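/- Throughout $\mathbb N=\{1,2,3,\dots\}$, $(e_k)$ is the unit vector basis of the space $c_{00}$ of finitely supported real sequences, $Ex$ is the restriction of $x\in c_{00}$ to $E\subseteq\mathbb N$, and $E<F$ means that every element of $E$ is smaller than every element of $F$. **Norms.** Let $\mathcal S_0$ consist of $\emptyset$ and the singletons of $\mathbb N$, and let $\mathcal S_{n+1}$ consist of the finite unions $G_1\cup\dots\cup G_k$ with $G_i\in\mathcal S_n$, $G_1<\dots<G_k$, $k\le\min\bigcup_i G_i$ (Schreier families; $\emptyset\in\mathcal S_{n+1}$). A finite sequence of nonempty finite sets $(E_i)$ with $\{\min E_i\}\in\mathcal S_n$ is $\mathcal S_n$-admissible if $E_1<E_2<\cdots$, and $\mathcal S_n$-allowable if the $E_i$ are pairwise disjoint. For a sequence $(\theta_n)_{n\ge1}$ in $(0,1)$ put $\|x\|_0=\sup_k|x_k|$, $\|x\|_{m+1}=\max\{\|x\|_m,\ \sup_n\theta_n\sup\sum_i\|E_ix\|_m\}$, the last supremum being over all $\mathcal S_n$-admissible $(E_i)$, and $\|x\|=\lim_m\|x\|_m$ (the norm of the mixed Tsirelson space $X$). The norm $\|x\|_{X_M}$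 of the modified space $X_M$ is defined in the same way with "allowable" in place of "admissible". **Hypotheses on $(\theta_n)$.** $(\theta_n)_{n\ge1}\subset(0,1)$ is regular, i.e. nonincreasing with $\theta_{m+n}\ge\theta_m\theta_n$, and satisfies $(\lnot\dag)$ $\lim_m\limsup_n\theta_{m+n}/\theta_n=0$, and $(\ddag)$ there is $F:\mathbb N\to\mathbb R$ with $F(n)\to0$ such that $\max_{1\le i\le R}\frac{\theta_{s_i+t}}{\theta_{s_i}}\le F(R)\sum_{i=1}^R\frac{\theta_{s_i+t}}{\theta_{s_i}}$ for all $R,t\in\mathbb N$ and all arithmetic progressions $(s_i)_{i=1}^R$ in $\mathbb N$ with positive difference. Fix such an $F$. **Parameters.** Let $N\in\mathbb N$ and let $V\subseteq\mathbb N$ be infinite. Call integers $p_1,\dots,p_N\ge1$ and $L_1,\dots,L_N\ge2$ *good* if * (A) $\theta_{p_{M+1}+n}/\theta_n\le\frac{\theta_1}{24N^2}\prod_{i=1}^M\theta_{L_ip_i}$ for $0\le M\le N-2$ and $n\ge p_N$, * (B) $p_{M+1}>\sum_{i=1}^ML_ip_i$ for $0<M\le N-2$, * (C) $F(L_{M+1})\le\frac{\theta_1}{144N^2}\prod_{i=1}^M\theta_{L_ip_i}$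 for $0\le M\le N-2$. For $k\in\mathbb N$ let $r_M(k)\in\{1,\dots,L_M\}$ be the number with $L_M\mid k-r_M(k)$. **Layered vectors.** An $\mathcal S_0$-repeated average is some $e_k$; an $\mathcal S_{q+1}$-repeated average is a vector $\frac1k(y_1+\dots+y_k)$, where $y_1,\dots,y_k$ are $\mathcal S_q$-repeated averages, $\operatorname{supp}y_1<\dots<\operatorname{supp}y_k$ and $k=\min\operatorname{supp}y_1$. A family $(x_j^M)_{0\le M\le N,\,j\ge1}$ in $c_{00}$ is *layered* (for $V$, $p_i$, $L_i$) if $(x_j^0)_j$ is a subsequence of $(e_k)_{k\in V}$ and, for each $0\le M<N$, there are successive nonempty integer intervals $I_1<I_2<\cdots$ with union $\mathbb N$ and a nonincreasing real sequence $(a_j)_{j\ge1}$ such that for all $k\in\mathbb N$ $$x_k^{M+1}=\sum_{j\in I_k}a_jx_j^M\quad\text{and}\quad \theta_q\sum_{j\in I_k}a_je_{m_j}\ \text{is an }\mathcal S_q\text{-repeated average},$$ where $q=r_{M+1}(k)\,p_{M+1}$ and $m_j=\min\operatorname{supp}x_j^M$. **Theorem.** Good integers $(p_i),(L_i)$ exist.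 For every choice of good integers, layered families exist, and for every layered family and every $k$ with $k\ge42N^2\prod_{i=1}^NL_i\theta_{L_ip_i}^{-1}$, the vector $x=x_k^N$ is a nonzero element of $\operatorname{span}\{e_v:v\in V\}$ and $$\|x\|\le\Bigl(\frac2N+4\theta_1^{-1}\sup_{r_1,\dots,r_{N-1}}\frac{\Theta_{p(r_1,\dots,r_{N-1},r_N(k))}}{\theta_{p(r_1,\dots,r_{N-1},r_N(k))}}\Bigr)\|x\|_{X_M}.$$ Here $p(r_1,\dots,r_N)=\sum_{i=1}^Np_ir_i$, the supremum is over $1\le r_i\le L_i$ ($1\le i\le N-1$), and $\Theta_q=\max\{\prod_{i=1}^N\theta_{\ell_i}:\ell_i\in\mathbb N,\ \sum_{i=1}^N\ell_i=q\}$. -/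

import Mathlib

open Filter Topology

namespace MixedTsirelson

/-! In the source `ℕ = {1, 2, 3, …}`.  Here the index type is Lean's `ℕ` and every index that the
source takes in its `ℕ` is required to be `≥ 1`; values of sequences at the index `0` play no role.
Finitely supported sequences are elements of `ℕ →₀ ℝ`, with `e_k = Finsupp.single k 1`. -/

/-- `E < F` for finite sets of natural numbers: every element of `E` is smaller than every element
of `F` (so `∅ < F` and `E < ∅` hold). -/
def SetLT (E F : Finset ℕ) : Prop := ∀ a ∈ E, ∀ b ∈ F, a < b

/-- The Schreier families `𝒮_n` of finite sets of positive integers: `𝒮_0` consists of the empty set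
and the singletons; `𝒮_{n+1}` of the unions `G_1 ∪ ⋯ ∪ G_k` with `G_i ∈ 𝒮_n`, `G_1 < ⋯ < G_k` and
`k` at most the minimum of the union (no condition if the union is empty). -/
def Schreier : ℕ → Set (Finset ℕ)
  | 0 => {F | F = ∅ ∨ ∃ m, 1 ≤ m ∧ F = {m}}
  | n + 1 => {F | ∃ (k : ℕ) (G : Fin k → Finset ℕ), (∀ i, G i ∈ Schreier n) ∧
      (∀ i j, i < j → SetLT (G i) (G j)) ∧ F = Finset.univ.biUnion G ∧ ∀ m ∈ F, k ≤ m}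

/-- The minimum of a nonempty finite set of natural numbers. -/
noncomputable def minOf (E : Finset ℕ) : ℕ := sInf (E : Set ℕ)

/-- `(E_i)` is `𝒮_n`-admissible: nonempty sets, `E_1 < ⋯ < E_r`, `{min E_i} ∈ 𝒮_n`. -/
def Admissible (n r : ℕ) (E : Fin r → Finset ℕ) : Prop :=
  (∀ i, (E i).Nonempty) ∧ (∀ i j, i < j → SetLT (E i) (E j)) ∧
    Finset.univ.image (fun i => minOf (E i)) ∈ Schreier n

/-- `(E_i)` is `𝒮_n`-allowable: nonempty pairwise disjoint sets with `{min E_i} ∈ 𝒮_n`. -/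
def Allowable (n r : ℕ) (E : Fin r → Finset ℕ) : Prop :=
  (∀ i, (E i).Nonempty) ∧ (∀ i j, i ≠ j → Disjoint (E i) (E j)) ∧
    Finset.univ.image (fun i => minOf (E i)) ∈ Schreier n

/-- The sequence of norms: the zeroth one is the sup norm, and the norm number `m + 1` of `x` is the
maximum of the norm number `m` of `x` and `sup_n θ_n sup ∑_i ‖E_i x‖_m`, where the sup is over
all `n ≥ 1` and all sequences `(E_i)` in the class `C n`. -/
noncomputable def iterNorm (C : ∀ _n r : ℕ, (Fin r → Finset ℕ) → Prop) (θ : ℕ → ℝ) :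
    ℕ → (ℕ →₀ ℝ) → ℝ
  | 0, x => ⨆ k, |x k|
  | m + 1, x => max (iterNorm C θ m x)
      (sSup {s | ∃ (n r : ℕ) (E : Fin r → Finset ℕ), 1 ≤ n ∧ C n r E ∧
        s = θ n * ∑ i, iterNorm C θ m (x.filter (fun j => j ∈ E i))})

/-- The norm of the mixed Tsirelson space `X = T[(𝒮_n, θ_n)_{n ≥ 1}]` on finitely supported
sequences, the limit (= supremum) of the increasing sequence of norms above. -/
noncomputable def normX (θ : ℕ → ℝ) (x : ℕ →₀ ℝ) : ℝ := ⨆ m, iterNorm Admissible θ m x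

/-- The norm of the modified mixed Tsirelson space `X_M = T_M[(𝒮_n, θ_n)_{n ≥ 1}]` on finitely
supported sequences. -/
noncomputable def normXM (θ : ℕ → ℝ) (x : ℕ →₀ ℝ) : ℝ := ⨆ m, iterNorm Allowable θ m x

/-- `(θ_n)_{n ≥ 1}` is a regular sequence in `(0, 1)`: nonincreasing with
`θ_{m+n} ≥ θ_m θ_n`. -/
structure RegularSeq (θ : ℕ → ℝ) : Prop where
  pos : ∀ n, 1 ≤ n → 0 < θ n
  lt_one : ∀ n, 1 ≤ n → θ n < 1
  antitone : ∀ m n, 1 ≤ m → m ≤ n → θ n ≤ θ m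
  mul_le : ∀ m n, 1 ≤ m → 1 ≤ n → θ m * θ n ≤ θ (m + n)

/-! The suprema in the definitions of the two norms are suprema of nonempty sets bounded by the
`ℓ¹`-norm, and the norms are the limits of the iterated ones. -/

theorem mul_sum_le_l1 {θ : ℕ → ℝ} (hθ : RegularSeq θ) {f : (ℕ →₀ ℝ) → ℝ}
    (hf : ∀ x, f x ≤ ∑ j ∈ x.support, |x j|) {n r : ℕ} (hn : 1 ≤ n) {E : Fin r → Finset ℕ}
    (hE : ∀ i j, i ≠ j → Disjoint (E i) (E j)) (x : ℕ →₀ ℝ) :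
    θ n * ∑ i, f (x.filter (fun j => j ∈ E i)) ≤ ∑ j ∈ x.support, |x j| := by
  have h1 : ∑ i, f (x.filter (fun j => j ∈ E i)) ≤ ∑ j ∈ x.support, |x j| := by
    calc ∑ i, f (x.filter (fun j => j ∈ E i))
        ≤ ∑ i, ∑ j ∈ x.support with j ∈ E i, |x j| := by
          refine Finset.sum_le_sum fun i _ => (hf _).trans (le_of_eq ?_)
          rw [Finsupp.support_filter]
          refine Finset.sum_congr rfl fun j hj => ?_
          rw [Finsupp.filter_apply_pos _ _ (Finset.mem_filter.1 hj).2]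
      _ = ∑ j ∈ Finset.univ.biUnion (fun i => {j ∈ x.support | j ∈ E i}), |x j| := by
          refine (Finset.sum_biUnion fun i _ k _ hik => ?_).symm
          refine Finset.disjoint_left.2 fun a ha hb => ?_
          exact Finset.disjoint_left.1 (hE i k hik) (Finset.mem_filter.1 ha).2
            (Finset.mem_filter.1 hb).2
      _ ≤ ∑ j ∈ x.support, |x j| := by
          refine Finset.sum_le_sum_of_subset_of_nonneg ?_ fun j _ _ => abs_nonneg _
          exact Finset.biUnion_subset.2 fun i _ => Finset.filter_subset _ _
  exact (mul_le_mul_of_nonneg_left h1 (hθ.pos n hn).le).trans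
    (mul_le_of_le_one_left (Finset.sum_nonneg fun j _ => abs_nonneg _) (hθ.lt_one n hn).le)

theorem iterNorm_le_l1 {C : ∀ _n r : ℕ, (Fin r → Finset ℕ) → Prop}
    (hC : ∀ n r E, C n r E → ∀ i j, i ≠ j → Disjoint (E i) (E j))
    {θ : ℕ → ℝ} (hθ : RegularSeq θ) (m : ℕ) (x : ℕ →₀ ℝ) :
    iterNorm C θ m x ≤ ∑ j ∈ x.support, |x j| := by
  induction m generalizing x with
  | zero =>
    refine ciSup_le fun k => ?_
    by_cases hk : k ∈ x.support
    · exact Finset.single_le_sum (f := fun j => |x j|) (fun j _ => abs_nonneg _) hk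
    · rw [Finsupp.notMem_support_iff.1 hk, abs_zero]
      exact Finset.sum_nonneg fun j _ => abs_nonneg _
  | succ m ih =>
    refine max_le (ih x) (Real.sSup_le ?_ (Finset.sum_nonneg fun j _ => abs_nonneg _))
    rintro s ⟨n, r, E, hn, hE, rfl⟩
    exact mul_sum_le_l1 hθ ih hn (hC n r E hE) x

theorem bddAbove_iterNorm_set {C : ∀ _n r : ℕ, (Fin r → Finset ℕ) → Prop}
    (hC : ∀ n r E, C n r E → ∀ i j, i ≠ j → Disjoint (E i) (E j))
    {θ : ℕ → ℝ} (hθ : RegularSeq θ) (m : ℕ) (x : ℕ →₀ ℝ) :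
    BddAbove {s | ∃ (n r : ℕ) (E : Fin r → Finset ℕ), 1 ≤ n ∧ C n r E ∧
        s = θ n * ∑ i, iterNorm C θ m (x.filter (fun j => j ∈ E i))} := by
  refine ⟨∑ j ∈ x.support, |x j|, ?_⟩
  rintro s ⟨n, r, E, hn, hE, rfl⟩
  exact mul_sum_le_l1 hθ (iterNorm_le_l1 hC hθ m) hn (hC n r E hE) x

theorem tendsto_iterNorm {C : ∀ _n r : ℕ, (Fin r → Finset ℕ) → Prop}
    (hC : ∀ n r E, C n r E → ∀ i j, i ≠ j → Disjoint (E i) (E j))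
    {θ : ℕ → ℝ} (hθ : RegularSeq θ) (x : ℕ →₀ ℝ) :
    Tendsto (fun m => iterNorm C θ m x) atTop (𝓝 (⨆ m, iterNorm C θ m x)) := by
  refine tendsto_atTop_ciSup (monotone_nat_of_le_succ fun m => le_max_left _ _) ?_
  exact ⟨_, by rintro _ ⟨m, rfl⟩; exact iterNorm_le_l1 hC hθ m x⟩

theorem tendsto_normX {θ : ℕ → ℝ} (hθ : RegularSeq θ) (x : ℕ →₀ ℝ) :
    Tendsto (fun m => iterNorm Admissible θ m x) atTop (𝓝 (normX θ x)) := by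
  refine tendsto_iterNorm (fun n r E hE i j hij => Finset.disjoint_left.2 fun a hi hj => ?_) hθ x
  rcases lt_or_gt_of_ne hij with h | h
  · exact lt_irrefl a (hE.2.1 i j h a hi a hj)
  · exact lt_irrefl a (hE.2.1 j i h a hj a hi)

theorem tendsto_normXM {θ : ℕ → ℝ} (hθ : RegularSeq θ) (x : ℕ →₀ ℝ) :
    Tendsto (fun m => iterNorm Allowable θ m x) atTop (𝓝 (normXM θ x)) :=
  tendsto_iterNorm (fun _ _ _ hE => hE.2.1) hθ x

/-- Condition `(¬†)`: `lim_m limsup_n θ_{m+n} / θ_n = 0`. -/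
def NotDagger (θ : ℕ → ℝ) : Prop :=
  Tendsto (fun m => limsup (fun n => θ (m + n) / θ n) atTop) atTop (𝓝 0)

/-- Condition `(‡)` with the function `F`: `F(n) → 0`, and
`max_i θ_{s_i+t} / θ_{s_i} ≤ F(R) ∑_i θ_{s_i+t} / θ_{s_i}` for every arithmetic progression
`s_i = a + i d`, `0 ≤ i < R`, of positive integers. -/
def DoubleDagger (θ F : ℕ → ℝ) : Prop :=
  Tendsto F atTop (𝓝 0) ∧
    ∀ R t a d : ℕ, 1 ≤ R → 1 ≤ t → 1 ≤ a → 1 ≤ d → ∀ i < R,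
      θ (a + i * d + t) / θ (a + i * d) ≤
        F R * ∑ j ∈ Finset.range R, θ (a + j * d + t) / θ (a + j * d)

/-- The `𝒮_p`-repeated averages: for `p = 0` the unit vectors `e_k`, and for `p + 1` the vectors
`(1/k) (y_1 + ⋯ + y_k)` with `𝒮_p`-repeated averages `y_1 < ⋯ < y_k` and
`k = min supp y_1`. -/
def IsRepeatedAverage : ℕ → (ℕ →₀ ℝ) → Prop
  | 0, x => ∃ k, 1 ≤ k ∧ x = Finsupp.single k 1
  | p + 1, x => ∃ (k : ℕ) (hk : 0 < k) (y : Fin k → (ℕ →₀ ℝ)),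
      (∀ i, IsRepeatedAverage p (y i)) ∧
      (∀ i j, i < j → SetLT (y i).support (y j).support) ∧
      minOf (y ⟨0, hk⟩).support = k ∧ x = (k : ℝ)⁻¹ • ∑ i, y i

/-- The conditions on the integers `p_1, …, p_N` and `L_1, …, L_N`. -/
structure IsParam (θ F : ℕ → ℝ) (N : ℕ) (p L : ℕ → ℕ) : Prop where
  p_pos : ∀ i, 1 ≤ i → i ≤ N → 1 ≤ p i
  two_le_L : ∀ i, 1 ≤ i → i ≤ N → 2 ≤ L i
  condA : ∀ M, M + 2 ≤ N → ∀ n, p N ≤ n →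
    θ (p (M + 1) + n) / θ n ≤
      θ 1 / (24 * (N : ℝ) ^ 2) * ∏ i ∈ Finset.Icc 1 M, θ (L i * p i)
  condB : ∀ M, 0 < M → M + 2 ≤ N → ∑ i ∈ Finset.Icc 1 M, L i * p i < p (M + 1)
  condC : ∀ M, M + 2 ≤ N →
    F (L (M + 1)) ≤ θ 1 / (144 * (N : ℝ) ^ 2) * ∏ i ∈ Finset.Icc 1 M, θ (L i * p i)

/-- For `k ≥ 1`, the element `r` of `{1, …, ℓ}` with `ℓ ∣ k - r`. -/
def residue (ℓ k : ℕ) : ℕ := (k - 1) % ℓ + 1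

/-- `x M j` (`0 ≤ M ≤ N`, `j ≥ 1`) are layered vectors `x_j^M`: `(x_j^0)_j` is a subsequence of
`(e_k)_{k ∈ V}`, and each `x_k^{M+1}` is a combination of the `x_j^M` over the `k`-th of successive
integer intervals partitioning `{1, 2, …}`, whose coefficients `a_j`, nonincreasing in `j`, are
such that `θ_q ∑ a_j e_{min supp x_j^M}` is an `𝒮_q`-repeated average with
`q = r_{M+1}(k) p_{M+1}`. -/
structure IsLayered (θ : ℕ → ℝ) (N : ℕ) (V : Set ℕ) (p L : ℕ → ℕ)
    (x : ℕ → ℕ → (ℕ →₀ ℝ)) : Prop where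
  base : ∃ n : ℕ → ℕ, (∀ i j, 1 ≤ i → i < j → n i < n j) ∧
    ∀ j, 1 ≤ j → n j ∈ V ∧ x 0 j = Finsupp.single (n j) 1
  step : ∀ M < N, ∃ (I : ℕ → Finset ℕ) (a : ℕ → ℝ),
    (∀ k, 1 ≤ k → ∃ u v, u ≤ v ∧ I k = Finset.Icc u v) ∧
    (∀ k, 1 ≤ k → SetLT (I k) (I (k + 1))) ∧
    (∀ j, 1 ≤ j ↔ ∃ k, 1 ≤ k ∧ j ∈ I k) ∧
    (∀ i j, 1 ≤ i → i ≤ j → a j ≤ a i) ∧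
    ∀ k, 1 ≤ k →
      x (M + 1) k = ∑ j ∈ I k, a j • x M j ∧
      IsRepeatedAverage (residue (L (M + 1)) k * p (M + 1))
        (θ (residue (L (M + 1)) k * p (M + 1)) •
          ∑ j ∈ I k, Finsupp.single (minOf (x M j).support) (a j))

/-- `Θ_q = Θ_q(N)`, the maximum of `θ_{ℓ_1} ⋯ θ_{ℓ_N}` over positive integers with
`ℓ_1 + ⋯ + ℓ_N = q` (a maximum over a finite set, nonempty when `1 ≤ N ≤ q`). -/
noncomputable def bigTheta (θ : ℕ → ℝ) (N q : ℕ) : ℝ :=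
  sSup {s | ∃ l : Fin N → ℕ, (∀ i, 1 ≤ l i) ∧ ∑ i, l i = q ∧ s = ∏ i, θ (l i)}

/-- `sup_{r_1, …, r_{N-1}} Θ_q / θ_q` with `q = p_1 r_1 + ⋯ + p_N r_N`, over `1 ≤ r_i ≤ L_i`
for `i < N`, where `r_N = rN` is fixed (a supremum over a finite nonempty set). -/
noncomputable def supRatio (θ : ℕ → ℝ) (N : ℕ) (p L : ℕ → ℕ) (rN : ℕ) : ℝ :=
  sSup {s | ∃ r : ℕ → ℕ, (∀ i, 1 ≤ i → i < N → 1 ≤ r i ∧ r i ≤ L i) ∧ r N = rN ∧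
    s = bigTheta θ N (∑ i ∈ Finset.Icc 1 N, p i * r i) / θ (∑ i ∈ Finset.Icc 1 N, p i * r i)}

end MixedTsirelson

namespace MixedTsirelson

/-! ### Schreier families -/

/-! Multiply each coefficient of x = x_k^N at a point v by the numbers θ_{r_l p_l} of the N layers
above v. The result is a probability vector (`Tower.nrm`), because every layer is, up to its θ, a
repeated average. Both norms are measured against it.

Lower bounds in X_M. Write t_M(v) for the sum of the indices r_l p_l of the layers l > M above v
(`tail`), and call the list of these indices the type of v. For each M < N, use the layers up to M
as they are and replace all higher ones by a single step. The level-M vectors of one type have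
minima in the Schreier family of order t_M, so one factor θ_{t_M} sums them. Vectors of different
types interlace, but there are at most k types, so one more 𝒮_1-step sums over the types at the cost
of θ_1. That step needs sets that are disjoint but not successive, which is exactly what the
modified norm permits. Hence θ_1 · dens_M is norming, where dens_M = θ_{t_M} ∏_{l ≤ M} θ_{r_l p_l}
(`norming_tail`). Also ‖x‖_{X_M} ≥ 1.

Upper bound in X. The norm is a supremum over tree functionals (`normX_le_of_tree`). On the branch
of a tree leading to v, let d_M be the first depth whose node meets at most L_1 ⋯ L_M vectors of
level M (`stopDepth`); it is nonincreasing in M. Let o_M be the sum of the Schreier indices used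
down to depth d_M. The weight of v in the functional is at most θ_{o_M}, by regularity. The points
are split as follows (`wt_mul_le`).

If o_M < t_M for some M, the points concerned have small mass: a repeated average of order q is
small on sets of lower Schreier order, and this smallness propagates through the layers
(`IsRepeatedAverage.average_le`, `sum_nrm_le`). If o_M ≥ t_M + p_{M+1}, condition (A) makes the
weight negligible against dens_M. If the branch has at least N nodes, the weight is a product of at
least N of the θ's with index sum at least t_0, hence at most Θ_{t_0}, that is, at most the supremum
of Θ/θ times dens_0; this is the main term.

Otherwise d_0 ≤ N - 1 and d_{N-1} ≥ 1, and a pigeonhole argument gives M with d_M = d_{M+1} = N - 1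
- M (`exists_eq_sub`). All points under one node of depth d_M - 1 share the order at depth d_M, and
t_M ≤ o_M < t_M + p_{M+1}. So, below a common vector of level M + 2, the node determines the residue
r_{M+1}. As that node meets more than L_{M+1} vectors of level M + 1, stuck points occupy at most
two vectors in any run of L_{M+1} consecutive siblings. By (‡) each such vector carries at most a
fraction F(L_{M+1}) of the dens_M-mass of its run, and (C) makes this negligible
(`sum_stuck_dens_le`). Siblings with no full run behind them are discarded because each coefficient
is at most 1/k (`sum_initial_le`).

Existence. The integers p_1, L_1, p_2, L_2, … are chosen successively, and p_N is enlarged at the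
end. Layered families are built on a subsequence of V so sparse that coefficients cannot increase
from one block to the next. -/

theorem empty_mem_schreier (n : ℕ) : ∅ ∈ Schreier n := by
  cases n with
  | zero => exact Or.inl rfl
  | succ n => exact ⟨0, fun _ => ∅, fun i => i.elim0, fun i => i.elim0, by simp, by simp⟩

theorem one_le_of_mem_schreier {n : ℕ} {F : Finset ℕ} (hF : F ∈ Schreier n) :
    ∀ m ∈ F, 1 ≤ m := by
  induction n generalizing F with
  | zero =>
    rcases hF with rfl | ⟨m, hm, rfl⟩
    · simp
    · simpa using hm
  | succ n ih =>
    obtain ⟨k, G, hG, -, rfl, -⟩ := hF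
    intro m hm
    obtain ⟨i, -, hi⟩ := Finset.mem_biUnion.1 hm
    exact ih (hG i) m hi

/-- Unions of successive `𝒮_a` sets, whose minima are dominated from below by a set in `𝒮_n`,
belong to `𝒮_{n+a}`. -/
theorem schreier_biUnion {n a : ℕ} {F : Finset ℕ} (hF : F ∈ Schreier n) {H : ℕ → Finset ℕ}
    (hH : ∀ u ∈ F, H u ∈ Schreier a) (hle : ∀ u ∈ F, ∀ g ∈ H u, u ≤ g)
    (hlt : ∀ u ∈ F, ∀ w ∈ F, u < w → SetLT (H u) (H w)) :
    F.biUnion H ∈ Schreier (n + a) := by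
  induction n generalizing F with
  | zero =>
    rcases hF with rfl | ⟨m, hm, rfl⟩
    · simpa using empty_mem_schreier _
    · simpa using hH m (by simp)
  | succ n ih =>
    obtain ⟨k, G, hG, hGlt, rfl, hk⟩ := hF
    have hmem : ∀ i, ∀ u ∈ G i, u ∈ Finset.univ.biUnion G := fun i u hu =>
      Finset.mem_biUnion.2 ⟨i, Finset.mem_univ _, hu⟩
    rw [Nat.succ_add]
    refine ⟨k, fun i => (G i).biUnion H, fun i => ?_, fun i j hij => ?_, ?_, ?_⟩
    · exact ih (hG i) (fun u hu => hH u (hmem i u hu)) (fun u hu => hle u (hmem i u hu))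
        fun u hu w hw => hlt u (hmem i u hu) w (hmem i w hw)
    · intro g hg g' hg'
      obtain ⟨u, hu, hgu⟩ := Finset.mem_biUnion.1 hg
      obtain ⟨w, hw, hgw⟩ := Finset.mem_biUnion.1 hg'
      exact hlt u (hmem i u hu) w (hmem j w hw) (hGlt i j hij u hu w hw) g hgu g' hgw
    · rw [Finset.biUnion_biUnion]
    · intro m hm
      obtain ⟨u, hu, hmu⟩ := Finset.mem_biUnion.1 hm
      exact (hk u hu).trans (hle u hu m hmu)

theorem singleton_mem_schreier_zero {m : ℕ} (hm : 1 ≤ m) : {m} ∈ Schreier 0 :=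
  Or.inr ⟨m, hm, rfl⟩

/-- Heredity is the case a = 0 of `schreier_biUnion`: replace each point of F by its singleton or by
the empty set. -/
theorem schreier_subset {n : ℕ} {F G : Finset ℕ} (hF : F ∈ Schreier n) (hG : G ⊆ F) :
    G ∈ Schreier n := by
  have h := schreier_biUnion (a := 0) hF (H := fun u => if u ∈ G then {u} else ∅)
    (fun u hu => by
      split_ifs
      · exact singleton_mem_schreier_zero (one_le_of_mem_schreier hF u hu)
      · exact empty_mem_schreier 0)
    (fun u _ g hg => by
      split_ifs at hg
      · rw [Finset.mem_singleton.1 hg]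
      · simp at hg)
    (fun u _ w _ huw g hg g' hg' => by
      split_ifs at hg hg'
      · rw [Finset.mem_singleton.1 hg, Finset.mem_singleton.1 hg']; exact huw
      all_goals simp_all)
  have he : G = F.biUnion fun u => if u ∈ G then {u} else ∅ := by
   ext u
   rw [Finset.mem_biUnion]
   constructor
   · intro hu
     exact ⟨u, hG hu, by simp [hu]⟩
   · rintro ⟨w, _, hw⟩
     split_ifs at hw with hwG
     · rw [Finset.mem_singleton.1 hw]; exact hwG
     · simp at hw
  rw [he]
  exact h

theorem schreier_subset_succ {n : ℕ} {F : Finset ℕ} (hF : F ∈ Schreier n) :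
    F ∈ Schreier (n + 1) :=
  ⟨1, fun _ => F, fun _ => hF, fun i j hij => by omega, by simp, one_le_of_mem_schreier hF⟩

theorem schreier_mono {n n' : ℕ} (h : n ≤ n') {F : Finset ℕ} (hF : F ∈ Schreier n) :
    F ∈ Schreier n' := by
  induction n', h using Nat.le_induction with
  | base => exact hF
  | succ m _ ih => exact schreier_subset_succ ih

theorem singleton_mem_schreier (n : ℕ) {m : ℕ} (hm : 1 ≤ m) : {m} ∈ Schreier n :=
  schreier_mono (Nat.zero_le n) (singleton_mem_schreier_zero hm)

/-- A set of at most `min F` positive integers is in `𝒮_1`. -/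
theorem mem_schreier_one {F : Finset ℕ} (h1 : ∀ m ∈ F, 1 ≤ m) (hF : ∀ m ∈ F, F.card ≤ m) :
    F ∈ Schreier 1 := by
  refine ⟨F.card, fun i => {F.orderEmbOfFin rfl i}, fun i => ?_, fun i j hij => ?_, ?_, hF⟩
  · exact singleton_mem_schreier_zero (h1 _ (Finset.orderEmbOfFin_mem F rfl i))
  · intro a ha b hb
    rw [Finset.mem_singleton.1 ha, Finset.mem_singleton.1 hb]
    exact (F.orderEmbOfFin rfl).strictMono hij
  · ext u
    have := Finset.range_orderEmbOfFin F rfl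
    have h2 : u ∈ F ↔ u ∈ Set.range (F.orderEmbOfFin rfl) := by rw [this]; simp
    rw [h2]
    simp only [Set.mem_range, Finset.mem_biUnion, Finset.mem_univ, true_and,
      Finset.mem_singleton]
    exact exists_congr fun _ => eq_comm

/-! ### Minima and supports -/

theorem minOf_mem {E : Finset ℕ} (h : E.Nonempty) : minOf E ∈ E := by
  have := Nat.sInf_mem (s := (E : Set ℕ)) (by simpa using h)
  simpa [minOf] using this

theorem minOf_le {E : Finset ℕ} {v : ℕ} (h : v ∈ E) : minOf E ≤ v :=
  Nat.sInf_le (by simpa using h)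

theorem minOf_eq {E : Finset ℕ} {m : ℕ} (hm : m ∈ E) (h : ∀ v ∈ E, m ≤ v) : minOf E = m :=
  le_antisymm (minOf_le hm) (h _ (minOf_mem ⟨m, hm⟩))

theorem SetLT.disjoint {E F : Finset ℕ} (h : SetLT E F) : Disjoint E F :=
  Finset.disjoint_left.2 fun a ha hb => lt_irrefl a (h a ha a hb)

theorem support_sum_of_nonneg {ι : Type*} {s : Finset ι} {y : ι → (ℕ →₀ ℝ)}
    (h : ∀ i ∈ s, ∀ v, 0 ≤ y i v) : (∑ i ∈ s, y i).support = s.biUnion fun i => (y i).support := by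
  ext v
  simp only [Finsupp.mem_support_iff, Finset.mem_biUnion, Finsupp.finsetSum_apply]
  rw [Ne, Finset.sum_eq_zero_iff_of_nonneg fun i hi => h i hi v]
  simp

theorem support_smul_pos {c : ℝ} (hc : 0 < c) (y : ℕ →₀ ℝ) : (c • y).support = y.support := by
  ext v
  simp [hc.ne']

/-! ### Repeated averages -/

theorem IsRepeatedAverage.basic {q : ℕ} {y : ℕ →₀ ℝ} (hy : IsRepeatedAverage q y) :
    (∀ v, 0 ≤ y v) ∧ y.support.Nonempty ∧ y.support ∈ Schreier q ∧
      ∑ v ∈ y.support, y v = 1 := by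
  induction q generalizing y with
  | zero =>
    obtain ⟨k, hk, rfl⟩ := hy
    have hs : (Finsupp.single k (1 : ℝ)).support = {k} := by
      rw [Finsupp.support_single _ one_ne_zero]
    refine ⟨fun v => ?_, ?_, ?_, ?_⟩
    · rw [Finsupp.single_apply]; split_ifs <;> norm_num
    · rw [hs]; simp
    · rw [hs]; exact singleton_mem_schreier_zero hk
    · rw [hs]; simp
  | succ q ih =>
    obtain ⟨k, hk, z, hz, hlt, hmin, rfl⟩ := hy
    have hkpos : (0 : ℝ) < (k : ℝ)⁻¹ := by positivity
    have hs : ((k : ℝ)⁻¹ • ∑ i, z i).support = Finset.univ.biUnion fun i => (z i).support := by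
      rw [support_smul_pos hkpos, support_sum_of_nonneg fun i _ => (ih (hz i)).1]
    have hdisj : ∀ i j, i ≠ j → Disjoint (z i).support (z j).support := by
      intro i j hij
      rcases lt_or_gt_of_ne hij with h | h
      · exact (hlt i j h).disjoint
      · exact (hlt j i h).disjoint.symm
    refine ⟨fun v => ?_, ?_, ?_, ?_⟩
    · rw [Finsupp.smul_apply, Finsupp.finsetSum_apply]
      exact mul_nonneg hkpos.le (Finset.sum_nonneg fun i _ => (ih (hz i)).1 v)
    · obtain ⟨v, hv⟩ := (ih (hz ⟨0, hk⟩)).2.1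
      rw [hs]
      exact ⟨v, Finset.mem_biUnion.2 ⟨_, Finset.mem_univ _, hv⟩⟩
    · rw [hs]
      refine ⟨k, fun i => (z i).support, fun i => (ih (hz i)).2.2.1, hlt, rfl, ?_⟩
      intro m hm
      obtain ⟨i, -, hi⟩ := Finset.mem_biUnion.1 hm
      rw [← hmin]
      have h0 := minOf_mem (ih (hz ⟨0, hk⟩)).2.1
      rcases Nat.eq_zero_or_pos i.1 with h | h
      · have : i = ⟨0, hk⟩ := Fin.ext h
        rw [this] at hi
        exact minOf_le hi
      · exact (hlt ⟨0, hk⟩ i h _ h0 m hi).le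
    · rw [hs, Finset.sum_biUnion fun i _ j _ hij => hdisj i j hij]
      have h1 : ∀ i, ∑ v ∈ (z i).support, ((k : ℝ)⁻¹ • ∑ i, z i) v = (k : ℝ)⁻¹ := by
        intro i
        have : ∀ v ∈ (z i).support, ((k : ℝ)⁻¹ • ∑ i, z i) v = (k : ℝ)⁻¹ * z i v := by
          intro v hv
          rw [Finsupp.smul_apply, Finsupp.finsetSum_apply, smul_eq_mul,
            Finset.sum_eq_single i]
          · intro j _ hj
            exact Finsupp.notMem_support_iff.1 (Finset.disjoint_left.1 (hdisj i j hj.symm) hv)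
          · simp
        rw [Finset.sum_congr rfl this, ← Finset.mul_sum, (ih (hz i)).2.2.2, mul_one]
      rw [Finset.sum_congr rfl fun i _ => h1 i]
      simp [hk.ne']

theorem IsRepeatedAverage.apply_le_one {q : ℕ} {y : ℕ →₀ ℝ} (hy : IsRepeatedAverage q y) (v : ℕ) :
    y v ≤ 1 := by
  by_cases hv : v ∈ y.support
  · rw [← hy.basic.2.2.2]
    exact Finset.single_le_sum (f := fun v => y v) (fun i _ => hy.basic.1 i) hv
  · rw [Finsupp.notMem_support_iff.1 hv]; exact zero_le_one

/-- The decomposition of a repeated average of order `q + 1`. -/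
theorem IsRepeatedAverage.decomp {q : ℕ} {y : ℕ →₀ ℝ} (hy : IsRepeatedAverage (q + 1) y) :
    ∃ (k : ℕ) (z : Fin k → (ℕ →₀ ℝ)), minOf y.support = k ∧ 0 < k ∧
      (∀ i, IsRepeatedAverage q (z i)) ∧
      (∀ i j, i < j → SetLT (z i).support (z j).support) ∧
      (y.support = Finset.univ.biUnion fun i => (z i).support) ∧
      ∀ i, ∀ v ∈ (z i).support, y v = (k : ℝ)⁻¹ * z i v := by
  obtain ⟨k, hk, z, hz, hlt, hmin, rfl⟩ := hy
  have hkpos : (0 : ℝ) < (k : ℝ)⁻¹ := by positivity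
  have hs : ((k : ℝ)⁻¹ • ∑ i, z i).support = Finset.univ.biUnion fun i => (z i).support := by
    rw [support_smul_pos hkpos, support_sum_of_nonneg fun i _ => (hz i).basic.1]
  have hdisj : ∀ i j, i ≠ j → Disjoint (z i).support (z j).support := by
    intro i j hij
    rcases lt_or_gt_of_ne hij with h | h
    · exact (hlt i j h).disjoint
    · exact (hlt j i h).disjoint.symm
  have hm : minOf ((k : ℝ)⁻¹ • ∑ i, z i).support = k := by
    have h0 := minOf_mem (hz ⟨0, hk⟩).basic.2.1
    rw [hs]
    refine minOf_eq ?_ fun v hv => ?_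
    · rw [hmin] at h0
      exact Finset.mem_biUnion.2 ⟨_, Finset.mem_univ _, h0⟩
    · obtain ⟨i, -, hi⟩ := Finset.mem_biUnion.1 hv
      rw [← hmin]
      rcases Nat.eq_zero_or_pos i.1 with h | h
      · have : i = ⟨0, hk⟩ := Fin.ext h
        rw [this] at hi
        exact minOf_le hi
      · exact (hlt ⟨0, hk⟩ i h _ h0 v hi).le
  refine ⟨k, z, hm, hk, hz, hlt, hs, fun i v hv => ?_⟩
  rw [Finsupp.smul_apply, Finsupp.finsetSum_apply, smul_eq_mul, Finset.sum_eq_single i]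
  · intro j _ hj
    exact Finsupp.notMem_support_iff.1 (Finset.disjoint_left.1 (hdisj i j hj.symm) hv)
  · simp

theorem IsRepeatedAverage.apply_le_inv {q : ℕ} {y : ℕ →₀ ℝ} (hy : IsRepeatedAverage q y)
    (hq : 1 ≤ q) {v : ℕ} : y v ≤ (minOf y.support : ℝ)⁻¹ := by
  obtain ⟨q, rfl⟩ := Nat.exists_eq_add_of_le' hq
  obtain ⟨k, z, hk, -, hz, -, hs, hv⟩ := hy.decomp
  by_cases h : v ∈ y.support
  · rw [hs] at h
    obtain ⟨i, -, hi⟩ := Finset.mem_biUnion.1 h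
    rw [hv i v hi, hk]
    exact mul_le_of_le_one_right (by positivity) ((hz i).apply_le_one v)
  · rw [Finsupp.notMem_support_iff.1 h]; positivity

/-- An average of positive order has min supp many nonempty blocks. Consequently whatever comes
after it starts beyond twice its minimum; this doubling gives the geometric decay in
`IsRepeatedAverage.average_le`. -/
theorem IsRepeatedAverage.minOf_le_card {q : ℕ} {y : ℕ →₀ ℝ} (hy : IsRepeatedAverage q y)
    (hq : 1 ≤ q) : minOf y.support ≤ y.support.card := by
  obtain ⟨q, rfl⟩ := Nat.exists_eq_add_of_le' hq
  obtain ⟨k, z, hk, -, hz, hlt, hs, -⟩ := hy.decomp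
  have hdisj : ∀ i j, i ≠ j → Disjoint (z i).support (z j).support := by
    intro i j hij
    rcases lt_or_gt_of_ne hij with h | h
    · exact (hlt i j h).disjoint
    · exact (hlt j i h).disjoint.symm
  have h1 : y.support.card = ∑ i, (z i).support.card := by
    conv_lhs => rw [hs]
    rw [Finset.card_biUnion fun i _ j _ hij => hdisj i j hij]
  rw [h1, hk]
  calc k = ∑ _i : Fin k, 1 := by simp
    _ ≤ _ := Finset.sum_le_sum fun i _ => (hz i).basic.2.1.card_pos

theorem two_mul_minOf_le {E : Finset ℕ} (hE : minOf E ≤ E.card) {u : ℕ}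
    (hu : ∀ v ∈ E, v < u) : 2 * minOf E ≤ u := by
  rcases E.eq_empty_or_nonempty with rfl | hne
  · simp [minOf]
  have h1 : E ⊆ Finset.Ico (minOf E) u := fun v hv =>
    Finset.mem_Ico.2 ⟨minOf_le hv, hu v hv⟩
  have h2 := Finset.card_le_card h1
  rw [Nat.card_Ico] at h2
  have := hu _ (minOf_mem hne)
  omega

/-- The bound 16 / 2^l beats the trivial bound 1 from l = 4 on, so four terms cost 1 each and the
remaining geometric series costs at most 2. -/
theorem sum_range_le_eight {e : ℕ → ℝ} {i₀ : ℕ} (h0 : ∀ i < i₀, e i = 0) (h1 : ∀ i, e i ≤ 1)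
    (h2 : ∀ l, 1 ≤ l → e (i₀ + l) ≤ 16 / 2 ^ l) (k : ℕ) : ∑ i ∈ Finset.range k, e i ≤ 8 := by
  rcases le_total k i₀ with hk | hk
  · rw [Finset.sum_eq_zero fun i hi => h0 i ((Finset.mem_range.1 hi).trans_le hk)]
    norm_num
  obtain ⟨n, rfl⟩ := Nat.exists_eq_add_of_le hk
  rw [Finset.sum_range_add, Finset.sum_eq_zero fun i hi => h0 i (Finset.mem_range.1 hi), zero_add]
  let w : ℕ → ℝ := fun l => if l < 4 then 1 else 16 / 2 ^ l
  have hw : ∀ l, e (i₀ + l) ≤ w l := by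
    intro l
    simp only [w]
    split_ifs with h
    · exact h1 _
    · exact h2 l (by omega)
  have hw0 : ∀ l, 0 ≤ w l := by
    intro l
    simp only [w]
    split_ifs <;> positivity
  calc ∑ l ∈ Finset.range n, e (i₀ + l) ≤ ∑ l ∈ Finset.range n, w l :=
        Finset.sum_le_sum fun l _ => hw l
    _ ≤ ∑ l ∈ Finset.range (4 + n), w l :=
        Finset.sum_le_sum_of_subset_of_nonneg
          (Finset.range_subset_range.2 (by omega)) fun l _ _ => hw0 l
    _ = 4 + ∑ l ∈ Finset.range n, ((1 : ℝ) / 2) ^ l := by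
        rw [Finset.sum_range_add]
        congr 1
        · simp [w, Finset.sum_range_succ]; norm_num
        · refine Finset.sum_congr rfl fun l _ => ?_
          simp only [w]
          rw [if_neg (by omega), pow_add, one_div, inv_pow]
          field_simp
          norm_num
    _ ≤ 8 := by linarith [sum_geometric_two_le n]

/-- If the set functions `φ u` are small on `𝒮_s`, `s < q'`, then their average with respect to a
repeated average of order `q` is small on `𝒮_s`, `s < q + q'`. -/
theorem IsRepeatedAverage.average_le {q q' : ℕ} {y : ℕ →₀ ℝ} (hy : IsRepeatedAverage q y)
    {φ : ℕ → Finset ℕ → ℝ} (h0 : ∀ u ∈ y.support, ∀ G, 0 ≤ φ u G)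
    (h1 : ∀ u ∈ y.support, ∀ G, φ u G ≤ 1)
    (hsub : ∀ u ∈ y.support, ∀ (k : ℕ) (G : Fin k → Finset ℕ),
      φ u (Finset.univ.biUnion G) ≤ ∑ i, φ u (G i))
    (hloc : ∀ u ∈ y.support, ∀ G, φ u G ≠ 0 →
      ∃ g ∈ G, u ≤ g ∧ ∀ u' ∈ y.support, u < u' → g < u')
    (hgrow : 1 ≤ q' → ∀ u ∈ y.support, ∀ u' ∈ y.support, u < u' → 2 * u ≤ u')
    (hsmall : ∀ u ∈ y.support, ∀ s < q', ∀ G ∈ Schreier s, φ u G ≤ 8 / u)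
    {s : ℕ} (hs : s < q + q') {G : Finset ℕ} (hG : G ∈ Schreier s) :
    ∑ u ∈ y.support, y u * φ u G ≤ 8 / minOf y.support := by
  induction q generalizing y s G with
  | zero =>
    obtain ⟨k, hk, rfl⟩ := hy
    have hsupp : (Finsupp.single k (1 : ℝ)).support = {k} := by
      rw [Finsupp.support_single _ one_ne_zero]
    have hmin : minOf ({k} : Finset ℕ) = k := minOf_eq (by simp) (by simp)
    rw [hsupp] at hsmall ⊢
    rw [hmin]
    simpa using hsmall k (by simp) s (by omega) G hG
  | succ q ih =>
    obtain ⟨k, z, hkmin, hk, hz, hlt, hsupp, hval⟩ := hy.decomp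
    have hsubset : ∀ i, (z i).support ⊆ y.support := fun i v hv => by
      rw [hsupp]; exact Finset.mem_biUnion.2 ⟨i, Finset.mem_univ _, hv⟩
    have hdisj : ∀ i j, i ≠ j → Disjoint (z i).support (z j).support := by
      intro i j hij
      rcases lt_or_gt_of_ne hij with h | h
      · exact (hlt i j h).disjoint
      · exact (hlt j i h).disjoint.symm
    let ψ : Fin k → Finset ℕ → ℝ := fun i G => ∑ u ∈ (z i).support, z i u * φ u G
    have hψ1 : ∀ i G, ψ i G ≤ 1 := by
      intro i G
      rw [← (hz i).basic.2.2.2]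
      exact Finset.sum_le_sum fun u hu =>
        mul_le_of_le_one_right ((hz i).basic.1 u) (h1 u (hsubset i hu) G)
    have hsum : ∑ u ∈ y.support, y u * φ u G = (k : ℝ)⁻¹ * ∑ i, ψ i G := by
      conv_lhs => rw [hsupp]
      rw [Finset.sum_biUnion fun i _ j _ hij => hdisj i j hij, Finset.mul_sum]
      refine Finset.sum_congr rfl fun i _ => ?_
      rw [Finset.mul_sum]
      refine Finset.sum_congr rfl fun u hu => ?_
      rw [hval i u hu, mul_assoc]
    have hih : ∀ i, ∀ t < q + q', ∀ G ∈ Schreier t, ψ i G ≤ 8 / minOf (z i).support :=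
      fun i t ht G hG => ih (hz i) (fun u hu => h0 u (hsubset i hu))
        (fun u hu => h1 u (hsubset i hu)) (fun u hu => hsub u (hsubset i hu))
        (fun u hu G hG => by
          obtain ⟨g, hg, hug, h⟩ := hloc u (hsubset i hu) G hG
          exact ⟨g, hg, hug, fun u' hu' => h u' (hsubset i hu')⟩)
        (fun h u hu u' hu' => hgrow h u (hsubset i hu) u' (hsubset i hu'))
        (fun u hu => hsmall u (hsubset i hu)) ht hG
    -- The factor 1/k of the outer average supplies the whole gain 8 / min, so only an absolute
    -- bound for the sum over the blocks is needed.
    suffices hmain : ∑ i, ψ i G ≤ 8 by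
      rw [hsum, hkmin, div_eq_inv_mul]
      exact mul_le_mul_of_nonneg_left hmain (by positivity)
    let e : ℕ → ℝ := fun i => if h : i < k then ψ ⟨i, h⟩ G else 0
    have he : ∑ i, ψ i G = ∑ i ∈ Finset.range k, e i := by
      rw [← Fin.sum_univ_eq_sum_range]
      exact Finset.sum_congr rfl fun i _ => by simp [e]
    rw [he]
    by_cases hex : ∃ i, e i ≠ 0
    swap
    · push Not at hex
      rw [Finset.sum_eq_zero fun i _ => hex i]
      norm_num
    classical
    -- At the first block that sees G, locality yields a point g of G lying to the left of all later
    -- blocks. The number of pieces of G is at most g, hence small against those blocks.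
    let i₀ := Nat.find hex
    have hi₀ : e i₀ ≠ 0 := Nat.find_spec hex
    have hi₀k : i₀ < k := by
      by_contra h
      exact hi₀ (by simp [e, h])
    have hψi₀ : ψ ⟨i₀, hi₀k⟩ G ≠ 0 := by simpa [e, hi₀k] using hi₀
    obtain ⟨u₀, hu₀, hφ⟩ := Finset.exists_ne_zero_of_sum_ne_zero hψi₀
    obtain ⟨g, hgG, hu₀g, hg⟩ := hloc u₀ (hsubset _ hu₀) G (right_ne_zero_of_mul hφ)
    refine sum_range_le_eight (i₀ := i₀) (fun i hi => ?_) (fun i => ?_) (fun l hl => ?_) k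
    · by_contra h
      exact Nat.find_min hex hi h
    · simp only [e]
      split_ifs
      · exact hψ1 _ _
      · exact zero_le_one
    by_cases hik : i₀ + l < k
    swap
    · simp only [e, hik, dif_neg, not_false_eq_true]
      positivity
    have hlt0 : ∀ u ∈ (z ⟨i₀ + l, hik⟩).support, g < u := fun u hu =>
      hg u (hsubset _ hu) (hlt ⟨i₀, hi₀k⟩ _ (by simp only [Fin.mk_lt_mk]; omega) u₀ hu₀ u hu)
    have heq : e (i₀ + l) = ψ ⟨i₀ + l, hik⟩ G := by simp only [e, hik, dif_pos]
    rw [heq]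
    have hG' : G ∈ Schreier (q + q') := schreier_mono (by omega) hG
    -- When q + q' = 0 there is no lower Schreier family to decompose into, but then G is the
    -- singleton {g} and the later blocks do not see it.
    rcases Nat.eq_zero_or_pos (q + q') with hqq | hqq
    · rw [hqq] at hG'
      have hGg : G = {g} := by
        rcases hG' with rfl | ⟨m, -, rfl⟩
        · simp at hgG
        · rw [Finset.mem_singleton.1 hgG]
      have : ψ ⟨i₀ + l, hik⟩ G = 0 := by
        refine Finset.sum_eq_zero fun u hu => ?_
        by_contra hne
        obtain ⟨g', hg', hug', -⟩ := hloc u (hsubset _ hu) G (right_ne_zero_of_mul hne)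
        rw [hGg, Finset.mem_singleton] at hg'
        have := hlt0 u hu
        omega
      rw [this]
      positivity
    obtain ⟨t, ht⟩ := Nat.exists_eq_add_of_le' hqq
    rw [ht] at hG'
    obtain ⟨D, H, hH, -, hGH, hD⟩ := hG'
    let κ : ℕ → ℕ := fun i => if h : i < k then minOf (z ⟨i, h⟩).support else 0
    -- Doubling of the block minima comes from the size of the blocks when q ≥ 1. When q = 0 the
    -- blocks are single points, and it comes from the growth assumption on the points.
    have hκ : ∀ i, i + 1 < k → 2 * κ i ≤ κ (i + 1) := by
      intro i hi
      have hi' : i < k := by omega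
      simp only [κ, hi, hi', dif_pos]
      have hmem := minOf_mem (hz ⟨i + 1, hi⟩).basic.2.1
      have hmem0 := minOf_mem (hz ⟨i, hi'⟩).basic.2.1
      have hlti := hlt ⟨i, hi'⟩ ⟨i + 1, hi⟩ (by simp)
      rcases Nat.eq_zero_or_pos q with hq | hq
      · exact hgrow (by omega) _ (hsubset _ hmem0) _ (hsubset _ hmem) (hlti _ hmem0 _ hmem)
      · exact two_mul_minOf_le ((hz ⟨i, hi'⟩).minOf_le_card hq) fun v hv => hlti v hv _ hmem
    -- The induction starts from D ≤ g < κ (i₀ + 1). Together with D pieces of size at most 8 / κ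
    -- each, it yields the bound 16 / 2^l for the block i₀ + l.
    have hκl : ∀ l, 1 ≤ l → i₀ + l < k → D * 2 ^ l ≤ 2 * κ (i₀ + l) := by
      intro l hl
      induction l, hl using Nat.le_induction with
      | base =>
        intro h
        have h1 : g < κ (i₀ + 1) := by
          simp only [κ, h, dif_pos]
          have hmem := minOf_mem (hz ⟨i₀ + 1, h⟩).basic.2.1
          exact hg _ (hsubset _ hmem) (hlt ⟨i₀, hi₀k⟩ _ (by simp) u₀ hu₀ _ hmem)
        have h2 := hD g hgG
        omega
      | succ l hl ihl =>
        intro h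
        have h1 := ihl (by omega)
        have h2 := hκ (i₀ + l) (by omega)
        rw [pow_succ]
        rw [← add_assoc]
        nlinarith
    have hfin := hκl l hl hik
    have hκv : κ (i₀ + l) = minOf (z ⟨i₀ + l, hik⟩).support := by simp only [κ, hik, dif_pos]
    set m := minOf (z ⟨i₀ + l, hik⟩).support with hm
    have hmpos : 0 < m := by
      have h1 := hlt0 _ (minOf_mem (hz ⟨i₀ + l, hik⟩).basic.2.1)
      omega
    have hbound : ψ ⟨i₀ + l, hik⟩ G ≤ D * (8 / m) := by
      calc ψ ⟨i₀ + l, hik⟩ G ≤ ∑ d, ψ ⟨i₀ + l, hik⟩ (H d) := by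
            simp only [ψ]
            rw [Finset.sum_comm]
            refine Finset.sum_le_sum fun u hu => ?_
            rw [← Finset.mul_sum, hGH]
            exact mul_le_mul_of_nonneg_left (hsub u (hsubset _ hu) D H) ((hz _).basic.1 u)
        _ ≤ ∑ _d : Fin D, 8 / (m : ℝ) :=
            Finset.sum_le_sum fun d _ => hih _ t (by omega) (H d) (hH d)
        _ = D * (8 / m) := by simp
    refine hbound.trans ?_
    rw [hκv] at hfin
    have hfin' : (D : ℝ) * 2 ^ l ≤ 2 * m := by exact_mod_cast hfin
    have hm' : (0 : ℝ) < m := by exact_mod_cast hmpos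
    rw [mul_div_assoc', div_le_div_iff₀ hm' (by positivity)]
    nlinarith

/-! ### Tree functionals for the norm of X -/

theorem schreier_biUnion_fin {n a r : ℕ} {f : Fin r → ℕ} (hf : Finset.univ.image f ∈ Schreier n)
    (hmono : StrictMono f) {H : Fin r → Finset ℕ} (hH : ∀ i, H i ∈ Schreier a)
    (hle : ∀ i, ∀ g ∈ H i, f i ≤ g) (hlt : ∀ i j, i < j → SetLT (H i) (H j)) :
    Finset.univ.biUnion H ∈ Schreier (n + a) := by
  let H' : ℕ → Finset ℕ := fun u => (Finset.univ.filter fun i => f i = u).biUnion H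
  have hH' : ∀ i, H' (f i) = H i := by
    intro i
    have : (Finset.univ.filter fun j => f j = f i) = {i} := by
      ext j
      simp [hmono.injective.eq_iff]
    simp only [H', this, Finset.singleton_biUnion]
  have h := schreier_biUnion (a := a) hf (H := H')
    (fun u hu => by
      obtain ⟨i, -, rfl⟩ := Finset.mem_image.1 hu
      rw [hH']; exact hH i)
    (fun u hu g hg => by
      obtain ⟨i, -, rfl⟩ := Finset.mem_image.1 hu
      rw [hH'] at hg; exact hle i g hg)
    (fun u hu w hw huw => by
      obtain ⟨i, -, rfl⟩ := Finset.mem_image.1 hu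
      obtain ⟨j, -, rfl⟩ := Finset.mem_image.1 hw
      rw [hH', hH']; exact hlt i j (hmono.lt_iff_lt.1 huw))
  rw [Finset.image_biUnion] at h
  simpa only [hH'] using h

/-- Trees of functionals: a leaf is a coordinate functional, a node is `θ_n` times the sum of its
children. -/
inductive NTree : Type
  | leaf (v : ℕ) : NTree
  | node (n r : ℕ) (c : Fin r → NTree) : NTree

namespace NTree

/-- The support of a tree. -/
def supp : NTree → Finset ℕ
  | leaf v => {v}
  | node _ _ c => Finset.univ.biUnion fun i => (c i).supp

/-- The children of every node are successive and `𝒮_n`-admissible. -/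
def Valid : NTree → Prop
  | leaf v => 1 ≤ v
  | node n r c => 1 ≤ n ∧ (∀ i, (c i).Valid) ∧ (∀ i j, i < j → SetLT (c i).supp (c j).supp) ∧
      ∃ f : Fin r → ℕ, Finset.univ.image f ∈ Schreier n ∧ StrictMono f ∧
        ∀ i, ∀ v ∈ (c i).supp, f i ≤ v

/-- The coefficients of the functional. -/
noncomputable def wt (θ : ℕ → ℝ) : NTree → ℕ → ℝ
  | leaf w, v => if v = w then 1 else 0
  | node n _ c, v => θ n * ∑ i, (c i).wt θ v

/-- The support of the node at depth `d` above `v`. -/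
def cell : NTree → ℕ → ℕ → Finset ℕ
  | leaf w, _, _ => {w}
  | node _ _ c, 0, _ => Finset.univ.biUnion fun i => (c i).supp
  | node _ _ c, d + 1, v => Finset.univ.biUnion fun i =>
      if v ∈ (c i).supp then (c i).cell d v else ∅

/-- The sum of the indices of the nodes above `v` of depth less than `d`. -/
def ord : NTree → ℕ → ℕ → ℕ
  | leaf _, _, _ => 0
  | node _ _ _, 0, _ => 0
  | node n _ c, d + 1, v => n + ∑ i, if v ∈ (c i).supp then (c i).ord d v else 0

/-- The depth of the leaf `v`. -/
def height : NTree → ℕ → ℕ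
  | leaf _, _ => 0
  | node _ _ c, v => 1 + ∑ i, if v ∈ (c i).supp then (c i).height v else 0

variable {T : NTree} {θ : ℕ → ℝ} {v w : ℕ}

theorem exists_child {n r : ℕ} {c : Fin r → NTree} (hv : v ∈ (node n r c).supp) :
    ∃ i, v ∈ (c i).supp := by
  simpa [supp] using hv

theorem child_subset {n r : ℕ} {c : Fin r → NTree} (i : Fin r) :
    (c i).supp ⊆ (node n r c).supp := fun v hv => by
  simp only [supp, Finset.mem_biUnion, Finset.mem_univ, true_and]
  exact ⟨i, hv⟩

theorem child_unique {n r : ℕ} {c : Fin r → NTree} (hT : (node n r c).Valid) {i j : Fin r}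
    (hi : v ∈ (c i).supp) (hj : v ∈ (c j).supp) : j = i := by
  by_contra h
  rcases lt_or_gt_of_ne h with h | h
  · exact lt_irrefl v (hT.2.2.1 _ _ h v hj v hi)
  · exact lt_irrefl v (hT.2.2.1 _ _ h v hi v hj)

theorem cell_node {n r : ℕ} {c : Fin r → NTree} (hT : (node n r c).Valid) {i : Fin r}
    (hi : v ∈ (c i).supp) (d : ℕ) : (node n r c).cell (d + 1) v = (c i).cell d v := by
  ext u
  simp only [cell, Finset.mem_biUnion, Finset.mem_univ, true_and]
  constructor
  · rintro ⟨j, hj⟩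
    split_ifs at hj with hv
    · rwa [child_unique hT hi hv] at hj
    · simp at hj
  · intro hu
    exact ⟨i, by rwa [if_pos hi]⟩

theorem ord_node {n r : ℕ} {c : Fin r → NTree} (hT : (node n r c).Valid) {i : Fin r}
    (hi : v ∈ (c i).supp) (d : ℕ) : (node n r c).ord (d + 1) v = n + (c i).ord d v := by
  simp only [ord]
  rw [Finset.sum_eq_single i, if_pos hi]
  · intro j _ hj
    exact if_neg fun h => hj (child_unique hT hi h)
  · simp

theorem height_node {n r : ℕ} {c : Fin r → NTree} (hT : (node n r c).Valid) {i : Fin r}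
    (hi : v ∈ (c i).supp) : (node n r c).height v = (c i).height v + 1 := by
  simp only [height]
  rw [Finset.sum_eq_single i, if_pos hi, add_comm]
  · intro j _ hj
    exact if_neg fun h => hj (child_unique hT hi h)
  · simp

theorem wt_eq_zero (hv : v ∉ T.supp) : T.wt θ v = 0 := by
  induction T with
  | leaf w =>
    simp only [supp, Finset.mem_singleton] at hv
    simp [wt, hv]
  | node n r c ih =>
    simp only [wt]
    rw [Finset.sum_eq_zero fun i _ => ih i fun h => hv (child_subset i h), mul_zero]

theorem wt_node {n r : ℕ} {c : Fin r → NTree} (hT : (node n r c).Valid) {i : Fin r}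
    (hi : v ∈ (c i).supp) : (node n r c).wt θ v = θ n * (c i).wt θ v := by
  simp only [wt]
  rw [Finset.sum_eq_single i]
  · intro j _ hj
    exact wt_eq_zero fun h => hj (child_unique hT hi h)
  · simp

theorem one_le_of_mem_supp (hT : T.Valid) (hv : v ∈ T.supp) : 1 ≤ v := by
  induction T with
  | leaf w =>
    simp only [supp, Finset.mem_singleton] at hv
    rw [hv]; exact hT
  | node n r c ih =>
    obtain ⟨i, hi⟩ := exists_child hv
    exact ih i (hT.2.1 i) hi

@[simp] theorem cell_zero : T.cell 0 v = T.supp := by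
  cases T <;> simp [cell, supp]

@[simp] theorem ord_zero : T.ord 0 v = 0 := by
  cases T <;> simp [ord]

theorem mem_cell (hT : T.Valid) (hv : v ∈ T.supp) (d : ℕ) : v ∈ T.cell d v := by
  induction T generalizing d with
  | leaf w => simpa [cell, supp] using hv
  | node n r c ih =>
    cases d with
    | zero => simpa using hv
    | succ d =>
      obtain ⟨i, hi⟩ := exists_child hv
      rw [cell_node hT hi]
      exact ih i (hT.2.1 i) hi d

theorem cell_subset (hT : T.Valid) (hv : v ∈ T.supp) (d : ℕ) : T.cell d v ⊆ T.supp := by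
  induction T generalizing d with
  | leaf w => simp [cell, supp]
  | node n r c ih =>
    cases d with
    | zero => simp
    | succ d =>
      obtain ⟨i, hi⟩ := exists_child hv
      rw [cell_node hT hi]
      exact (ih i (hT.2.1 i) hi d).trans (child_subset i)

/-- The last equality goes one step deeper than the first two: the index added between depths d and
d + 1 belongs to the node at depth d, so it is the same for all points below that node, whichever
child they lie in. The count of stuck points rests on this. -/
theorem cell_eq (hT : T.Valid) (hv : v ∈ T.supp) {d : ℕ} (hw : w ∈ T.cell d v) :
    T.cell d w = T.cell d v ∧ T.ord d w = T.ord d v ∧ T.ord (d + 1) w = T.ord (d + 1) v := by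
  induction T generalizing d with
  | leaf u => simp [cell, ord]
  | node n r c ih =>
    obtain ⟨i, hi⟩ := exists_child hv
    cases d with
    | zero =>
      rw [cell_zero] at hw
      obtain ⟨j, hj⟩ := exists_child hw
      rw [ord_node hT hi, ord_node hT hj]
      simp
    | succ d =>
      rw [cell_node hT hi] at hw
      have hwi := cell_subset (hT.2.1 i) hi d hw
      rw [cell_node hT hi, cell_node hT hwi, ord_node hT hi, ord_node hT hwi, ord_node hT hi,
        ord_node hT hwi]
      obtain ⟨h1, h2, h3⟩ := ih i (hT.2.1 i) hi hw
      exact ⟨h1, by rw [h2], by rw [h3]⟩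

theorem cell_succ_subset (hT : T.Valid) (hv : v ∈ T.supp) (d : ℕ) :
    T.cell (d + 1) v ⊆ T.cell d v := by
  induction T generalizing d with
  | leaf u => simp [cell]
  | node n r c ih =>
    obtain ⟨i, hi⟩ := exists_child hv
    cases d with
    | zero => rw [cell_zero]; exact cell_subset hT hv _
    | succ d =>
      rw [cell_node hT hi, cell_node hT hi]
      exact ih i (hT.2.1 i) hi d

theorem cell_antitone (hT : T.Valid) (hv : v ∈ T.supp) {d d' : ℕ} (h : d ≤ d') :
    T.cell d' v ⊆ T.cell d v := by
  induction d', h using Nat.le_induction with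
  | base => exact subset_rfl
  | succ m _ ih => exact (cell_succ_subset hT hv m).trans ih

theorem ord_le_ord_height (hT : T.Valid) (hv : v ∈ T.supp) (d : ℕ) :
    T.ord d v ≤ T.ord (T.height v) v := by
  induction T generalizing d with
  | leaf u => simp [ord]
  | node n r c ih =>
    obtain ⟨i, hi⟩ := exists_child hv
    cases d with
    | zero => simp
    | succ d =>
      rw [height_node hT hi, ord_node hT hi, ord_node hT hi]
      exact Nat.add_le_add_left (ih i (hT.2.1 i) hi d) n

theorem setLT_cell (hT : T.Valid) (hv : v ∈ T.supp) (hw : w ∈ T.supp) (hvw : v < w) {d : ℕ}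
    (hne : T.cell d v ≠ T.cell d w) : SetLT (T.cell d v) (T.cell d w) := by
  induction T generalizing d with
  | leaf u => simp [cell] at hne
  | node n r c ih =>
    obtain ⟨i, hi⟩ := exists_child hv
    obtain ⟨j, hj⟩ := exists_child hw
    cases d with
    | zero => simp at hne
    | succ d =>
      rw [cell_node hT hi, cell_node hT hj] at hne ⊢
      rcases lt_trichotomy i j with h | h | h
      · intro a ha b hb
        exact hT.2.2.1 i j h a (cell_subset (hT.2.1 i) hi d ha) b
          (cell_subset (hT.2.1 j) hj d hb)
      · subst h
        exact ih i (hT.2.1 i) hi hj hne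
      · exact absurd (hT.2.2.1 j i h w hj v hi) (by omega)

theorem cell_height (hT : T.Valid) (hv : v ∈ T.supp) : T.cell (T.height v) v = {v} := by
  induction T with
  | leaf u => simp only [supp, Finset.mem_singleton] at hv; simp [cell, hv]
  | node n r c ih =>
    obtain ⟨i, hi⟩ := exists_child hv
    rw [height_node hT hi, cell_node hT hi]
    exact ih i (hT.2.1 i) hi

theorem wt_nonneg (hθ : RegularSeq θ) (hT : T.Valid) : 0 ≤ T.wt θ v := by
  induction T with
  | leaf u => simp only [wt]; split_ifs <;> norm_num
  | node n r c ih =>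
    simp only [wt]
    exact mul_nonneg (hθ.pos n hT.1).le (Finset.sum_nonneg fun i _ => ih i (hT.2.1 i))

theorem wt_le_one (hθ : RegularSeq θ) (hT : T.Valid) (hv : v ∈ T.supp) : T.wt θ v ≤ 1 := by
  induction T with
  | leaf u => simp only [wt]; split_ifs <;> norm_num
  | node n r c ih =>
    obtain ⟨i, hi⟩ := exists_child hv
    rw [wt_node hT hi]
    exact mul_le_one₀ (hθ.lt_one n hT.1).le (wt_nonneg hθ (hT.2.1 i)) (ih i (hT.2.1 i) hi)

/-- The weights met along the branch multiply, and θ_m θ_n ≤ θ_{m+n} collapses them into one θ.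
Nodes below depth d contribute factors at most 1. -/
theorem wt_le_ord (hθ : RegularSeq θ) (hT : T.Valid) (hv : v ∈ T.supp) {d : ℕ}
    (hd : 1 ≤ T.ord d v) : T.wt θ v ≤ θ (T.ord d v) := by
  induction T generalizing d with
  | leaf u => simp [ord] at hd
  | node n r c ih =>
    obtain ⟨i, hi⟩ := exists_child hv
    cases d with
    | zero => simp at hd
    | succ d =>
      rw [wt_node hT hi, ord_node hT hi]
      rcases Nat.eq_zero_or_pos ((c i).ord d v) with h | h
      · rw [h, add_zero]
        exact mul_le_of_le_one_right (hθ.pos n hT.1).le (wt_le_one hθ (hT.2.1 i) hi)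
      · exact (mul_le_mul_of_nonneg_left (ih i (hT.2.1 i) hi h) (hθ.pos n hT.1).le).trans
          (hθ.mul_le _ _ hT.1 h)

theorem one_le_ord_height (hT : T.Valid) (hv : v ∈ T.supp) (h : 1 ≤ T.height v) :
    1 ≤ T.ord (T.height v) v := by
  cases T with
  | leaf u => simp [height] at h
  | node n r c =>
    obtain ⟨i, hi⟩ := exists_child hv
    rw [height_node hT hi, ord_node hT hi]
    exact hT.1.trans (Nat.le_add_right _ _)

/-- A leaf of depth at least `N` carries a weight at most a product of `N` of the `θ_n`. -/
theorem exists_prod_of_le_height (hθ : RegularSeq θ) (hT : T.Valid) (hv : v ∈ T.supp) {N : ℕ}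
    (hN : 1 ≤ N) (h : N ≤ T.height v) :
    ∃ l : Fin N → ℕ, (∀ i, 1 ≤ l i) ∧ ∑ i, l i = T.ord (T.height v) v ∧
      T.wt θ v ≤ ∏ i, θ (l i) := by
  induction N, hN using Nat.le_induction generalizing T with
  | base =>
    exact ⟨fun _ => T.ord (T.height v) v, fun _ => one_le_ord_height hT hv h, by simp,
      by simpa using wt_le_ord hθ hT hv (one_le_ord_height hT hv h)⟩
  | succ N hN ih =>
    cases T with
    | leaf u => simp [height] at h
    | node n r c =>
      obtain ⟨i, hi⟩ := exists_child hv
      rw [height_node hT hi] at h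
      obtain ⟨l, hl, hsum, hle⟩ := ih (hT.2.1 i) hi (by omega)
      refine ⟨Fin.cons n l, fun j => ?_, ?_, ?_⟩
      · refine Fin.cases ?_ (fun j => ?_) j
        · simpa using hT.1
        · simpa using hl j
      · rw [Fin.sum_univ_succ, height_node hT hi, ord_node hT hi]
        simp [hsum]
      · rw [Fin.prod_univ_succ, wt_node hT hi]
        simpa using mul_le_mul_of_nonneg_left hle (hθ.pos n hT.1).le

/-- Points chosen in pairwise incomparable nodes of order at most `s` form an `𝒮_s` set. -/
theorem image_mem_schreier (hT : T.Valid) {Z : Finset ℕ} (hZ : Z ⊆ T.supp) {σ β : ℕ → ℕ} {s : ℕ}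
    (hβ : ∀ v ∈ Z, β v ∈ T.cell (σ v) v) (hs : ∀ v ∈ Z, T.ord (σ v) v ≤ s)
    (hconst : ∀ v ∈ Z, ∀ w ∈ Z, w ∈ T.cell (σ v) v → σ w = σ v ∧ β w = β v) :
    Z.image β ∈ Schreier s := by
  induction T generalizing Z σ s with
  | leaf u =>
    rcases Z.eq_empty_or_nonempty with rfl | hne
    · simpa using empty_mem_schreier s
    have : Z.image β ⊆ {u} := by
      intro g hg
      obtain ⟨v, hv, rfl⟩ := Finset.mem_image.1 hg
      simpa [cell] using hβ v hv
    exact schreier_subset (singleton_mem_schreier s hT) this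
  | node n r c ih =>
    rcases Z.eq_empty_or_nonempty with rfl | ⟨v₀, hv₀⟩
    · simpa using empty_mem_schreier s
    -- A point stopped at the root has the whole support as its cell, so constancy reduces the image
    -- of β to one point. Otherwise every stopping depth is positive and the set splits among the
    -- children.
    by_cases h0 : ∃ v ∈ Z, σ v = 0
    · obtain ⟨v, hv, hσ⟩ := h0
      have : Z.image β ⊆ {β v} := by
        intro g hg
        obtain ⟨w, hw, rfl⟩ := Finset.mem_image.1 hg
        rw [(hconst v hv w hw (by rw [hσ, cell_zero]; exact hZ hw)).2]
        simp
      refine schreier_subset (singleton_mem_schreier s ?_) this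
      exact one_le_of_mem_supp hT (cell_subset hT (hZ hv) _ (hβ v hv))
    push Not at h0
    have hσ : ∀ v ∈ Z, σ v - 1 + 1 = σ v := fun v hv => by have := h0 v hv; omega
    obtain ⟨hn, hc, hlt, f, hf, hfm, hfle⟩ := id hT
    have hns : n ≤ s := by
      obtain ⟨i, hi⟩ := exists_child (hZ hv₀)
      have h1 := hs v₀ hv₀
      rw [← hσ v₀ hv₀, ord_node hT hi] at h1
      omega
    let Y : Fin r → Finset ℕ := fun i => Z.filter fun v => v ∈ (c i).supp
    have hYZ : ∀ i, ∀ v ∈ Y i, v ∈ Z := fun i v hv => (Finset.mem_filter.1 hv).1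
    have hYc : ∀ i, ∀ v ∈ Y i, v ∈ (c i).supp := fun i v hv => (Finset.mem_filter.1 hv).2
    have hβi : ∀ i, ∀ v ∈ Y i, β v ∈ (c i).cell (σ v - 1) v := by
      intro i v hv
      have h1 := hβ v (hYZ i v hv)
      rwa [← hσ v (hYZ i v hv), cell_node hT (hYc i v hv)] at h1
    have hH : ∀ i, (Y i).image β ∈ Schreier (s - n) := by
      intro i
      refine ih i (hc i) (σ := fun v => σ v - 1) (hYc i) (hβi i) ?_ ?_
      · intro v hv
        have h1 := hs v (hYZ i v hv)
        rw [← hσ v (hYZ i v hv), ord_node hT (hYc i v hv)] at h1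
        omega
      · intro v hv w hw hwv
        have h1 := hconst v (hYZ i v hv) w (hYZ i w hw)
        rw [← hσ v (hYZ i v hv), cell_node hT (hYc i v hv)] at h1
        have h2 := h1 hwv
        have h3 := hσ v (hYZ i v hv)
        exact ⟨by omega, h2.2⟩
    have hHc : ∀ i, ∀ g ∈ (Y i).image β, g ∈ (c i).supp := by
      intro i g hg
      obtain ⟨v, hv, rfl⟩ := Finset.mem_image.1 hg
      exact cell_subset (hc i) (hYc i v hv) _ (hβi i v hv)
    -- The children contribute 𝒮_{s-n} sets bounded below by points that form an 𝒮_n set, so the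
    -- orders add up to s.
    have h := schreier_biUnion_fin hf hfm hH (fun i g hg => hfle i g (hHc i g hg))
      fun i j hij a ha b hb => hlt i j hij a (hHc i a ha) b (hHc j b hb)
    rw [Nat.add_sub_cancel' hns] at h
    refine schreier_subset h fun g hg => ?_
    obtain ⟨v, hv, rfl⟩ := Finset.mem_image.1 hg
    obtain ⟨i, hi⟩ := exists_child (hZ hv)
    exact Finset.mem_biUnion.2 ⟨i, Finset.mem_univ _,
      Finset.mem_image_of_mem _ (Finset.mem_filter.2 ⟨hv, hi⟩)⟩

/-- The value of the functional at `x`. -/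
noncomputable def val (θ : ℕ → ℝ) (T : NTree) (x : ℕ →₀ ℝ) : ℝ := ∑ v ∈ T.supp, T.wt θ v * x v

theorem val_node {n r : ℕ} {c : Fin r → NTree} (hT : (node n r c).Valid) (x : ℕ →₀ ℝ) :
    (node n r c).val θ x = θ n * ∑ i, (c i).val θ x := by
  simp only [val]
  conv_lhs => rw [supp]
  rw [Finset.sum_biUnion, Finset.mul_sum]
  · refine Finset.sum_congr rfl fun i _ => ?_
    rw [Finset.mul_sum]
    refine Finset.sum_congr rfl fun v hv => ?_
    rw [wt_node hT hv, mul_assoc]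
  · intro i _ j _ hij
    refine Finset.disjoint_left.2 fun v hi hj => hij (child_unique hT hj hi)

end NTree

/-- Unfolding the recursive norm along nearly optimal choices gives a tree. Passing to approximate
maxima avoids showing that the suprema are attained. -/
theorem exists_tree {θ : ℕ → ℝ} (hθ : RegularSeq θ) (m : ℕ) {x : ℕ →₀ ℝ} (hx : ∀ v, 0 ≤ x v)
    (hx1 : ∀ v ∈ x.support, 1 ≤ v) {ε : ℝ} (hε : 0 < ε) :
    ∃ T : NTree, T.Valid ∧ T.supp ⊆ x.support ∧ iterNorm Admissible θ m x ≤ T.val θ x + ε := by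
  -- A node without children serves as the zero functional, for the case in which the sup norm is
  -- almost attained at a zero coordinate.
  have hzero : ∀ y : ℕ →₀ ℝ, (NTree.node 1 0 fun i => i.elim0).val θ y = 0 := by
    intro y; simp [NTree.val, NTree.supp]
  have hzv : (NTree.node 1 0 fun i => i.elim0).Valid :=
    ⟨le_rfl, fun i => i.elim0, fun i => i.elim0, fun i => i.elim0,
      by simpa using empty_mem_schreier 1, fun i => i.elim0, fun i => i.elim0⟩
  have hzs : (NTree.node 1 0 fun i => i.elim0).supp = ∅ := by simp [NTree.supp]
  induction m generalizing x ε with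
  | zero =>
    simp only [iterNorm]
    obtain ⟨k, hk⟩ := exists_lt_of_lt_ciSup (show (⨆ k, |x k|) - ε < ⨆ k, |x k| by linarith)
    by_cases hkx : k ∈ x.support
    · refine ⟨NTree.leaf k, hx1 k hkx, by simpa [NTree.supp] using hkx, ?_⟩
      rw [abs_of_nonneg (hx k)] at hk
      simp only [NTree.val, NTree.supp, Finset.sum_singleton, NTree.wt, if_true, one_mul]
      linarith
    · refine ⟨_, hzv, by simp [hzs], ?_⟩
      rw [Finsupp.notMem_support_iff.1 hkx, abs_zero] at hk
      rw [hzero]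
      linarith
  | succ m ih =>
    simp only [iterNorm]
    rcases le_total (sSup {s | ∃ (n r : ℕ) (E : Fin r → Finset ℕ), 1 ≤ n ∧ Admissible n r E ∧
        s = θ n * ∑ i, iterNorm Admissible θ m (x.filter (fun j => j ∈ E i))})
        (iterNorm Admissible θ m x) with h | h
    · rw [max_eq_left h]
      exact ih hx hx1 hε
    · rw [max_eq_right h]
      have hne : {s | ∃ (n r : ℕ) (E : Fin r → Finset ℕ), 1 ≤ n ∧ Admissible n r E ∧
          s = θ n * ∑ i, iterNorm Admissible θ m (x.filter (fun j => j ∈ E i))}.Nonempty :=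
        ⟨_, 1, 0, fun i => i.elim0, le_rfl, ⟨fun i => i.elim0, fun i => i.elim0,
          by simpa using empty_mem_schreier 1⟩, rfl⟩
      obtain ⟨s, ⟨n, r, E, hn, hE, rfl⟩, hs⟩ :=
        exists_lt_of_lt_csSup hne (sub_lt_self _ (half_pos hε))
      have hr : (0 : ℝ) < r + 1 := by positivity
      have hxE : ∀ i, ∀ v, 0 ≤ (x.filter (fun j => j ∈ E i)) v := by
        intro i v
        rw [Finsupp.filter_apply]
        split_ifs
        · exact hx v
        · exact le_rfl
      -- Each of the r children may lose ε / (2 (r + 1)), ε / 2 in all; the shift by one covers r =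
      -- 0.
      have hex := fun i => ih (hxE i) (fun v hv => hx1 v (by
        rw [Finsupp.support_filter] at hv
        exact (Finset.mem_filter.1 hv).1)) (ε := ε / 2 / (r + 1)) (by positivity)
      choose c hc hsupp hle using hex
      have hcE : ∀ i, ∀ v ∈ (c i).supp, v ∈ x.support ∧ v ∈ E i := by
        intro i v hv
        have := hsupp i hv
        rw [Finsupp.support_filter] at this
        exact Finset.mem_filter.1 this
      have hT : (NTree.node n r c).Valid := by
        -- The supports of the children may be smaller than the E i, or empty. The minima of the E i
        -- are kept as lower bounds, so the Schreier condition need not be transferred to new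
        -- minima.
        refine ⟨hn, hc, fun i j hij a ha b hb => ?_, fun i => minOf (E i), hE.2.2, ?_, ?_⟩
        · exact hE.2.1 i j hij a (hcE i a ha).2 b (hcE j b hb).2
        · intro i j hij
          exact hE.2.1 i j hij _ (minOf_mem (hE.1 i)) _ (minOf_mem (hE.1 j))
        · intro i v hv
          exact minOf_le (hcE i v hv).2
      refine ⟨NTree.node n r c, hT, ?_, ?_⟩
      · intro v hv
        obtain ⟨i, hi⟩ := NTree.exists_child hv
        exact (hcE i v hi).1
      rw [NTree.val_node hT]
      have hval : ∀ i, (c i).val θ (x.filter (fun j => j ∈ E i)) = (c i).val θ x := by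
        intro i
        refine Finset.sum_congr rfl fun v hv => ?_
        rw [Finsupp.filter_apply_pos _ _ (hcE i v hv).2]
      have h1 : ∑ i, iterNorm Admissible θ m (x.filter (fun j => j ∈ E i)) ≤
          ∑ i, (c i).val θ x + ε / 2 := by
        calc _ ≤ ∑ i, ((c i).val θ x + ε / 2 / (r + 1)) :=
              Finset.sum_le_sum fun i _ => by rw [← hval i]; exact hle i
          _ = ∑ i, (c i).val θ x + r * (ε / 2 / (r + 1)) := by
              rw [Finset.sum_add_distrib]; simp
          _ ≤ _ := by
              have : r * (ε / 2 / (r + 1)) ≤ ε / 2 := by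
                rw [mul_div_assoc', div_le_iff₀ hr]
                nlinarith
              linarith
      have h2 := mul_le_mul_of_nonneg_left h1 (hθ.pos n hn).le
      have h3 := hθ.lt_one n hn
      nlinarith

theorem normX_le_of_tree {θ : ℕ → ℝ} (hθ : RegularSeq θ) {x : ℕ →₀ ℝ} (hx : ∀ v, 0 ≤ x v)
    (hx1 : ∀ v ∈ x.support, 1 ≤ v) {c : ℝ}
    (h : ∀ T : NTree, T.Valid → T.supp ⊆ x.support → T.val θ x ≤ c) : normX θ x ≤ c := by
  refine ciSup_le fun m => le_of_forall_pos_le_add fun ε hε => ?_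
  obtain ⟨T, hT, hs, hle⟩ := exists_tree hθ m hx hx1 hε
  linarith [h T hT hs]

/-! ### Lower bounds in the modified space -/

/-- `g` restricted to `E` is a functional of norm at most one on nonnegative vectors of `X_M`. -/
def Norming (θ : ℕ → ℝ) (E : Finset ℕ) (g : ℕ → ℝ) : Prop :=
  ∀ x : ℕ →₀ ℝ, (∀ v, 0 ≤ x v) → ∑ v ∈ E, g v * x v ≤ normXM θ x

theorem iterNorm_allowable_le {θ : ℕ → ℝ} (hθ : RegularSeq θ) (m : ℕ) (x : ℕ →₀ ℝ) :
    iterNorm Allowable θ m x ≤ normXM θ x :=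
  le_ciSup (f := fun m => iterNorm Allowable θ m x)
    ⟨_, by rintro _ ⟨m, rfl⟩; exact iterNorm_le_l1 (fun _ _ _ hE => hE.2.1) hθ m x⟩ m

theorem norming_singleton {θ : ℕ → ℝ} (hθ : RegularSeq θ) (u : ℕ) {g : ℕ → ℝ} (hg : g u ≤ 1) :
    Norming θ {u} g := by
  intro x hx
  rw [Finset.sum_singleton]
  refine le_trans ?_ (iterNorm_allowable_le hθ 0 x)
  refine (mul_le_of_le_one_left (hx u) hg).trans ((le_abs_self _).trans ?_)
  refine le_ciSup (f := fun k => |x k|) ⟨∑ j ∈ x.support, |x j|, ?_⟩ u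
  rintro _ ⟨k, rfl⟩
  by_cases hk : k ∈ x.support
  · exact Finset.single_le_sum (f := fun j => |x j|) (fun j _ => abs_nonneg _) hk
  · dsimp only
    rw [Finsupp.notMem_support_iff.1 hk, abs_zero]
    exact Finset.sum_nonneg fun j _ => abs_nonneg _

/-- The recursive inequality between the stages m and m + 1 passes to the limit in m. -/
theorem sum_normXM_le {θ : ℕ → ℝ} (hθ : RegularSeq θ) {n r : ℕ} (hn : 1 ≤ n)
    {E : Fin r → Finset ℕ} (hE : Allowable n r E) (x : ℕ →₀ ℝ) :
    θ n * ∑ i, normXM θ (x.filter (fun j => j ∈ E i)) ≤ normXM θ x := by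
  have ht : Tendsto (fun m => θ n * ∑ i, iterNorm Allowable θ m (x.filter (fun j => j ∈ E i)))
      atTop (𝓝 (θ n * ∑ i, normXM θ (x.filter (fun j => j ∈ E i)))) :=
    (tendsto_finsetSum _ fun i _ => tendsto_normXM hθ _).const_mul _
  refine le_of_tendsto' ht fun m => le_trans ?_ (iterNorm_allowable_le hθ (m + 1) x)
  exact (le_csSup (bddAbove_iterNorm_set (fun _ _ _ hE => hE.2.1) hθ m x)
    ⟨n, r, E, hn, hE, rfl⟩).trans (le_max_right _ _)

/-- Only disjointness of the pieces and the Schreier order of their minima matter, so the pieces may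
interlace. This is what separates X_M from X in the lower estimates. -/
theorem Norming.biUnion {θ : ℕ → ℝ} (hθ : RegularSeq θ) {ι : Type*} {J : Finset ι}
    {E : ι → Finset ℕ} {g : ℕ → ℝ} {n : ℕ} (hn : 1 ≤ n) (hne : ∀ j ∈ J, (E j).Nonempty)
    (hdisj : ∀ i ∈ J, ∀ j ∈ J, i ≠ j → Disjoint (E i) (E j))
    (hS : J.image (fun j => minOf (E j)) ∈ Schreier n) (hg : ∀ j ∈ J, Norming θ (E j) g) :
    Norming θ (J.biUnion E) (fun v => θ n * g v) := by
  classical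
  intro x hx
  let e := J.equivFin
  let E' : Fin J.card → Finset ℕ := fun i => E (e.symm i)
  have hE : Allowable n J.card E' := by
    refine ⟨fun i => hne _ (e.symm i).2, fun i j hij => hdisj _ (e.symm i).2 _ (e.symm j).2 ?_, ?_⟩
    · exact fun h => hij (e.symm.injective (Subtype.ext h))
    · convert hS using 1
      ext u
      simp only [Finset.mem_image, Finset.mem_univ, true_and, E']
      constructor
      · rintro ⟨i, rfl⟩
        exact ⟨_, (e.symm i).2, rfl⟩
      · rintro ⟨j, hj, rfl⟩
        exact ⟨e ⟨j, hj⟩, by simp⟩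
  refine le_trans ?_ (sum_normXM_le hθ hn hE x)
  rw [Finset.sum_biUnion fun i hi j hj hij => hdisj i hi j hj hij]
  simp only [mul_assoc]
  simp only [← Finset.mul_sum]
  refine mul_le_mul_of_nonneg_left ?_ (hθ.pos n hn).le
  rw [← Finset.sum_coe_sort J, ← e.symm.sum_comp]
  refine Finset.sum_le_sum fun i _ => ?_
  refine le_trans (le_of_eq ?_) (hg _ (e.symm i).2 (x.filter fun j => j ∈ E' i) fun v => ?_)
  · refine Finset.sum_congr rfl fun v hv => ?_
    rw [Finsupp.filter_apply_pos _ _ hv]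
  · rw [Finsupp.filter_apply]
    split_ifs
    · exact hx v
    · exact le_rfl

/-! ### Supports, coefficients and level maps of layered vectors -/

theorem sum_single_apply {I : Finset ℕ} {m : ℕ → ℕ} (hm : Set.InjOn m I) (a : ℕ → ℝ) {j : ℕ}
    (hj : j ∈ I) : (∑ i ∈ I, Finsupp.single (m i) (a i)) (m j) = a j := by
  rw [Finsupp.finsetSum_apply, Finset.sum_eq_single j]
  · simp
  · intro i hi hij
    exact Finsupp.single_eq_of_ne fun h => hij (hm hi hj h.symm)
  · exact fun h => absurd hj h

theorem exists_of_sum_single_ne_zero {I : Finset ℕ} {m : ℕ → ℕ} {a : ℕ → ℝ} {v : ℕ}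
    (hv : (∑ i ∈ I, Finsupp.single (m i) (a i)) v ≠ 0) : ∃ j ∈ I, m j = v := by
  rw [Finsupp.finsetSum_apply] at hv
  obtain ⟨j, hj, h⟩ := Finset.exists_ne_zero_of_sum_ne_zero hv
  refine ⟨j, hj, ?_⟩
  by_contra hne
  exact h (Finsupp.single_eq_of_ne (Ne.symm hne))

/-- The properties of layered vectors: the intervals `I M k`, the (positive) coefficients `a M j`
and the supports. -/
structure Tower (θ : ℕ → ℝ) (N : ℕ) (V : Set ℕ) (p L : ℕ → ℕ) (x : ℕ → ℕ → (ℕ →₀ ℝ))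
    (I : ℕ → ℕ → Finset ℕ) (a : ℕ → ℕ → ℝ) : Prop where
  I_Icc : ∀ M < N, ∀ k, 1 ≤ k → ∃ u v, u ≤ v ∧ I M k = Finset.Icc u v
  I_lt : ∀ M < N, ∀ i j, 1 ≤ i → i < j → SetLT (I M i) (I M j)
  I_cover : ∀ M < N, ∀ j, 1 ≤ j ↔ ∃ k, 1 ≤ k ∧ j ∈ I M k
  a_anti : ∀ M < N, ∀ i j, 1 ≤ i → i ≤ j → a M j ≤ a M i
  a_pos : ∀ M < N, ∀ j, 1 ≤ j → 0 < a M j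
  nonneg : ∀ M ≤ N, ∀ j, 1 ≤ j → ∀ v, 0 ≤ x M j v
  nonempty : ∀ M ≤ N, ∀ j, 1 ≤ j → (x M j).support.Nonempty
  lt : ∀ M ≤ N, ∀ i j, 1 ≤ i → i < j → SetLT (x M i).support (x M j).support
  base : ∀ j, 1 ≤ j → ∃ v ∈ V, x 0 j = Finsupp.single v 1
  succ : ∀ M < N, ∀ k, 1 ≤ k → x (M + 1) k = ∑ j ∈ I M k, a M j • x M j
  ra : ∀ M < N, ∀ k, 1 ≤ k → IsRepeatedAverage (residue (L (M + 1)) k * p (M + 1))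
        (θ (residue (L (M + 1)) k * p (M + 1)) •
          ∑ j ∈ I M k, Finsupp.single (minOf (x M j).support) (a M j))

theorem one_le_residue (l k : ℕ) : 1 ≤ residue l k := Nat.le_add_left _ _

theorem residue_le {l k : ℕ} (hl : 1 ≤ l) : residue l k ≤ l := Nat.mod_lt _ hl

theorem minOf_lt_minOf {E F : Finset ℕ} (hE : E.Nonempty) (hF : F.Nonempty) (h : SetLT E F) :
    minOf E < minOf F := h _ (minOf_mem hE) _ (minOf_mem hF)

theorem injOn_minOf {y : ℕ → (ℕ →₀ ℝ)} (hne : ∀ j, 1 ≤ j → (y j).support.Nonempty)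
    (hlt : ∀ i j, 1 ≤ i → i < j → SetLT (y i).support (y j).support) {J : Finset ℕ}
    (hJ : ∀ j ∈ J, 1 ≤ j) : Set.InjOn (fun j => minOf (y j).support) J := by
  intro i hi j hj hij
  by_contra hne'
  rcases lt_or_gt_of_ne hne' with h | h
  · exact (minOf_lt_minOf (hne i (hJ i hi)) (hne j (hJ j hj)) (hlt i j (hJ i hi) h)).ne hij
  · exact (minOf_lt_minOf (hne j (hJ j hj)) (hne i (hJ i hi)) (hlt j i (hJ j hj) h)).ne hij.symm

/-- Positivity of the coefficients has to be derived, together with the ordering of the supports,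
level by level. Each coefficient dominates, by monotonicity, every coefficient of the next block,
and one of those is positive because the repeated average there is nonzero and nonnegative. -/
theorem IsLayered.exists_tower {θ : ℕ → ℝ} (hθ : RegularSeq θ) {N : ℕ} {V : Set ℕ} {p L : ℕ → ℕ}
    (hp : ∀ i, 1 ≤ i → i ≤ N → 1 ≤ p i)
    {x : ℕ → ℕ → (ℕ →₀ ℝ)} (hx : IsLayered θ N V p L x) : ∃ I a, Tower θ N V p L x I a := by
  obtain ⟨⟨n, hn, hnV⟩, hstep⟩ := hx
  choose! I a hIcc hIsucc hcov hanti hra using hstep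
  have hIne : ∀ M < N, ∀ k, 1 ≤ k → (I M k).Nonempty := by
    intro M hM k hk
    obtain ⟨u, v, huv, h⟩ := hIcc M hM k hk
    rw [h]
    exact ⟨u, Finset.left_mem_Icc.2 huv⟩
  have hIlt : ∀ M < N, ∀ i j, 1 ≤ i → i < j → SetLT (I M i) (I M j) := by
    intro M hM i j hi hij
    induction j, hij using Nat.le_induction with
    | base => exact hIsucc M hM i hi
    | succ j hj ih =>
      intro s hs t ht
      obtain ⟨u, hu⟩ := hIne M hM j (hi.trans (by omega))
      exact (ih s hs u hu).trans (hIsucc M hM j (by omega) u hu t ht)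
  have hI1 : ∀ M < N, ∀ k, 1 ≤ k → ∀ j ∈ I M k, 1 ≤ j := fun M hM k hk j hj =>
    (hcov M hM j).2 ⟨k, hk, hj⟩
  have hθq : ∀ M < N, ∀ k, 0 < θ (residue (L (M + 1)) k * p (M + 1)) := fun M hM k =>
    hθ.pos _ (Nat.mul_pos (one_le_residue _ _) (hp _ (by omega) (by omega)))
  have hapos : ∀ M < N, (∀ j, 1 ≤ j → (x M j).support.Nonempty) →
      (∀ i j, 1 ≤ i → i < j → SetLT (x M i).support (x M j).support) →
      ∀ j, 1 ≤ j → 0 < a M j := by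
    intro M hM hne hlt j hj
    obtain ⟨k, hk, hjk⟩ := (hcov M hM j).1 hj
    -- The block after the one containing j is used: all its indices exceed j, so any positive
    -- coefficient in it bounds `a M j` from below.
    have hra' := (hra M hM (k + 1) (by omega)).2.basic
    obtain ⟨v, hv⟩ := hra'.2.1
    have h0 := hra'.1 v
    have hv' := Finsupp.mem_support_iff.1 hv
    rw [Finsupp.smul_apply, smul_eq_mul] at h0 hv'
    obtain ⟨i, hi, rfl⟩ := exists_of_sum_single_ne_zero
      (m := fun j => minOf (x M j).support) (right_ne_zero_of_mul hv')
    have h1 := sum_single_apply (m := fun j => minOf (x M j).support)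
      (injOn_minOf hne hlt (hI1 M hM (k + 1) (by omega))) (a M) hi
    rw [h1] at h0 hv'
    have h2 : 0 < a M i := by
      rcases lt_or_ge 0 (a M i) with h | h
      · exact h
      · nlinarith [hθq M hM (k + 1), lt_of_le_of_ne h0 hv'.symm]
    exact h2.trans_le (hanti M hM j i hj (hIlt M hM k (k + 1) hk (by omega) j hjk i hi).le)
  have hall : ∀ M ≤ N, (∀ j, 1 ≤ j → ∀ v, 0 ≤ x M j v) ∧
      (∀ j, 1 ≤ j → (x M j).support.Nonempty) ∧
      ∀ i j, 1 ≤ i → i < j → SetLT (x M i).support (x M j).support := by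
    intro M
    induction M with
    | zero =>
      intro _
      have hs : ∀ j, 1 ≤ j → (x 0 j).support = {n j} := by
        intro j hj
        rw [(hnV j hj).2, Finsupp.support_single _ one_ne_zero]
      refine ⟨fun j hj v => ?_, fun j hj => ?_, fun i j hi hij => ?_⟩
      · rw [(hnV j hj).2, Finsupp.single_apply]; split_ifs <;> norm_num
      · rw [hs j hj]; simp
      · rw [hs i hi, hs j (by omega)]
        intro s hs t ht
        rw [Finset.mem_singleton.1 hs, Finset.mem_singleton.1 ht]
        exact hn i j hi hij
    | succ M ih =>
      intro hM
      obtain ⟨h0, hne, hlt⟩ := ih (by omega)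
      have hM' : M < N := hM
      have ha := hapos M hM' hne hlt
      have hnn : ∀ k, 1 ≤ k → ∀ j ∈ I M k, ∀ v, 0 ≤ (a M j • x M j) v := by
        intro k hk j hj v
        rw [Finsupp.smul_apply]
        exact mul_nonneg (ha j (hI1 M hM' k hk j hj)).le (h0 j (hI1 M hM' k hk j hj) v)
      have hsupp : ∀ k, 1 ≤ k →
          ∀ v, v ∈ (x (M + 1) k).support ↔ ∃ j ∈ I M k, v ∈ (x M j).support := by
        intro k hk v
        rw [(hra M hM' k hk).1, support_sum_of_nonneg (hnn k hk)]
        simp only [Finset.mem_biUnion]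
        refine exists_congr fun j => and_congr_right fun hj => ?_
        rw [support_smul_pos (ha j (hI1 M hM' k hk j hj))]
      refine ⟨fun k hk v => ?_, fun k hk => ?_, fun i k hi hik => ?_⟩
      · rw [(hra M hM' k hk).1, Finsupp.finsetSum_apply]
        exact Finset.sum_nonneg fun j hj => hnn k hk j hj v
      · obtain ⟨j, hj⟩ := hIne M hM' k hk
        obtain ⟨v, hv⟩ := hne j (hI1 M hM' k hk j hj)
        exact ⟨v, (hsupp k hk v).2 ⟨j, hj, hv⟩⟩
      · intro s hs t ht
        obtain ⟨j, hj, hsj⟩ := (hsupp i hi s).1 hs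
        obtain ⟨j', hj', htj⟩ := (hsupp k (by omega) t).1 ht
        exact hlt j j' (hI1 M hM' i hi j hj) (hIlt M hM' i k hi hik j hj j' hj') s hsj t htj
  exact ⟨I, a, ⟨hIcc, hIlt, hcov, hanti, fun M hM => hapos M hM (hall M hM.le).2.1
    (hall M hM.le).2.2, fun M hM => (hall M hM).1, fun M hM => (hall M hM).2.1,
    fun M hM => (hall M hM).2.2, fun j hj => ⟨_, hnV j hj⟩, fun M hM k hk => (hra M hM k hk).1,
    fun M hM k hk => (hra M hM k hk).2⟩⟩

/-- The index `j ≥ 1` with `v ∈ supp x_j^M`. -/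
noncomputable def lev (x : ℕ → ℕ → (ℕ →₀ ℝ)) (M v : ℕ) : ℕ :=
  sInf {j | 1 ≤ j ∧ v ∈ (x M j).support}

/-- The index `r_l p_l` of the repeated average of level `l` above the point `v`. -/
noncomputable def lidx (p L : ℕ → ℕ) (x : ℕ → ℕ → (ℕ →₀ ℝ)) (l v : ℕ) : ℕ :=
  residue (L l) (lev x l v) * p l

namespace Tower

variable {θ : ℕ → ℝ} {N : ℕ} {V : Set ℕ} {p L : ℕ → ℕ} {x : ℕ → ℕ → (ℕ →₀ ℝ)}
  {I : ℕ → ℕ → Finset ℕ} {a : ℕ → ℕ → ℝ}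

theorem one_le_of_mem (h : Tower θ N V p L x I a) {M : ℕ} (hM : M < N) {k j : ℕ} (hk : 1 ≤ k)
    (hj : j ∈ I M k) : 1 ≤ j := (h.I_cover M hM j).2 ⟨k, hk, hj⟩

theorem lev_eq (h : Tower θ N V p L x I a) {M : ℕ} (hM : M ≤ N) {j v : ℕ} (hj : 1 ≤ j)
    (hv : v ∈ (x M j).support) : lev x M v = j := by
  have hmem := Nat.sInf_mem (s := {j | 1 ≤ j ∧ v ∈ (x M j).support}) ⟨j, hj, hv⟩
  change 1 ≤ lev x M v ∧ v ∈ (x M (lev x M v)).support at hmem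
  by_contra hne
  rcases lt_or_gt_of_ne hne with h' | h'
  · exact lt_irrefl v (h.lt M hM _ _ hmem.1 h' v hmem.2 v hv)
  · exact lt_irrefl v (h.lt M hM _ _ hj h' v hv v hmem.2)

theorem mem_support_succ (h : Tower θ N V p L x I a) {M : ℕ} (hM : M < N) {k : ℕ} (hk : 1 ≤ k)
    {v : ℕ} : v ∈ (x (M + 1) k).support ↔ ∃ j ∈ I M k, v ∈ (x M j).support := by
  rw [h.succ M hM k hk, support_sum_of_nonneg]
  · simp only [Finset.mem_biUnion]
    refine exists_congr fun j => and_congr_right fun hj => ?_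
    rw [support_smul_pos (h.a_pos M hM j (h.one_le_of_mem hM hk hj))]
  · intro j hj v
    rw [Finsupp.smul_apply]
    exact mul_nonneg (h.a_pos M hM j (h.one_le_of_mem hM hk hj)).le
      (h.nonneg M hM.le j (h.one_le_of_mem hM hk hj) v)

theorem apply_succ (h : Tower θ N V p L x I a) {M : ℕ} (hM : M < N) {k j : ℕ} (hk : 1 ≤ k)
    (hj : j ∈ I M k) {v : ℕ} (hv : v ∈ (x M j).support) :
    x (M + 1) k v = a M j * x M j v := by
  rw [h.succ M hM k hk, Finsupp.finsetSum_apply, Finset.sum_eq_single j]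
  · simp
  · intro i hi hij
    have h1 := h.lev_eq hM.le (h.one_le_of_mem hM hk hj) hv
    by_contra hne
    rw [Finsupp.smul_apply, smul_eq_mul] at hne
    have h2 := h.lev_eq hM.le (h.one_le_of_mem hM hk hi)
      (Finsupp.mem_support_iff.2 (right_ne_zero_of_mul hne))
    exact hij (h2.symm.trans h1)
  · exact fun hn => absurd hj hn

/-- `v` is one of the points carrying the vectors `x_j^0`. -/
def IsPoint (x : ℕ → ℕ → (ℕ →₀ ℝ)) (v : ℕ) : Prop := ∃ j, 1 ≤ j ∧ v ∈ (x 0 j).support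

theorem isPoint_of_mem (h : Tower θ N V p L x I a) {M : ℕ} (hM : M ≤ N) {j v : ℕ} (hj : 1 ≤ j)
    (hv : v ∈ (x M j).support) : IsPoint x v := by
  induction M generalizing j with
  | zero => exact ⟨j, hj, hv⟩
  | succ M ih =>
    obtain ⟨i, hi, hvi⟩ := (h.mem_support_succ hM hj).1 hv
    exact ih (by omega) (h.one_le_of_mem hM hj hi) hvi

theorem lev_spec (h : Tower θ N V p L x I a) {v : ℕ} (hv : IsPoint x v) {M : ℕ} (hM : M ≤ N) :
    1 ≤ lev x M v ∧ v ∈ (x M (lev x M v)).support := by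
  induction M with
  | zero =>
    obtain ⟨j, hj, hvj⟩ := hv
    rw [h.lev_eq hM hj hvj]
    exact ⟨hj, hvj⟩
  | succ M ih =>
    obtain ⟨h1, h2⟩ := ih (by omega)
    obtain ⟨k, hk, hjk⟩ := (h.I_cover M hM _).1 h1
    have h3 := (h.mem_support_succ hM hk).2 ⟨_, hjk, h2⟩
    rw [h.lev_eq hM hk h3]
    exact ⟨hk, h3⟩

theorem one_le_lev (h : Tower θ N V p L x I a) {v : ℕ} (hv : IsPoint x v) {M : ℕ} (hM : M ≤ N) :
    1 ≤ lev x M v := (h.lev_spec hv hM).1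

theorem mem_lev (h : Tower θ N V p L x I a) {v : ℕ} (hv : IsPoint x v) {M : ℕ} (hM : M ≤ N) :
    v ∈ (x M (lev x M v)).support := (h.lev_spec hv hM).2

theorem lev_mem_I (h : Tower θ N V p L x I a) {v : ℕ} (hv : IsPoint x v) {M : ℕ} (hM : M < N) :
    lev x M v ∈ I M (lev x (M + 1) v) := by
  obtain ⟨k, hk, hjk⟩ := (h.I_cover M hM _).1 (h.one_le_lev hv hM.le)
  have h3 := (h.mem_support_succ hM hk).2 ⟨_, hjk, h.mem_lev hv hM.le⟩
  rwa [h.lev_eq hM hk h3]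

theorem mem_support_iff (h : Tower θ N V p L x I a) {M : ℕ} (hM : M ≤ N) {j v : ℕ}
    (hj : 1 ≤ j) : v ∈ (x M j).support ↔ IsPoint x v ∧ lev x M v = j := by
  constructor
  · exact fun hv => ⟨h.isPoint_of_mem hM hj hv, h.lev_eq hM hj hv⟩
  · rintro ⟨hv, rfl⟩
    exact h.mem_lev hv hM

theorem lev_mono (h : Tower θ N V p L x I a) {v w : ℕ} (hv : IsPoint x v) (hw : IsPoint x w)
    (hvw : v ≤ w) {M : ℕ} (hM : M ≤ N) : lev x M v ≤ lev x M w := by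
  by_contra hlt
  exact absurd (h.lt M hM _ _ (h.one_le_lev hw hM) (not_le.1 hlt) w (h.mem_lev hw hM) v
    (h.mem_lev hv hM)) (by omega)

theorem lt_of_lev_lt (h : Tower θ N V p L x I a) {v w : ℕ} (hv : IsPoint x v) (hw : IsPoint x w)
    {M : ℕ} (hM : M ≤ N) (hlt : lev x M v < lev x M w) : v < w :=
  h.lt M hM _ _ (h.one_le_lev hv hM) hlt v (h.mem_lev hv hM) w (h.mem_lev hw hM)

theorem I_eq (h : Tower θ N V p L x I a) {M : ℕ} (hM : M < N) {j k k' : ℕ} (hk : 1 ≤ k)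
    (hk' : 1 ≤ k') (hj : j ∈ I M k) (hj' : j ∈ I M k') : k = k' := by
  by_contra hne
  rcases lt_or_gt_of_ne hne with h' | h'
  · exact lt_irrefl j (h.I_lt M hM _ _ hk h' j hj j hj')
  · exact lt_irrefl j (h.I_lt M hM _ _ hk' h' j hj' j hj)

theorem lev_succ_congr (h : Tower θ N V p L x I a) {v w : ℕ} (hv : IsPoint x v)
    (hw : IsPoint x w) {M : ℕ} (hM : M < N) (he : lev x M v = lev x M w) :
    lev x (M + 1) v = lev x (M + 1) w := by
  have h1 := h.lev_mem_I hv hM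
  rw [he] at h1
  exact h.I_eq hM (h.one_le_lev hv hM) (h.one_le_lev hw hM) h1 (h.lev_mem_I hw hM)

theorem lev_congr (h : Tower θ N V p L x I a) {v w : ℕ} (hv : IsPoint x v)
    (hw : IsPoint x w) {M M' : ℕ} (hM : M ≤ M') (hM' : M' ≤ N) (he : lev x M v = lev x M w) :
    lev x M' v = lev x M' w := by
  induction M', hM using Nat.le_induction with
  | base => exact he
  | succ m _ ih => exact h.lev_succ_congr hv hw hM' (ih (by omega))

theorem le_minOf (h : Tower θ N V p L x I a) (hV : ∀ v ∈ V, 1 ≤ v) {M : ℕ} (hM : M ≤ N) {j : ℕ}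
    (hj : 1 ≤ j) : j ≤ minOf (x M j).support := by
  induction j, hj using Nat.le_induction with
  | base =>
    obtain ⟨i, hi, hv⟩ := h.isPoint_of_mem hM le_rfl (minOf_mem (h.nonempty M hM 1 le_rfl))
    obtain ⟨v, hvV, he⟩ := h.base i hi
    rw [he, Finsupp.support_single _ one_ne_zero, Finset.mem_singleton] at hv
    rw [hv]
    exact hV v hvV
  | succ j hj ih =>
    have := minOf_lt_minOf (h.nonempty M hM j hj) (h.nonempty M hM (j + 1) (by omega))
      (h.lt M hM j (j + 1) hj (by omega))
    omega

theorem lidx_pos (hp : ∀ i, 1 ≤ i → i ≤ N → 1 ≤ p i) {l : ℕ} (hl : 1 ≤ l) (hlN : l ≤ N)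
    (v : ℕ) : 1 ≤ lidx p L x l v := Nat.mul_pos (one_le_residue _ _) (hp l hl hlN)

theorem mem_V (h : Tower θ N V p L x I a) {v : ℕ} (hv : IsPoint x v) : v ∈ V := by
  obtain ⟨j, hj, hvj⟩ := hv
  obtain ⟨u, hu, he⟩ := h.base j hj
  rw [he, Finsupp.support_single _ one_ne_zero, Finset.mem_singleton] at hvj
  rwa [hvj]

theorem mem_span (h : Tower θ N V p L x I a) {M : ℕ} (hM : M ≤ N) {j : ℕ} (hj : 1 ≤ j) :
    x M j ∈ Submodule.span ℝ ((fun v : ℕ => (Finsupp.single v 1 : ℕ →₀ ℝ)) '' V) := by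
  rw [← Finsupp.sum_single (x M j)]
  refine Submodule.sum_mem _ fun v hv => ?_
  have he : Finsupp.single v (x M j v) = x M j v • (Finsupp.single v 1 : ℕ →₀ ℝ) := by simp
  rw [he]
  exact Submodule.smul_mem _ _ (Submodule.subset_span
    ⟨v, h.mem_V (h.isPoint_of_mem hM hj hv), rfl⟩)

/-! ### Normalised vectors -/

/-- The vector `x_j^M`, multiplied pointwise by the `θ_{r_l p_l}`, so that its coefficients add up
to one. -/
noncomputable def nrm (θ : ℕ → ℝ) (p L : ℕ → ℕ) (x : ℕ → ℕ → (ℕ →₀ ℝ)) (M j v : ℕ) : ℝ :=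
  x M j v * ∏ l ∈ Finset.Icc 1 M, θ (lidx p L x l v)

/-- The weight of `x_j^M` in its parent, after normalisation. -/
noncomputable def cof (θ : ℕ → ℝ) (p L : ℕ → ℕ) (a : ℕ → ℕ → ℝ) (M k j : ℕ) : ℝ :=
  θ (residue (L (M + 1)) k * p (M + 1)) * a M j

theorem theta_pos (hθ : RegularSeq θ) (hp : ∀ i, 1 ≤ i → i ≤ N → 1 ≤ p i) {M : ℕ} (hM : M < N)
    (k : ℕ) : 0 < θ (residue (L (M + 1)) k * p (M + 1)) :=
  hθ.pos _ (Nat.mul_pos (one_le_residue _ _) (hp _ (by omega) (by omega)))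

theorem cof_pos (h : Tower θ N V p L x I a) (hθ : RegularSeq θ)
    (hp : ∀ i, 1 ≤ i → i ≤ N → 1 ≤ p i) {M : ℕ} (hM : M < N) (k : ℕ) {j : ℕ} (hj : 1 ≤ j) :
    0 < cof θ p L a M k j := mul_pos (theta_pos hθ hp hM k) (h.a_pos M hM j hj)

theorem nrm_succ (h : Tower θ N V p L x I a) {M : ℕ} (hM : M < N) {k j : ℕ} (hk : 1 ≤ k)
    (hj : j ∈ I M k) {v : ℕ} (hv : v ∈ (x M j).support) :
    nrm θ p L x (M + 1) k v = cof θ p L a M k j * nrm θ p L x M j v := by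
  have h1 : lev x (M + 1) v = k :=
    h.lev_eq hM hk ((h.mem_support_succ hM hk).2 ⟨j, hj, hv⟩)
  simp only [nrm, cof]
  rw [h.apply_succ hM hk hj hv, Finset.prod_Icc_succ_top (by omega), lidx, h1]
  ring

/-- The repeated average attached to `x_k^{M+1}`. -/
noncomputable def avg (θ : ℕ → ℝ) (p L : ℕ → ℕ) (x : ℕ → ℕ → (ℕ →₀ ℝ))
    (I : ℕ → ℕ → Finset ℕ) (a : ℕ → ℕ → ℝ) (M k : ℕ) : ℕ →₀ ℝ :=
  θ (residue (L (M + 1)) k * p (M + 1)) •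
          ∑ j ∈ I M k, Finsupp.single (minOf (x M j).support) (a M j)

theorem avg_apply (h : Tower θ N V p L x I a) {M : ℕ} (hM : M < N) {k j : ℕ} (hk : 1 ≤ k)
    (hj : j ∈ I M k) : avg θ p L x I a M k (minOf (x M j).support) = cof θ p L a M k j := by
  have h1 := sum_single_apply (m := fun j => minOf (x M j).support)
    (injOn_minOf (h.nonempty M hM.le) (h.lt M hM.le) fun j hj => h.one_le_of_mem hM hk hj)
    (a M) hj
  rw [avg, Finsupp.smul_apply, smul_eq_mul, h1, cof]

theorem avg_support (h : Tower θ N V p L x I a) (hθ : RegularSeq θ)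
    (hp : ∀ i, 1 ≤ i → i ≤ N → 1 ≤ p i) {M : ℕ} (hM : M < N) {k : ℕ} (hk : 1 ≤ k) :
    (avg θ p L x I a M k).support = (I M k).image fun j => minOf (x M j).support := by
  ext v
  rw [Finset.mem_image]
  constructor
  · intro hv
    rw [Finsupp.mem_support_iff, avg, Finsupp.smul_apply, smul_eq_mul] at hv
    exact exists_of_sum_single_ne_zero (m := fun j => minOf (x M j).support)
      (right_ne_zero_of_mul hv)
  · rintro ⟨j, hj, rfl⟩
    rw [Finsupp.mem_support_iff, h.avg_apply hM hk hj]
    exact (h.cof_pos hθ hp hM k (h.one_le_of_mem hM hk hj)).ne'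

theorem sum_avg (h : Tower θ N V p L x I a) (hθ : RegularSeq θ)
    (hp : ∀ i, 1 ≤ i → i ≤ N → 1 ≤ p i) {M : ℕ} (hM : M < N) {k : ℕ} (hk : 1 ≤ k) (f : ℕ → ℝ) :
    ∑ u ∈ (avg θ p L x I a M k).support, avg θ p L x I a M k u * f u =
      ∑ j ∈ I M k, cof θ p L a M k j * f (minOf (x M j).support) := by
  rw [h.avg_support hθ hp hM hk, Finset.sum_image
    (injOn_minOf (h.nonempty M hM.le) (h.lt M hM.le) fun j hj => h.one_le_of_mem hM hk hj)]
  exact Finset.sum_congr rfl fun j hj => by rw [h.avg_apply hM hk hj]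

theorem sum_cof (h : Tower θ N V p L x I a) (hθ : RegularSeq θ)
    (hp : ∀ i, 1 ≤ i → i ≤ N → 1 ≤ p i) {M : ℕ} (hM : M < N) {k : ℕ} (hk : 1 ≤ k) :
    ∑ j ∈ I M k, cof θ p L a M k j = 1 := by
  have h1 := h.sum_avg hθ hp hM hk fun _ => 1
  simp only [mul_one] at h1
  rw [← h1]
  exact (h.ra M hM k hk).basic.2.2.2

/-- Sums over `supp x_k^{M+1}` split into sums over the `supp x_j^M`. -/
theorem sum_support_succ (h : Tower θ N V p L x I a) {M : ℕ} (hM : M < N) {k : ℕ} (hk : 1 ≤ k)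
    (f : ℕ → ℝ) : ∑ v ∈ (x (M + 1) k).support, f v =
      ∑ j ∈ I M k, ∑ v ∈ (x M j).support, f v := by
  have hs : (x (M + 1) k).support = (I M k).biUnion fun j => (x M j).support := by
    ext v
    rw [Finset.mem_biUnion]
    exact h.mem_support_succ hM hk
  rw [hs, Finset.sum_biUnion]
  intro i hi j hj hij
  refine Finset.disjoint_left.2 fun v hvi hvj => hij ?_
  rw [← h.lev_eq hM.le (h.one_le_of_mem hM hk hi) hvi,
    h.lev_eq hM.le (h.one_le_of_mem hM hk hj) hvj]

theorem sum_nrm (h : Tower θ N V p L x I a) (hθ : RegularSeq θ)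
    (hp : ∀ i, 1 ≤ i → i ≤ N → 1 ≤ p i) {M : ℕ} (hM : M ≤ N) {j : ℕ} (hj : 1 ≤ j) :
    ∑ v ∈ (x M j).support, nrm θ p L x M j v = 1 := by
  induction M generalizing j with
  | zero =>
    obtain ⟨u, -, he⟩ := h.base j hj
    rw [he, Finsupp.support_single _ one_ne_zero]
    simp [nrm, he]
  | succ M ih =>
    rw [h.sum_support_succ hM hj, ← h.sum_cof hθ hp hM hj]
    refine Finset.sum_congr rfl fun i hi => ?_
    rw [Finset.sum_congr rfl fun v hv => h.nrm_succ hM hj hi hv, ← Finset.mul_sum,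
      ih (by omega) (h.one_le_of_mem hM hj hi), mul_one]

theorem nrm_nonneg (h : Tower θ N V p L x I a) (hθ : RegularSeq θ)
    (hp : ∀ i, 1 ≤ i → i ≤ N → 1 ≤ p i) {M : ℕ} (hM : M ≤ N) {j : ℕ} (hj : 1 ≤ j) (v : ℕ) :
    0 ≤ nrm θ p L x M j v :=
  mul_nonneg (h.nonneg M hM j hj v) (Finset.prod_nonneg fun _ hl =>
    (hθ.pos _ (lidx_pos hp (Finset.mem_Icc.1 hl).1 ((Finset.mem_Icc.1 hl).2.trans hM) v)).le)

end Tower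

/-! ### Norming functionals of X_M along the layers -/

theorem Norming.congr {θ : ℕ → ℝ} {E : Finset ℕ} {g g' : ℕ → ℝ} (h : Norming θ E g)
    (hg : ∀ v ∈ E, g v = g' v) : Norming θ E g' := fun x hx => by
  refine le_trans (le_of_eq ?_) (h x hx)
  exact Finset.sum_congr rfl fun v hv => by rw [hg v hv]

namespace Tower

variable {θ : ℕ → ℝ} {N : ℕ} {V : Set ℕ} {p L : ℕ → ℕ} {x : ℕ → ℕ → (ℕ →₀ ℝ)}
  {I : ℕ → ℕ → Finset ℕ} {a : ℕ → ℕ → ℝ}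

theorem support_succ (h : Tower θ N V p L x I a) {M : ℕ} (hM : M < N) {k : ℕ} (hk : 1 ≤ k) :
    (x (M + 1) k).support = (I M k).biUnion fun j => (x M j).support := by
  ext v
  rw [Finset.mem_biUnion]
  exact h.mem_support_succ hM hk

theorem disjoint_support (h : Tower θ N V p L x I a) {M : ℕ} (hM : M ≤ N) {i j : ℕ} (hi : 1 ≤ i)
    (hj : 1 ≤ j) (hij : i ≠ j) : Disjoint (x M i).support (x M j).support :=
  Finset.disjoint_left.2 fun v hvi hvj => hij <| by
    rw [← h.lev_eq hM hi hvi, ← h.lev_eq hM hj hvj]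

theorem image_minOf_mem (h : Tower θ N V p L x I a) (hθ : RegularSeq θ)
    (hp : ∀ i, 1 ≤ i → i ≤ N → 1 ≤ p i) {M : ℕ} (hM : M < N) {k : ℕ} (hk : 1 ≤ k) :
    (I M k).image (fun j => minOf (x M j).support) ∈
      Schreier (residue (L (M + 1)) k * p (M + 1)) := by
  rw [← h.avg_support hθ hp hM hk]
  exact (h.ra M hM k hk).basic.2.2.1

/-- One allowable combination is used for each layer, with the order of its repeated average.
Applied to x itself at level N, this functional returns the total normalised mass 1. -/
theorem norming_level (h : Tower θ N V p L x I a) (hθ : RegularSeq θ)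
    (hp : ∀ i, 1 ≤ i → i ≤ N → 1 ≤ p i) {M : ℕ} (hM : M ≤ N) {j : ℕ} (hj : 1 ≤ j) :
    Norming θ (x M j).support fun v => ∏ l ∈ Finset.Icc 1 M, θ (lidx p L x l v) := by
  induction M generalizing j with
  | zero =>
    obtain ⟨u, -, he⟩ := h.base j hj
    rw [he, Finsupp.support_single _ one_ne_zero]
    exact norming_singleton hθ u (by simp)
  | succ M ih =>
    have hq : 1 ≤ residue (L (M + 1)) j * p (M + 1) :=
      Nat.mul_pos (one_le_residue _ _) (hp _ (by omega) hM)
    have h1 := Norming.biUnion hθ (J := I M j) (E := fun i => (x M i).support) hq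
      (fun i hi => h.nonempty M (by omega) i (h.one_le_of_mem hM hj hi))
      (fun i hi i' hi' hne => h.disjoint_support (by omega) (h.one_le_of_mem hM hj hi)
        (h.one_le_of_mem hM hj hi') hne)
      (h.image_minOf_mem hθ hp hM hj)
      fun i hi => ih (by omega) (h.one_le_of_mem hM hj hi)
    rw [← h.support_succ hM hj] at h1
    refine h1.congr fun v hv => ?_
    rw [Finset.prod_Icc_succ_top (by omega), lidx, h.lev_eq hM hj hv, mul_comm]

/-- The sum of the indices of the levels above `M`. -/
noncomputable def tail (N : ℕ) (p L : ℕ → ℕ) (x : ℕ → ℕ → (ℕ →₀ ℝ)) (M v : ℕ) : ℕ :=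
  ∑ l ∈ Finset.Ioc M N, lidx p L x l v

/-- The sequence of indices of the levels above `M`. -/
noncomputable def typ (N : ℕ) (p L : ℕ → ℕ) (x : ℕ → ℕ → (ℕ →₀ ℝ)) (M v l : ℕ) : ℕ :=
  if l ∈ Finset.Ioc M N then lidx p L x l v else 0

theorem typ_of_mem {M v l : ℕ} (hl : l ∈ Finset.Ioc M N) :
    typ N p L x M v l = lidx p L x l v := if_pos hl

theorem typ_eq_iff {M v w : ℕ} : typ N p L x M v = typ N p L x M w ↔
    ∀ l ∈ Finset.Ioc M N, lidx p L x l v = lidx p L x l w := by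
  constructor
  · intro he l hl
    have := congrFun he l
    rwa [typ_of_mem hl, typ_of_mem hl] at this
  · intro he
    funext l
    simp only [typ]
    split_ifs with hl
    · exact he l hl
    · rfl

theorem tail_eq_of_typ_eq {M v w : ℕ} (he : typ N p L x M v = typ N p L x M w) :
    tail N p L x M v = tail N p L x M w :=
  Finset.sum_congr rfl fun l hl => typ_eq_iff.1 he l hl

theorem tail_eq_sum_typ (M v : ℕ) :
    tail N p L x M v = ∑ l ∈ Finset.Ioc M N, typ N p L x M v l :=
  Finset.sum_congr rfl fun _ hl => (typ_of_mem hl).symm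

theorem lidx_congr (h : Tower θ N V p L x I a) {v w : ℕ} (hv : IsPoint x v)
    (hw : IsPoint x w) {M l : ℕ} (hM : M ≤ l) (hl : l ≤ N) (he : lev x M v = lev x M w) :
    lidx p L x l v = lidx p L x l w := by
  rw [lidx, lidx, h.lev_congr hv hw hM hl he]

theorem typ_congr (h : Tower θ N V p L x I a) {v w : ℕ} (hv : IsPoint x v)
    (hw : IsPoint x w) {M : ℕ} (he : lev x M v = lev x M w) :
    typ N p L x M v = typ N p L x M w :=
  typ_eq_iff.2 fun _ hl => h.lidx_congr hv hw (Finset.mem_Ioc.1 hl).1.le (Finset.mem_Ioc.1 hl).2 he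

open scoped Classical in
-- A type is determined by the residues at the levels strictly between M and N: the index at level N
-- is the same for all points of the support, since they all lie in the single vector number k.
theorem card_image_typ_le (h : Tower θ N V p L x I a) (hL : ∀ i, 1 ≤ i → i ≤ N → 2 ≤ L i)
    {M k : ℕ} (hk : 1 ≤ k) :
    ((x N k).support.image (typ N p L x M)).card ≤ ∏ l ∈ Finset.Ioo M N, L l := by
  have h1 : (x N k).support.image (typ N p L x M) ⊆
      ((Finset.Ioo M N).pi fun l => Finset.Icc 1 (L l)).image
        (fun f l => if hl : l ∈ Finset.Ioo M N then f l hl * p l else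
          if l ∈ Finset.Ioc M N then residue (L l) k * p l else 0) := by
    intro t ht
    obtain ⟨v, hv, rfl⟩ := Finset.mem_image.1 ht
    refine Finset.mem_image.2 ⟨fun l _ => residue (L l) (lev x l v), ?_, ?_⟩
    · refine Finset.mem_pi.2 fun l hl => Finset.mem_Icc.2 ⟨one_le_residue _ _, residue_le ?_⟩
      rw [Finset.mem_Ioo] at hl
      exact (hL l (by omega) (by omega)).trans' (by omega)
    · funext l
      simp only [typ, lidx]
      by_cases hl : l ∈ Finset.Ioo M N
      · have hl' : l ∈ Finset.Ioc M N := Finset.Ioo_subset_Ioc_self hl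
        simp [hl, hl']
      · by_cases hl' : l ∈ Finset.Ioc M N
        · have hlN : l = N := by
            rw [Finset.mem_Ioo] at hl; rw [Finset.mem_Ioc] at hl'; omega
          rw [dif_neg hl, if_pos hl', if_pos hl', hlN, h.lev_eq le_rfl hk hv]
        · rw [dif_neg hl, if_neg hl', if_neg hl']
  refine (Finset.card_le_card h1).trans (Finset.card_image_le.trans ?_)
  rw [Finset.card_pi]
  simp

theorem minOf_mem_support (h : Tower θ N V p L x I a) {M : ℕ} (hM : M ≤ N) {j : ℕ}
    (hj : 1 ≤ j) : minOf (x M j).support ∈ (x M j).support := minOf_mem (h.nonempty M hM j hj)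

/-- A point in the same level `M` vector as `v` is in the same level `m` vector. -/
theorem mem_support_of_lev_eq (h : Tower θ N V p L x I a) {M m : ℕ} (hM : M ≤ m) (hm : m ≤ N)
    {j v w : ℕ} (hj : 1 ≤ j) (hv : v ∈ (x m j).support) (hw : w ∈ (x M (lev x M v)).support) :
    w ∈ (x m j).support := by
  have hvp := h.isPoint_of_mem hm hj hv
  have h1 := h.one_le_lev hvp (hM.trans hm)
  have hwp := h.isPoint_of_mem (hM.trans hm) h1 hw
  have h2 := h.lev_eq (hM.trans hm) h1 hw
  refine (h.mem_support_iff hm hj).2 ⟨hwp, ?_⟩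
  rw [h.lev_congr hwp hvp hM hm h2, h.lev_eq hm hj hv]

/-- Each layer between M and m replaces the points of a Schreier set of order ρ l by sets lying to
their right, so the orders add. Prescribing the indices makes the order of the result independent of
the vector of level m. -/
theorem image_typ_mem_schreier (h : Tower θ N V p L x I a) (hθ : RegularSeq θ)
    (hp : ∀ i, 1 ≤ i → i ≤ N → 1 ≤ p i) (hV : ∀ v ∈ V, 1 ≤ v) {M m : ℕ} (hM : M ≤ m) (hm : m ≤ N)
    (ρ : ℕ → ℕ) {j : ℕ} (hj : 1 ≤ j) :
    ((x m j).support.filter fun v => ∀ l ∈ Finset.Ioc M m, lidx p L x l v = ρ l).image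
      (fun v => minOf (x M (lev x M v)).support) ∈ Schreier (∑ l ∈ Finset.Ioc M m, ρ l) := by
  induction m, hM using Nat.le_induction generalizing j with
  | base =>
    refine schreier_subset (F := {minOf (x M j).support}) ?_ ?_
    · exact singleton_mem_schreier _ (hj.trans (h.le_minOf hV hm hj))
    · intro g hg
      obtain ⟨v, hv, rfl⟩ := Finset.mem_image.1 hg
      rw [h.lev_eq hm hj (Finset.mem_filter.1 hv).1]
      simp
  | succ m hM ih =>
    have hm' : m < N := hm
    by_cases hex : residue (L (m + 1)) j * p (m + 1) = ρ (m + 1)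
    swap
    · rw [Finset.filter_false_of_mem]
      · simpa using empty_mem_schreier _
      · intro v hv hall
        have := hall (m + 1) (Finset.mem_Ioc.2 (by omega))
        rw [lidx, h.lev_eq hm hj hv] at this
        exact hex this
    let H : ℕ → Finset ℕ := fun u =>
      ((x m (lev x m u)).support.filter fun v => ∀ l ∈ Finset.Ioc M m, lidx p L x l v = ρ l).image
        (fun v => minOf (x M (lev x M v)).support)
    have hF := h.image_minOf_mem hθ hp hm' hj
    have hlevu : ∀ i ∈ I m j, lev x m (minOf (x m i).support) = i := fun i hi =>
      h.lev_eq hm'.le (h.one_le_of_mem hm' hj hi)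
        (h.minOf_mem_support hm'.le (h.one_le_of_mem hm' hj hi))
    have hHsub : ∀ i ∈ I m j, ∀ g ∈ H (minOf (x m i).support), g ∈ (x m i).support := by
      intro i hi g hg
      obtain ⟨v, hv, rfl⟩ := Finset.mem_image.1 hg
      rw [hlevu i hi] at hv
      have hi1 := h.one_le_of_mem hm' hj hi
      have hvi := (Finset.mem_filter.1 hv).1
      exact h.mem_support_of_lev_eq hM hm'.le hi1 hvi (h.minOf_mem_support (hM.trans hm'.le)
        (h.one_le_lev (h.isPoint_of_mem hm'.le hi1 hvi) (hM.trans hm'.le)))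
    have hmain := schreier_biUnion (a := ∑ l ∈ Finset.Ioc M m, ρ l) hF (H := H)
      (fun u hu => by
        obtain ⟨i, hi, rfl⟩ := Finset.mem_image.1 hu
        have := ih hm'.le (h.one_le_of_mem hm' hj hi)
        simp only [H]
        rwa [hlevu i hi])
      (fun u hu g hg => by
        obtain ⟨i, hi, rfl⟩ := Finset.mem_image.1 hu
        exact minOf_le (hHsub i hi g hg))
      (fun u hu w hw huw g hg g' hg' => by
        obtain ⟨i, hi, rfl⟩ := Finset.mem_image.1 hu
        obtain ⟨i', hi', rfl⟩ := Finset.mem_image.1 hw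
        have hi1 := h.one_le_of_mem hm' hj hi
        have hi1' := h.one_le_of_mem hm' hj hi'
        have hlt : i < i' := by
          by_contra hle
          have := h.lev_mono (h.isPoint_of_mem hm'.le hi1 (h.minOf_mem_support hm'.le hi1))
            (h.isPoint_of_mem hm'.le hi1' (h.minOf_mem_support hm'.le hi1')) huw.le hm'.le
          rw [hlevu i hi, hlevu i' hi'] at this
          have : i = i' := by omega
          rw [this] at huw
          exact lt_irrefl _ huw
        exact h.lt m hm'.le i i' hi1 hlt g (hHsub i hi g hg) g' (hHsub i' hi' g' hg'))
    rw [Finset.sum_Ioc_succ_top hM, add_comm, ← hex]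
    refine schreier_subset hmain fun g hg => ?_
    obtain ⟨v, hv, rfl⟩ := Finset.mem_image.1 hg
    obtain ⟨hv1, hv2⟩ := Finset.mem_filter.1 hv
    obtain ⟨i, hi, hvi⟩ := (h.mem_support_succ hm' hj).1 hv1
    refine Finset.mem_biUnion.2 ⟨_, Finset.mem_image_of_mem _ hi, ?_⟩
    refine Finset.mem_image.2 ⟨v, ?_, rfl⟩
    rw [hlevu i hi]
    refine Finset.mem_filter.2 ⟨hvi, fun l hl => hv2 l ?_⟩
    rw [Finset.mem_Ioc] at hl ⊢
    omega

theorem one_le_tail (hp : ∀ i, 1 ≤ i → i ≤ N → 1 ≤ p i) {M : ℕ} (hM : M < N) (v : ℕ) :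
    1 ≤ tail N p L x M v :=
  (lidx_pos hp (by omega) le_rfl v).trans (Finset.single_le_sum (f := fun l => lidx p L x l v)
    (fun _ _ => Nat.zero_le _) (Finset.mem_Ioc.2 ⟨hM, le_rfl⟩))

open scoped Classical in
-- The level-M vectors of one type have minima of Schreier order t_M, so all the layers above M are
-- merged into a single combination with the factor θ of the sum of their indices.
theorem norming_typ (h : Tower θ N V p L x I a) (hθ : RegularSeq θ)
    (hp : ∀ i, 1 ≤ i → i ≤ N → 1 ≤ p i) (hV : ∀ v ∈ V, 1 ≤ v) {M : ℕ} (hM : M < N) {k : ℕ}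
    (hk : 1 ≤ k) (v₀ : ℕ) :
    Norming θ ((x N k).support.filter fun v => typ N p L x M v = typ N p L x M v₀)
      fun v => θ (tail N p L x M v) * ∏ l ∈ Finset.Icc 1 M, θ (lidx p L x l v) := by
  set E := (x N k).support.filter fun v => typ N p L x M v = typ N p L x M v₀ with hE
  have hEk : ∀ v ∈ E, v ∈ (x N k).support := fun v hv => (Finset.mem_filter.1 hv).1
  have hpt : ∀ v ∈ E, IsPoint x v := fun v hv => h.isPoint_of_mem le_rfl hk (hEk v hv)
  have h1 : ∀ j ∈ E.image (lev x M), 1 ≤ j := by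
    intro j hj
    obtain ⟨v, hv, rfl⟩ := Finset.mem_image.1 hj
    exact h.one_le_lev (hpt v hv) hM.le
  have hS := h.image_typ_mem_schreier hθ hp hV hM.le le_rfl (typ N p L x M v₀) hk
  rw [← tail_eq_sum_typ] at hS
  have hn := Norming.biUnion hθ (J := E.image (lev x M)) (E := fun i => (x M i).support)
      (one_le_tail hp hM v₀)
      (fun i hi => h.nonempty M hM.le i (h1 i hi))
      (fun i hi i' hi' hne => h.disjoint_support hM.le (h1 i hi) (h1 i' hi') hne)
      (by
        rw [Finset.image_image]
        refine schreier_subset hS fun g hg => ?_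
        obtain ⟨v, hv, rfl⟩ := Finset.mem_image.1 hg
        refine Finset.mem_image.2 ⟨v, Finset.mem_filter.2 ⟨hEk v hv, fun l hl => ?_⟩, rfl⟩
        rw [← (Finset.mem_filter.1 hv).2, typ_of_mem hl])
      (fun i hi => h.norming_level hθ hp hM.le (h1 i hi))
  have hEu : (E.image (lev x M)).biUnion (fun i => (x M i).support) = E := by
    ext v
    rw [Finset.mem_biUnion]
    constructor
    · rintro ⟨j, hj, hvj⟩
      have hj1 := h1 j hj
      obtain ⟨w, hw, rfl⟩ := Finset.mem_image.1 hj
      have hvp := h.isPoint_of_mem hM.le hj1 hvj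
      rw [hE, Finset.mem_filter]
      refine ⟨h.mem_support_of_lev_eq hM.le le_rfl hk (hEk w hw) hvj, ?_⟩
      rw [h.typ_congr hvp (hpt w hw) (h.lev_eq hM.le hj1 hvj)]
      exact (Finset.mem_filter.1 hw).2
    · intro hv
      exact ⟨_, Finset.mem_image_of_mem _ hv, h.mem_lev (hpt v hv) hM.le⟩
  rw [hEu] at hn
  refine hn.congr fun v hv => ?_
  rw [tail_eq_of_typ_eq (Finset.mem_filter.1 hv).2]

/-- The lower estimate in `X_M`. -/
theorem norming_tail (h : Tower θ N V p L x I a) (hθ : RegularSeq θ)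
    (hp : ∀ i, 1 ≤ i → i ≤ N → 1 ≤ p i) (hL : ∀ i, 1 ≤ i → i ≤ N → 2 ≤ L i)
    (hV : ∀ v ∈ V, 1 ≤ v) {M : ℕ} (hM : M < N) {k : ℕ}
    (hk : 1 ≤ k) (hkL : ∏ l ∈ Finset.Ioo M N, L l ≤ k) :
    Norming θ (x N k).support
      fun v => θ 1 * (θ (tail N p L x M v) * ∏ l ∈ Finset.Icc 1 M, θ (lidx p L x l v)) := by
  classical
  set S := (x N k).support with hS
  let E : (ℕ → ℕ) → Finset ℕ := fun t => S.filter fun v => typ N p L x M v = t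
  have hne : ∀ t ∈ S.image (typ N p L x M), (E t).Nonempty := by
    intro t ht
    obtain ⟨v, hv, rfl⟩ := Finset.mem_image.1 ht
    exact ⟨v, Finset.mem_filter.2 ⟨hv, rfl⟩⟩
  have hES : ∀ t, ∀ v ∈ E t, v ∈ S := fun t v hv => (Finset.mem_filter.1 hv).1
  have hge : ∀ t ∈ S.image (typ N p L x M), k ≤ minOf (E t) := fun t ht =>
    (h.le_minOf hV le_rfl hk).trans (minOf_le (hES t _ (minOf_mem (hne t ht))))
  have hn := Norming.biUnion hθ (J := S.image (typ N p L x M)) (E := E) le_rfl hne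
    (fun s _ t _ hst => Finset.disjoint_left.2 fun v hvs hvt => hst <| by
      rw [← (Finset.mem_filter.1 hvs).2, ← (Finset.mem_filter.1 hvt).2])
    (by
      -- There are at most k types and every point of the support is at least k, so the minima of
      -- the classes form an 𝒮_1 set.
      refine mem_schreier_one (fun m hm => ?_) fun m hm => ?_
      · obtain ⟨t, ht, rfl⟩ := Finset.mem_image.1 hm
        exact hk.trans (hge t ht)
      · obtain ⟨t, ht, rfl⟩ := Finset.mem_image.1 hm
        exact (Finset.card_image_le.trans ((h.card_image_typ_le hL hk).trans hkL)).trans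
          (hge t ht))
    (g := fun v => θ (tail N p L x M v) * ∏ l ∈ Finset.Icc 1 M, θ (lidx p L x l v))
    (fun t ht => by
      obtain ⟨v, hv, rfl⟩ := Finset.mem_image.1 ht
      exact h.norming_typ hθ hp hV hM hk v)
  have hEu : (S.image (typ N p L x M)).biUnion E = S := by
    ext v
    rw [Finset.mem_biUnion]
    constructor
    · rintro ⟨t, -, hv⟩
      exact hES t v hv
    · intro hv
      exact ⟨_, Finset.mem_image_of_mem _ hv, Finset.mem_filter.2 ⟨hv, rfl⟩⟩
  rwa [hEu] at hn

theorem one_le_normXM (h : Tower θ N V p L x I a) (hθ : RegularSeq θ)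
    (hp : ∀ i, 1 ≤ i → i ≤ N → 1 ≤ p i) {k : ℕ} (hk : 1 ≤ k) : 1 ≤ normXM θ (x N k) := by
  rw [← h.sum_nrm hθ hp le_rfl hk]
  refine le_trans (le_of_eq ?_) (h.norming_level hθ hp le_rfl hk (x N k) (h.nonneg N le_rfl k hk))
  exact Finset.sum_congr rfl fun v _ => mul_comm _ _

/-! ### Smallness of the normalised vectors -/

theorem minOf_le_card_support (h : Tower θ N V p L x I a) (hθ : RegularSeq θ)
    (hp : ∀ i, 1 ≤ i → i ≤ N → 1 ≤ p i) {M : ℕ} (hM1 : 1 ≤ M) (hM : M ≤ N) {k : ℕ} (hk : 1 ≤ k) :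
    minOf (x M k).support ≤ (x M k).support.card := by
  obtain ⟨M, rfl⟩ := Nat.exists_eq_add_of_le' hM1
  have hM' : M < N := hM
  have hsub : (avg θ p L x I a M k).support ⊆ (x (M + 1) k).support := by
    rw [h.avg_support hθ hp hM' hk]
    intro g hg
    obtain ⟨j, hj, rfl⟩ := Finset.mem_image.1 hg
    exact (h.mem_support_succ hM' hk).2
      ⟨j, hj, h.minOf_mem_support hM'.le (h.one_le_of_mem hM' hk hj)⟩
  have hra : IsRepeatedAverage _ (avg θ p L x I a M k) := h.ra M hM' k hk
  calc minOf (x (M + 1) k).support ≤ minOf (avg θ p L x I a M k).support :=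
        minOf_le (hsub (minOf_mem hra.basic.2.1))
    _ ≤ (avg θ p L x I a M k).support.card :=
        hra.minOf_le_card (Nat.mul_pos (one_le_residue _ _) (hp _ hM1 hM))
    _ ≤ _ := Finset.card_le_card hsub

/-- A set of points of one type whose representatives form an `𝒮_s` set, with `s` less than the
sum of the indices, has small mass. -/
theorem sum_nrm_le (h : Tower θ N V p L x I a) (hθ : RegularSeq θ)
    (hp : ∀ i, 1 ≤ i → i ≤ N → 1 ≤ p i) (hV : ∀ v ∈ V, 1 ≤ v) {M m : ℕ} (hM : M ≤ m) (hm : m ≤ N)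
    (ρ : ℕ → ℕ) {β : ℕ → ℕ} (hβ : ∀ v, IsPoint x v → β v ∈ (x M (lev x M v)).support)
    {j : ℕ} (hj : 1 ≤ j) {s : ℕ} (hs : s < ∑ l ∈ Finset.Ioc M m, ρ l) {G : Finset ℕ}
    (hG : G ∈ Schreier s) :
    ∑ v ∈ (x m j).support,
      (if (∀ l ∈ Finset.Ioc M m, lidx p L x l v = ρ l) ∧ β v ∈ G then nrm θ p L x m j v else 0) ≤
        8 / minOf (x m j).support := by
  induction m, hM using Nat.le_induction generalizing j s G with
  | base => simp at hs
  | succ m hM ih =>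
    have hm' : m < N := hm
    by_cases hex : residue (L (m + 1)) j * p (m + 1) = ρ (m + 1)
    swap
    · rw [Finset.sum_eq_zero]
      · positivity
      · intro v hv
        refine if_neg fun hall => hex ?_
        have := hall.1 (m + 1) (Finset.mem_Ioc.2 (by omega))
        rwa [lidx, h.lev_eq hm hj hv] at this
    have hlevu : ∀ i ∈ I m j, lev x m (minOf (x m i).support) = i := fun i hi =>
      h.lev_eq hm'.le (h.one_le_of_mem hm' hj hi)
        (h.minOf_mem_support hm'.le (h.one_le_of_mem hm' hj hi))
    let φ' : ℕ → Finset ℕ → ℝ := fun i G => ∑ v ∈ (x m i).support,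
      if (∀ l ∈ Finset.Ioc M m, lidx p L x l v = ρ l) ∧ β v ∈ G then nrm θ p L x m i v else 0
    let φ : ℕ → Finset ℕ → ℝ := fun u => φ' (lev x m u)
    have hra : IsRepeatedAverage _ (avg θ p L x I a m j) := h.ra m hm' j hj
    rw [hex] at hra
    have hsupp := h.avg_support hθ hp hm' hj
    have hmem : ∀ u ∈ (avg θ p L x I a m j).support, ∃ i ∈ I m j, 1 ≤ i ∧
        minOf (x m i).support = u ∧ lev x m u = i := by
      intro u hu
      rw [hsupp] at hu
      obtain ⟨i, hi, rfl⟩ := Finset.mem_image.1 hu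
      exact ⟨i, hi, h.one_le_of_mem hm' hj hi, rfl, hlevu i hi⟩
    have hnn : ∀ i, 1 ≤ i → ∀ v, 0 ≤ nrm θ p L x m i v := fun i hi v =>
      h.nrm_nonneg hθ hp hm'.le hi v
    have hmain := hra.average_le (q' := ∑ l ∈ Finset.Ioc M m, ρ l) (φ := φ)
      (fun u hu G => by
        obtain ⟨i, hi, hi1, -, hui⟩ := hmem u hu
        simp only [φ, φ', hui]
        refine Finset.sum_nonneg fun v _ => ?_
        split_ifs
        · exact hnn i hi1 v
        · exact le_rfl)
      (fun u hu G => by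
        obtain ⟨i, hi, hi1, -, hui⟩ := hmem u hu
        simp only [φ, φ', hui]
        rw [← h.sum_nrm hθ hp hm'.le hi1]
        refine Finset.sum_le_sum fun v _ => ?_
        split_ifs
        · exact le_rfl
        · exact hnn i hi1 v)
      (fun u hu n G => by
        obtain ⟨i, hi, hi1, -, hui⟩ := hmem u hu
        simp only [φ, φ', hui]
        rw [Finset.sum_comm]
        refine Finset.sum_le_sum fun v _ => ?_
        have hterm : ∀ d, 0 ≤ if (∀ l ∈ Finset.Ioc M m, lidx p L x l v = ρ l) ∧ β v ∈ G d then
            nrm θ p L x m i v else 0 := by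
          intro d
          split_ifs
          · exact hnn i hi1 v
          · exact le_rfl
        split_ifs with hc
        · obtain ⟨d, -, hd⟩ := Finset.mem_biUnion.1 hc.2
          refine le_trans (le_of_eq ?_)
            (Finset.single_le_sum (fun d _ => hterm d) (Finset.mem_univ d))
          rw [if_pos ⟨hc.1, hd⟩]
        · exact Finset.sum_nonneg fun d _ => hterm d)
      (fun u hu G hne => by
        obtain ⟨i, hi, hi1, hmi, hui⟩ := hmem u hu
        simp only [φ, φ', hui] at hne
        obtain ⟨v, hv, hvne⟩ := Finset.exists_ne_zero_of_sum_ne_zero hne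
        have hc : (∀ l ∈ Finset.Ioc M m, lidx p L x l v = ρ l) ∧ β v ∈ G := by
          by_contra hc
          exact hvne (if_neg hc)
        have hβv : β v ∈ (x m i).support := h.mem_support_of_lev_eq hM hm'.le hi1 hv
          (hβ v (h.isPoint_of_mem hm'.le hi1 hv))
        refine ⟨β v, hc.2, hmi ▸ minOf_le hβv, fun u' hu' huu' => ?_⟩
        obtain ⟨i', hi', hi1', hmi', hui'⟩ := hmem u' hu'
        have hlt : i < i' := by
          by_contra hle
          have h1 := h.lev_mono (h.isPoint_of_mem hm'.le hi1 (h.minOf_mem_support hm'.le hi1))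
            (h.isPoint_of_mem hm'.le hi1' (h.minOf_mem_support hm'.le hi1'))
            (by rw [hmi, hmi']; exact huu'.le) hm'.le
          rw [hmi, hmi', hui, hui'] at h1
          have : i = i' := by omega
          rw [← hmi, ← hmi', this] at huu'
          exact lt_irrefl _ huu'
        exact h.lt m hm'.le i i' hi1 hlt _ hβv _ (hmi' ▸ h.minOf_mem_support hm'.le hi1'))
      -- If the order accumulated below level m is positive, then m > M, so m ≥ 1 and the vectors of
      -- level m have at least min supp points. Their minima therefore double.
      (fun hq' u hu u' hu' huu' => by
        obtain ⟨i, hi, hi1, hmi, hui⟩ := hmem u hu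
        obtain ⟨i', hi', hi1', hmi', hui'⟩ := hmem u' hu'
        have hm1 : 1 ≤ m := by
          by_contra hm0
          have : M = m := by omega
          rw [this] at hq'
          simp at hq'
        have hlt : i < i' := by
          by_contra hle
          have h1 := h.lev_mono (h.isPoint_of_mem hm'.le hi1 (h.minOf_mem_support hm'.le hi1))
            (h.isPoint_of_mem hm'.le hi1' (h.minOf_mem_support hm'.le hi1'))
            (by rw [hmi, hmi']; exact huu'.le) hm'.le
          rw [hmi, hmi', hui, hui'] at h1
          have : i = i' := by omega
          rw [← hmi, ← hmi', this] at huu'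
          exact lt_irrefl _ huu'
        rw [← hmi]
        exact two_mul_minOf_le (h.minOf_le_card_support hθ hp hm1 hm'.le hi1) fun v hv =>
          h.lt m hm'.le i i' hi1 hlt v hv u' (hmi' ▸ h.minOf_mem_support hm'.le hi1'))
      (fun u hu t ht G hG => by
        obtain ⟨i, hi, hi1, hmi, hui⟩ := hmem u hu
        simp only [φ, hui]
        rw [← hmi]
        exact ih hm'.le hi1 ht hG)
      (s := s) (by rw [Finset.sum_Ioc_succ_top hM] at hs; omega) hG
    have hsub : minOf (x (m + 1) j).support ≤ minOf (avg θ p L x I a m j).support := by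
      obtain ⟨i, hi, hi1, hmi, -⟩ := hmem _ (minOf_mem hra.basic.2.1)
      rw [← hmi]
      exact minOf_le ((h.mem_support_succ hm' hj).2 ⟨i, hi, h.minOf_mem_support hm'.le hi1⟩)
    have hpos : 0 < minOf (x (m + 1) j).support := hj.trans (h.le_minOf hV hm hj)
    refine le_trans (le_trans (le_of_eq ?_) hmain) ?_
    · rw [h.sum_avg hθ hp hm' hj, h.sum_support_succ hm' hj]
      refine Finset.sum_congr rfl fun i hi => ?_
      simp only [φ, φ', hlevu i hi]
      rw [Finset.mul_sum]
      refine Finset.sum_congr rfl fun v hv => ?_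
      rw [h.nrm_succ hm' hj hi hv, mul_ite, mul_zero]
      refine if_congr (and_congr_left fun _ => ⟨fun hall l hl => hall l ?_,
        fun hall l hl => ?_⟩) rfl rfl
      · rw [Finset.mem_Ioc] at hl ⊢; omega
      · rcases eq_or_ne l (m + 1) with rfl | hne
        · rw [lidx, h.lev_eq hm hj ((h.mem_support_succ hm' hj).2 ⟨i, hi, hv⟩), hex]
        · refine hall l ?_
          rw [Finset.mem_Ioc] at hl ⊢; omega
    · gcongr

end Tower

theorem card_le_two {s : Finset ℕ}
    (h : ∀ a ∈ s, ∀ b ∈ s, ∀ c ∈ s, a < b → b < c → False) : s.card ≤ 2 := by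
  by_contra hc
  have h3 : 2 < s.card := by omega
  let e := s.orderEmbOfFin rfl
  exact h _ (s.orderEmbOfFin_mem rfl ⟨0, by omega⟩) _ (s.orderEmbOfFin_mem rfl ⟨1, by omega⟩) _
    (s.orderEmbOfFin_mem rfl ⟨2, by omega⟩) (e.strictMono (by simp)) (e.strictMono (by simp))

namespace Tower

variable {θ : ℕ → ℝ} {N : ℕ} {V : Set ℕ} {p L : ℕ → ℕ} {x : ℕ → ℕ → (ℕ →₀ ℝ)}
  {I : ℕ → ℕ → Finset ℕ} {a : ℕ → ℕ → ℝ}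

theorem lidx_le (hL : ∀ i, 1 ≤ i → i ≤ N → 2 ≤ L i) {l : ℕ} (hl : 1 ≤ l) (hlN : l ≤ N) (v : ℕ) :
    lidx p L x l v ≤ L l * p l :=
  Nat.mul_le_mul_right _ (residue_le (by have := hL l hl hlN; omega))

theorem prod_theta_le (hθ : RegularSeq θ) (hp : ∀ i, 1 ≤ i → i ≤ N → 1 ≤ p i)
    (hL : ∀ i, 1 ≤ i → i ≤ N → 2 ≤ L i) {M : ℕ} (hM : M ≤ N) (v : ℕ) :
    ∏ l ∈ Finset.Icc 1 M, θ (L l * p l) ≤ ∏ l ∈ Finset.Icc 1 M, θ (lidx p L x l v) := by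
  refine Finset.prod_le_prod (fun l hl => ?_) fun l hl => ?_
  all_goals
    rw [Finset.mem_Icc] at hl
    have h1 := hL l hl.1 (hl.2.trans hM)
    have h2 := hp l hl.1 (hl.2.trans hM)
  · exact (hθ.pos _ (Nat.mul_pos (by omega) h2)).le
  · exact hθ.antitone _ _ (lidx_pos hp hl.1 (hl.2.trans hM) v)
      (lidx_le hL hl.1 (hl.2.trans hM) v)

theorem prod_theta_pos (hθ : RegularSeq θ) (hp : ∀ i, 1 ≤ i → i ≤ N → 1 ≤ p i)
    (hL : ∀ i, 1 ≤ i → i ≤ N → 2 ≤ L i) {M : ℕ} (hM : M ≤ N) :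
    0 < ∏ l ∈ Finset.Icc 1 M, θ (L l * p l) := by
  refine Finset.prod_pos fun l hl => ?_
  rw [Finset.mem_Icc] at hl
  have h1 := hL l hl.1 (hl.2.trans hM)
  have h2 := hp l hl.1 (hl.2.trans hM)
  exact hθ.pos _ (Nat.mul_pos (by omega) h2)

theorem apply_le_nrm (h : Tower θ N V p L x I a) (hθ : RegularSeq θ)
    (hp : ∀ i, 1 ≤ i → i ≤ N → 1 ≤ p i) (hL : ∀ i, 1 ≤ i → i ≤ N → 2 ≤ L i) {k : ℕ} (hk : 1 ≤ k)
    (v : ℕ) : x N k v ≤ (∏ l ∈ Finset.Icc 1 N, θ (L l * p l))⁻¹ * nrm θ p L x N k v := by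
  rw [← div_eq_inv_mul, le_div_iff₀ (prod_theta_pos hθ hp hL le_rfl)]
  exact mul_le_mul_of_nonneg_left (prod_theta_le hθ hp hL le_rfl v) (h.nonneg N le_rfl k hk v)

/-! ### Stopping depths -/

/-- The number of vectors of level `M` that are met by `D`. -/
noncomputable def meets (x : ℕ → ℕ → (ℕ →₀ ℝ)) (M : ℕ) (D : Finset ℕ) : ℕ :=
  (D.image (lev x M)).card

/-- The depth of the first node above `v` that meets at most `L_1 ⋯ L_M` vectors of level `M`. -/
noncomputable def stopDepth (L : ℕ → ℕ) (x : ℕ → ℕ → (ℕ →₀ ℝ)) (T : NTree) (M v : ℕ) : ℕ :=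
  sInf {d | meets x M (T.cell d v) ≤ ∏ l ∈ Finset.Icc 1 M, L l}

theorem one_le_prod_L (hL : ∀ i, 1 ≤ i → i ≤ N → 2 ≤ L i) {M : ℕ} (hM : M ≤ N) :
    1 ≤ ∏ l ∈ Finset.Icc 1 M, L l :=
  Finset.one_le_prod' fun l hl => by
    rw [Finset.mem_Icc] at hl
    have := hL l hl.1 (hl.2.trans hM)
    omega

theorem height_mem_stopDepth (hL : ∀ i, 1 ≤ i → i ≤ N → 2 ≤ L i) {T : NTree} (hT : T.Valid) {v : ℕ}
    (hv : v ∈ T.supp) {M : ℕ} (hM : M ≤ N) :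
    T.height v ∈ {d | meets x M (T.cell d v) ≤ ∏ l ∈ Finset.Icc 1 M, L l} := by
  rw [Set.mem_ofPred_eq, T.cell_height hT hv, meets]
  simpa using one_le_prod_L hL hM

theorem stopDepth_le_height (hL : ∀ i, 1 ≤ i → i ≤ N → 2 ≤ L i) {T : NTree} (hT : T.Valid) {v : ℕ}
    (hv : v ∈ T.supp) {M : ℕ} (hM : M ≤ N) : stopDepth L x T M v ≤ T.height v :=
  Nat.sInf_le (height_mem_stopDepth hL hT hv hM)

theorem meets_stopDepth (hL : ∀ i, 1 ≤ i → i ≤ N → 2 ≤ L i) {T : NTree} (hT : T.Valid) {v : ℕ}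
    (hv : v ∈ T.supp) {M : ℕ} (hM : M ≤ N) :
    meets x M (T.cell (stopDepth L x T M v) v) ≤ ∏ l ∈ Finset.Icc 1 M, L l :=
  Nat.sInf_mem ⟨_, height_mem_stopDepth (x := x) hL hT hv hM⟩

theorem lt_meets {T : NTree} {M v d : ℕ} (hd : d < stopDepth L x T M v) :
    ∏ l ∈ Finset.Icc 1 M, L l < meets x M (T.cell d v) :=
  not_le.1 fun hle => Nat.notMem_of_lt_sInf hd hle

/-- The stopping rule looks only at the nodes of the branch, and two points of the stopping node
share all nodes down to it. -/
theorem stopDepth_congr (hL : ∀ i, 1 ≤ i → i ≤ N → 2 ≤ L i) {T : NTree} (hT : T.Valid) {v w : ℕ}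
    (hv : v ∈ T.supp) {M : ℕ} (hM : M ≤ N) (hw : w ∈ T.cell (stopDepth L x T M v) v) :
    stopDepth L x T M w = stopDepth L x T M v := by
  have hcell : ∀ d ≤ stopDepth L x T M v, T.cell d w = T.cell d v := fun d hd =>
    (T.cell_eq hT hv (T.cell_antitone hT hv hd hw)).1
  refine le_antisymm (Nat.sInf_le ?_) ?_
  · rw [Set.mem_ofPred_eq, hcell _ le_rfl]
    exact meets_stopDepth hL hT hv hM
  · by_contra hlt
    rw [not_le] at hlt
    have h1 := lt_meets hlt
    rw [← hcell _ hlt.le] at h1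
    exact absurd (meets_stopDepth (x := x) hL hT (T.cell_subset hT hv _ hw) hM) (not_le.2 h1)

theorem meets_succ_le (h : Tower θ N V p L x I a) {M : ℕ} (hM : M < N) {D : Finset ℕ}
    (hD : ∀ v ∈ D, IsPoint x v) : meets x (M + 1) D ≤ meets x M D := by
  have hsub : D.image (lev x (M + 1)) ⊆
      (D.image (lev x M)).image fun j => lev x (M + 1) (minOf (x M j).support) := by
    intro j hj
    obtain ⟨v, hv, rfl⟩ := Finset.mem_image.1 hj
    refine Finset.mem_image.2 ⟨_, Finset.mem_image_of_mem _ hv, ?_⟩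
    have h1 := h.one_le_lev (hD v hv) hM.le
    have h2 := h.minOf_mem_support hM.le h1
    exact h.lev_succ_congr (h.isPoint_of_mem hM.le h1 h2) (hD v hv) hM (h.lev_eq hM.le h1 h2)
  exact (Finset.card_le_card hsub).trans Finset.card_image_le

/-- A node meets no more vectors of a coarser level, and the allowed number grows with the level, so
the coarser level stops no later. -/
theorem stopDepth_succ_le (h : Tower θ N V p L x I a) (hL : ∀ i, 1 ≤ i → i ≤ N → 2 ≤ L i)
    {T : NTree} (hT : T.Valid) (hpt : ∀ v ∈ T.supp, IsPoint x v) {v : ℕ} (hv : v ∈ T.supp) {M : ℕ}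
    (hM : M < N) : stopDepth L x T (M + 1) v ≤ stopDepth L x T M v := by
  refine Nat.sInf_le ?_
  rw [Set.mem_ofPred_eq]
  refine (h.meets_succ_le hM fun w hw => hpt w (T.cell_subset hT hv _ hw)).trans
    ((meets_stopDepth hL hT hv hM.le).trans ?_)
  rw [Finset.prod_Icc_succ_top (by omega)]
  have := hL (M + 1) (by omega) hM
  exact Nat.le_mul_of_pos_right _ (by omega)

/-! ### Points stopped at nodes of small order -/

/-- The number of vectors of level `M` met by the stopping node before the one containing `v`. -/
noncomputable def pos (L : ℕ → ℕ) (x : ℕ → ℕ → (ℕ →₀ ℝ)) (T : NTree) (M v : ℕ) : ℕ :=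
  (((T.cell (stopDepth L x T M v) v).image (lev x M)).filter fun j => j < lev x M v).card

theorem pos_lt (hL : ∀ i, 1 ≤ i → i ≤ N → 2 ≤ L i) {T : NTree} (hT : T.Valid) {v : ℕ}
    (hv : v ∈ T.supp) {M : ℕ} (hM : M ≤ N) : pos L x T M v < ∏ l ∈ Finset.Icc 1 M, L l := by
  refine lt_of_lt_of_le (Finset.card_lt_card ?_) (meets_stopDepth (x := x) hL hT hv hM)
  refine (Finset.filter_ssubset).2 ⟨lev x M v, ?_, lt_irrefl _⟩
  exact Finset.mem_image_of_mem _ (T.mem_cell hT hv _)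

/-- Inside a stopping node the position labels the vectors of level M injectively. Fixing it leaves
at most one vector for each stopping node. -/
theorem lev_eq_of_pos_eq (hL : ∀ i, 1 ≤ i → i ≤ N → 2 ≤ L i) {T : NTree} (hT : T.Valid)
    {v w : ℕ} (hv : v ∈ T.supp) {M : ℕ} (hM : M ≤ N) (hw : w ∈ T.cell (stopDepth L x T M v) v)
    (hpos : pos L x T M w = pos L x T M v) : lev x M w = lev x M v := by
  have hcell : T.cell (stopDepth L x T M w) w = T.cell (stopDepth L x T M v) v := by
    rw [stopDepth_congr hL hT hv hM hw]
    exact (T.cell_eq hT hv hw).1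
  have key : ∀ D : Finset ℕ, ∀ i ∈ D, ∀ j, i < j →
      (D.filter fun t => t < i).card < (D.filter fun t => t < j).card := by
    intro D i hi j hij
    refine Finset.card_lt_card (Finset.ssubset_iff_of_subset ?_ |>.2 ⟨i, ?_, ?_⟩)
    · intro t ht
      rw [Finset.mem_filter] at ht ⊢
      exact ⟨ht.1, ht.2.trans hij⟩
    · exact Finset.mem_filter.2 ⟨hi, hij⟩
    · simp
  simp only [pos, hcell] at hpos
  rcases lt_trichotomy (lev x M w) (lev x M v) with hlt | heq | hlt
  · exact absurd hpos (key _ _ (Finset.mem_image_of_mem _ hw) _ hlt).ne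
  · exact heq
  · exact absurd hpos
      (key _ _ (Finset.mem_image_of_mem _ (T.mem_cell hT hv _)) _ hlt).ne'

open scoped Classical in
-- With type and position fixed, each stopping node contributes a single vector of level M. One
-- representative from each of them gives a Schreier set of order below t_M, on which the normalised
-- vector is small by `sum_nrm_le`.
theorem sum_nrm_typ_pos_le (h : Tower θ N V p L x I a) (hθ : RegularSeq θ)
    (hp : ∀ i, 1 ≤ i → i ≤ N → 1 ≤ p i) (hL : ∀ i, 1 ≤ i → i ≤ N → 2 ≤ L i)
    (hV : ∀ v ∈ V, 1 ≤ v) {k : ℕ} (hk : 1 ≤ k) {T : NTree} (hT : T.Valid)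
    (hTS : T.supp ⊆ (x N k).support) {M : ℕ} (hM : M < N) (t : ℕ → ℕ) (n : ℕ) :
    ∑ v ∈ T.supp.filter (fun v => T.ord (stopDepth L x T M v) v < tail N p L x M v ∧
      typ N p L x M v = t ∧ pos L x T M v = n), nrm θ p L x N k v ≤ 8 / k := by
  set Z := T.supp.filter (fun v => T.ord (stopDepth L x T M v) v < tail N p L x M v ∧
      typ N p L x M v = t ∧ pos L x T M v = n) with hZ
  have hk0 : (0 : ℝ) < k := by exact_mod_cast hk
  rcases Z.eq_empty_or_nonempty with he | ⟨v₀, hv₀⟩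
  · rw [he, Finset.sum_empty]
    positivity
  have hZT : ∀ v ∈ Z, v ∈ T.supp := fun v hv => (Finset.mem_filter.1 hv).1
  have hZo : ∀ v ∈ Z, T.ord (stopDepth L x T M v) v < tail N p L x M v :=
    fun v hv => (Finset.mem_filter.1 hv).2.1
  have hZt : ∀ v ∈ Z, typ N p L x M v = t := fun v hv => (Finset.mem_filter.1 hv).2.2.1
  have hZn : ∀ v ∈ Z, pos L x T M v = n := fun v hv => (Finset.mem_filter.1 hv).2.2.2
  have hpt : ∀ v ∈ T.supp, IsPoint x v := fun v hv => h.isPoint_of_mem le_rfl hk (hTS hv)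
  let C : ℕ → Finset ℕ := fun v =>
    (T.cell (stopDepth L x T M v) v).filter fun w => lev x M w = lev x M v
  have hC : ∀ v ∈ T.supp, minOf (C v) ∈ C v := fun v hv =>
    minOf_mem ⟨v, Finset.mem_filter.2 ⟨T.mem_cell hT hv _, rfl⟩⟩
  -- The representative must lie both in the stopping node and in the level-M vector of v, so it is
  -- the minimum of their intersection. Outside Z the value v merely keeps β inside the vector.
  let β : ℕ → ℕ := fun v => if v ∈ Z then minOf (C v) else v
  have hβZ : ∀ v ∈ Z, β v = minOf (C v) := fun v hv => if_pos hv
  have hβ : ∀ v, IsPoint x v → β v ∈ (x M (lev x M v)).support := by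
    intro v hv
    by_cases hvZ : v ∈ Z
    · rw [hβZ v hvZ]
      have h1 := Finset.mem_filter.1 (hC v (hZT v hvZ))
      rw [← h1.2]
      exact h.mem_lev (hpt _ (T.cell_subset hT (hZT v hvZ) _ h1.1)) hM.le
    · simp only [β, if_neg hvZ]
      exact h.mem_lev hv hM.le
  have htail : ∀ v ∈ Z, tail N p L x M v = ∑ l ∈ Finset.Ioc M N, t l := fun v hv => by
    rw [tail_eq_sum_typ, hZt v hv]
  have hG : Z.image β ∈ Schreier (tail N p L x M v₀ - 1) := by
    refine T.image_mem_schreier hT hZT (σ := stopDepth L x T M) (fun v hv => ?_) (fun v hv => ?_)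
      fun v hv w hw hwv => ?_
    · rw [hβZ v hv]
      exact (Finset.mem_filter.1 (hC v (hZT v hv))).1
    · have h1 := hZo v hv
      rw [htail v hv] at h1
      rw [htail v₀ hv₀]
      omega
    · have h1 := stopDepth_congr hL hT (hZT v hv) hM.le hwv
      have h2 := lev_eq_of_pos_eq hL hT (hZT v hv) hM.le hwv (by rw [hZn v hv, hZn w hw])
      have h3 := (T.cell_eq hT (hZT v hv) hwv).1
      refine ⟨h1, ?_⟩
      rw [hβZ v hv, hβZ w hw]
      simp only [C, h1, h2, h3]
  have hmain := h.sum_nrm_le hθ hp hV hM.le le_rfl t hβ hk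
    (s := tail N p L x M v₀ - 1) (by
      have := one_le_tail (L := L) (x := x) hp hM v₀
      rw [← htail v₀ hv₀]; omega) hG
  refine le_trans ?_ (hmain.trans ?_)
  · rw [← Finset.sum_filter]
    refine Finset.sum_le_sum_of_subset_of_nonneg (fun v hv => ?_) fun v _ _ =>
      h.nrm_nonneg hθ hp le_rfl hk v
    refine Finset.mem_filter.2 ⟨hTS (hZT v hv), fun l hl => ?_, Finset.mem_image_of_mem _ hv⟩
    rw [← hZt v hv, typ_of_mem hl]
  · have := h.le_minOf hV le_rfl hk
    gcongr

/-- Each pair of a type and a position costs 8 / k. Passing from normalised to true coefficients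
costs at most P⁻¹, and the lower bound for k absorbs this together with the number of pairs. -/
theorem sum_apply_small_order_le (h : Tower θ N V p L x I a) (hθ : RegularSeq θ)
    (hp : ∀ i, 1 ≤ i → i ≤ N → 1 ≤ p i) (hL : ∀ i, 1 ≤ i → i ≤ N → 2 ≤ L i)
    (hV : ∀ v ∈ V, 1 ≤ v) {k : ℕ} (hk : 1 ≤ k)
    (hkN : 42 * (N : ℝ) ^ 2 * ∏ i ∈ Finset.Icc 1 N, (L i : ℝ) * (θ (L i * p i))⁻¹ ≤ k)
    {T : NTree} (hT : T.Valid)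
    (hTS : T.supp ⊆ (x N k).support) {M : ℕ} (hM : M < N) :
    ∑ v ∈ T.supp.filter (fun v => T.ord (stopDepth L x T M v) v < tail N p L x M v), x N k v ≤
      1 / (2 * (N : ℝ) ^ 2) := by
  classical
  set Z := T.supp.filter (fun v => T.ord (stopDepth L x T M v) v < tail N p L x M v) with hZ
  have hk0 : (0 : ℝ) < k := by exact_mod_cast hk
  have hN0 : (0 : ℝ) < N := by exact_mod_cast (by omega : 0 < N)
  set P := ∏ l ∈ Finset.Icc 1 N, θ (L l * p l) with hP
  have hP0 : 0 < P := prod_theta_pos hθ hp hL le_rfl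
  let Q := ((x N k).support.image (typ N p L x M)) ×ˢ
    Finset.range (∏ l ∈ Finset.Icc 1 M, L l)
  have hmaps : ∀ v ∈ Z, (typ N p L x M v, pos L x T M v) ∈ Q := by
    intro v hv
    have hvT := (Finset.mem_filter.1 hv).1
    exact Finset.mem_product.2 ⟨Finset.mem_image_of_mem _ (hTS hvT),
      Finset.mem_range.2 (pos_lt hL hT hvT hM.le)⟩
  have h1 : ∑ v ∈ Z, nrm θ p L x N k v ≤ (Q.card : ℝ) * (8 / k) := by
    rw [← Finset.sum_fiberwise_of_maps_to hmaps, ← nsmul_eq_mul]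
    refine Finset.sum_le_card_nsmul _ _ _ fun q _ => ?_
    refine le_trans (le_of_eq ?_) (h.sum_nrm_typ_pos_le hθ hp hL hV hk hT hTS hM q.1 q.2)
    refine Finset.sum_congr ?_ fun _ _ => rfl
    ext v
    rw [hZ]
    simp only [Finset.mem_filter, Prod.ext_iff, and_assoc]
  -- Types use the L_l with M < l < N and positions those with l ≤ M; the missing factor L_N ≥ 2
  -- gains a factor two.
  have hQ : 2 * Q.card ≤ ∏ l ∈ Finset.Icc 1 N, L l := by
    have h2 : Q.card ≤ (∏ l ∈ Finset.Ioo M N, L l) * ∏ l ∈ Finset.Icc 1 M, L l := by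
      rw [Finset.card_product, Finset.card_range]
      exact Nat.mul_le_mul_right _ (h.card_image_typ_le hL hk)
    have h3 : ∏ l ∈ Finset.Icc 1 N, L l =
        (∏ l ∈ Finset.Icc 1 M, L l) * ((∏ l ∈ Finset.Ioo M N, L l) * L N) := by
      have hd : Finset.Icc 1 N = Finset.Icc 1 M ∪ (Finset.Ioo M N ∪ {N}) := by
        ext l; simp only [Finset.mem_union, Finset.mem_Icc, Finset.mem_Ioo, Finset.mem_singleton]
        omega
      rw [hd, Finset.prod_union, Finset.prod_union, Finset.prod_singleton]
      · simp
      · refine Finset.disjoint_left.2 fun l hl hl' => ?_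
        simp only [Finset.mem_union, Finset.mem_Icc, Finset.mem_Ioo, Finset.mem_singleton] at hl hl'
        omega
    rw [h3]
    have h4 := hL N (by omega) le_rfl
    calc 2 * Q.card ≤ L N * ((∏ l ∈ Finset.Ioo M N, L l) * ∏ l ∈ Finset.Icc 1 M, L l) :=
          Nat.mul_le_mul h4 h2
      _ = _ := by ring
  have hQ' : 2 * (Q.card : ℝ) ≤ ∏ l ∈ Finset.Icc 1 N, (L l : ℝ) := by exact_mod_cast hQ
  rw [Finset.prod_mul_distrib, Finset.prod_inv_distrib, ← hP] at hkN
  calc ∑ v ∈ Z, x N k v ≤ ∑ v ∈ Z, P⁻¹ * nrm θ p L x N k v :=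
        Finset.sum_le_sum fun v _ => h.apply_le_nrm hθ hp hL hk v
    _ = P⁻¹ * ∑ v ∈ Z, nrm θ p L x N k v := by rw [Finset.mul_sum]
    _ ≤ P⁻¹ * ((Q.card : ℝ) * (8 / k)) := mul_le_mul_of_nonneg_left h1 (inv_nonneg.2 hP0.le)
    _ = (4 * (2 * Q.card) * P⁻¹) / k := by ring
    _ ≤ 1 / (2 * (N : ℝ) ^ 2) := by
      rw [div_le_div_iff₀ hk0 (by positivity)]
      have h5 : 2 * (Q.card : ℝ) * P⁻¹ ≤ (∏ l ∈ Finset.Icc 1 N, (L l : ℝ)) * P⁻¹ :=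
        mul_le_mul_of_nonneg_right hQ' (inv_nonneg.2 hP0.le)
      have h6 : 0 ≤ (Q.card : ℝ) * P⁻¹ := by positivity
      have h7 : (2 * (Q.card : ℝ) * P⁻¹) * (N : ℝ) ^ 2 ≤
        ((∏ l ∈ Finset.Icc 1 N, (L l : ℝ)) * P⁻¹) * (N : ℝ) ^ 2 :=
        mul_le_mul_of_nonneg_right h5 (by positivity)
      have h8 : 0 ≤ (Q.card : ℝ) * P⁻¹ * (N : ℝ) ^ 2 := by positivity
      nlinarith

/-! ### Masses of the vectors of one level -/

/-- A layer multiplies a whole child vector by one scalar. Collecting these scalars from level N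
down shows that inside each vector of level m the normalised mass is distributed as in that vector
alone. -/
theorem exists_weight (h : Tower θ N V p L x I a) (hθ : RegularSeq θ)
    (hp : ∀ i, 1 ≤ i → i ≤ N → 1 ≤ p i) {k : ℕ} (hk : 1 ≤ k) {m : ℕ} (hm : m ≤ N) :
    ∃ w : ℕ → ℝ, (∀ j, 1 ≤ j → 0 ≤ w j) ∧ ∀ v ∈ (x N k).support,
      nrm θ p L x N k v = w (lev x m v) * nrm θ p L x m (lev x m v) v := by
  induction hm using Nat.decreasingInduction with
  | self =>
    exact ⟨fun _ => 1, fun _ _ => zero_le_one, fun v hv => by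
      rw [one_mul, h.lev_eq le_rfl hk hv]⟩
  | of_succ m hm ih =>
    obtain ⟨w, hw0, hw⟩ := ih
    refine ⟨fun j => w (lev x (m + 1) (minOf (x m j).support)) *
      cof θ p L a m (lev x (m + 1) (minOf (x m j).support)) j, fun j hj => ?_, fun v hv => ?_⟩
    · have h2 := h.isPoint_of_mem hm.le hj (h.minOf_mem_support hm.le hj)
      exact mul_nonneg (hw0 _ (h.one_le_lev h2 hm)) (h.cof_pos hθ hp hm _ hj).le
    · have hvp := h.isPoint_of_mem le_rfl hk hv
      have h1 := h.one_le_lev hvp hm.le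
      have h2 := h.minOf_mem_support hm.le h1
      have h3 := h.lev_succ_congr (h.isPoint_of_mem hm.le h1 h2) hvp hm (h.lev_eq hm.le h1 h2)
      dsimp only
      rw [h3, hw v hv, h.nrm_succ hm (h.one_le_lev hvp hm) (h.lev_mem_I hvp hm)
        (h.mem_lev hvp hm.le), mul_assoc]

end Tower

/-! ### Residues in windows and the condition (‡) -/

theorem sum_window_residue {l j : ℕ} (hlj : l ≤ j) (g : ℕ → ℝ) :
    ∑ i ∈ Finset.Ico (j - l + 1) (j + 1), g (residue l i) = ∑ s ∈ Finset.range l, g (s + 1) := by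
  have h1 : j - l + l = j := Nat.sub_add_cancel hlj
  calc ∑ i ∈ Finset.Ico (j - l + 1) (j + 1), g (residue l i)
      = ∑ i ∈ Finset.Ico (j - l) j, g (i % l + 1) := by
        rw [← Finset.sum_Ico_add' (fun i => g (residue l i)) (j - l) j 1]
        exact Finset.sum_congr rfl fun i _ => by simp [residue]
    _ = ∑ i ∈ Finset.Ico (j - l) (j - l + l), g (i % l + 1) := by rw [h1]
    _ = _ := by
        rw [← Nat.image_Ico_mod (j - l) l, Finset.sum_image]
        exact Nat.mod_injOn_Ico _ _

theorem residue_ne {l i j : ℕ} (hi : 1 ≤ i) (hij : i < j) (hjl : j < i + l) :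
    residue l i ≠ residue l j := by
  intro he
  have h1 : (i - 1) % l = (j - 1) % l := by simpa [residue] using he
  have h2 := Nat.mod_injOn_Ico (i - 1) l (x₁ := i - 1) (x₂ := j - 1)
    (by simp; omega) (by simp; omega) h1
  omega

/-- The ratios in (‡) are positive on both sides, which forces the factor F R to be positive. -/
theorem DoubleDagger.pos {θ F : ℕ → ℝ} (hθ : RegularSeq θ) (hF : DoubleDagger θ F) {R : ℕ}
    (hR : 1 ≤ R) : 0 < F R := by
  have h1 := hF.2 R 1 1 1 hR le_rfl le_rfl le_rfl 0 hR
  have hpos : ∀ i, 0 < θ (1 + i * 1 + 1) / θ (1 + i * 1) := fun i =>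
    div_pos (hθ.pos _ (by omega)) (hθ.pos _ (by omega))
  have h2 : 0 < ∑ j ∈ Finset.range R, θ (1 + j * 1 + 1) / θ (1 + j * 1) :=
    Finset.sum_pos (fun i _ => hpos i) ⟨0, Finset.mem_range.2 hR⟩
  have h3 := (hpos 0).trans_le h1
  exact (pos_iff_pos_of_mul_pos h3).2 h2

/-- The form of `(‡)` for the multiples of `p`. -/
theorem DoubleDagger.le_sum {θ F : ℕ → ℝ} (hF : DoubleDagger θ F) {l p t j : ℕ}
    (hl : 1 ≤ l) (hp : 1 ≤ p) (ht : 1 ≤ t) (hlj : l ≤ j) :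
    θ (residue l j * p + t) / θ (residue l j * p) ≤
      F l * ∑ i ∈ Finset.Ico (j - l + 1) (j + 1),
        θ (residue l i * p + t) / θ (residue l i * p) := by
  have h1 := hF.2 l t p p hl ht hp hp ((j - 1) % l) (Nat.mod_lt _ hl)
  -- A window of l consecutive indices takes each residue exactly once, so the sum runs over the
  -- progression p, 2p, …, l p.
  rw [sum_window_residue hlj fun r => θ (r * p + t) / θ (r * p)]
  have h2 : ∀ s, p + s * p = (s + 1) * p := fun s => by ring
  simp only [h2] at h1
  exact h1

namespace Tower

variable {θ : ℕ → ℝ} {N : ℕ} {V : Set ℕ} {p L : ℕ → ℕ} {x : ℕ → ℕ → (ℕ →₀ ℝ)}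
  {I : ℕ → ℕ → Finset ℕ} {a : ℕ → ℕ → ℝ}

/-! ### Initial vectors and the window estimate for stuck points -/

theorem support_subset (h : Tower θ N V p L x I a) {k : ℕ} (hk : 1 ≤ k) {m : ℕ} (hm : m ≤ N)
    {v : ℕ} (hv : v ∈ (x N k).support) :
    (x m (lev x m v)).support ⊆ (x N k).support := fun _ hw =>
  h.mem_support_of_lev_eq hm le_rfl hk hv hw

theorem filter_lev_eq (h : Tower θ N V p L x I a) {k : ℕ} (hk : 1 ≤ k) {m : ℕ} (hm : m ≤ N)
    {v : ℕ} (hv : v ∈ (x N k).support) :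
    (x N k).support.filter (fun w => lev x m w = lev x m v) = (x m (lev x m v)).support := by
  have hvp := h.isPoint_of_mem le_rfl hk hv
  ext w
  rw [Finset.mem_filter]
  constructor
  · rintro ⟨hw, he⟩
    exact (h.mem_support_iff hm (h.one_le_lev hvp hm)).2 ⟨h.isPoint_of_mem le_rfl hk hw, he⟩
  · exact fun hw => ⟨h.support_subset hk hm hv hw, h.lev_eq hm (h.one_le_lev hvp hm) hw⟩

theorem child_support_subset (h : Tower θ N V p L x I a) {k : ℕ} (hk : 1 ≤ k) {m : ℕ} (hm : m < N)
    {v j : ℕ} (hv : v ∈ (x N k).support) (hj : j ∈ I m (lev x (m + 1) v)) :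
    (x m j).support ⊆ (x (m + 1) (lev x (m + 1) v)).support := fun _ hw =>
  (h.mem_support_succ hm (h.one_le_lev (h.isPoint_of_mem le_rfl hk hv) hm)).2 ⟨j, hj, hw⟩

theorem class_mass (h : Tower θ N V p L x I a) (hθ : RegularSeq θ)
    (hp : ∀ i, 1 ≤ i → i ≤ N → 1 ≤ p i) {k : ℕ} (hk : 1 ≤ k) {m : ℕ} (hm : m < N) {w : ℕ → ℝ}
    (hw : ∀ v ∈ (x N k).support, nrm θ p L x N k v =
      w (lev x (m + 1) v) * nrm θ p L x (m + 1) (lev x (m + 1) v) v)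
    {v j : ℕ} (hv : v ∈ (x N k).support) (hj : j ∈ I m (lev x (m + 1) v)) :
    ∑ u ∈ (x m j).support, nrm θ p L x N k u =
      w (lev x (m + 1) v) * cof θ p L a m (lev x (m + 1) v) j := by
  have h1 := h.one_le_lev (h.isPoint_of_mem le_rfl hk hv) (M := m + 1) hm
  have h2 : ∀ u ∈ (x m j).support, nrm θ p L x N k u =
      w (lev x (m + 1) v) * cof θ p L a m (lev x (m + 1) v) j * nrm θ p L x m j u := by
    intro u hu
    have h3 := h.child_support_subset hk hm hv hj hu
    rw [hw u (h.support_subset hk hm hv h3), h.lev_eq hm h1 h3, h.nrm_succ hm h1 hj hu, mul_assoc]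
  rw [Finset.sum_congr rfl h2, ← Finset.mul_sum,
    h.sum_nrm hθ hp hm.le (h.one_le_of_mem hm h1 hj), mul_one]

theorem cof_le (h : Tower θ N V p L x I a) (hθ : RegularSeq θ)
    (hp : ∀ i, 1 ≤ i → i ≤ N → 1 ≤ p i) (hV : ∀ v ∈ V, 1 ≤ v) {k : ℕ} (hk : 1 ≤ k) {m : ℕ}
    (hm : m < N) {v j : ℕ} (hv : v ∈ (x N k).support) (hj : j ∈ I m (lev x (m + 1) v)) :
    cof θ p L a m (lev x (m + 1) v) j ≤ (k : ℝ)⁻¹ := by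
  have h1 := h.one_le_lev (h.isPoint_of_mem le_rfl hk hv) (M := m + 1) hm
  have hra : IsRepeatedAverage _ (avg θ p L x I a m (lev x (m + 1) v)) := h.ra m hm _ h1
  rw [← h.avg_apply hm h1 hj]
  refine (hra.apply_le_inv (Nat.mul_pos (one_le_residue _ _) (hp _ (by omega) hm))).trans ?_
  have hmem := minOf_mem hra.basic.2.1
  rw [h.avg_support hθ hp hm h1] at hmem
  obtain ⟨i, hi, hmi⟩ := Finset.mem_image.1 hmem
  have h3 : k ≤ minOf (avg θ p L x I a m (lev x (m + 1) v)).support := by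
    rw [h.avg_support hθ hp hm h1, ← hmi]
    exact (h.le_minOf hV le_rfl hk).trans (minOf_le (h.support_subset hk hm hv
      (h.child_support_subset hk hm hv hi
        (h.minOf_mem_support hm.le (h.one_le_of_mem hm h1 hi)))))
  have hk0 : (0 : ℝ) < k := by exact_mod_cast hk
  gcongr

/-- The points in one of the first vectors of level `m` of their parent. -/
noncomputable def initial (N : ℕ) (L : ℕ → ℕ) (x : ℕ → ℕ → (ℕ →₀ ℝ)) (I : ℕ → ℕ → Finset ℕ)
    (m k : ℕ) : Finset ℕ :=
  (x N k).support.filter fun v => lev x m v + 1 < minOf (I m (lev x (m + 1) v)) + L m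

/-- A parent has at most L_m initial children, and each carries at most the fraction 1/k of its
mass, because repeated averages of positive order supported beyond k have coefficients at most 1/k.
-/
theorem sum_initial_le (h : Tower θ N V p L x I a) (hθ : RegularSeq θ)
    (hp : ∀ i, 1 ≤ i → i ≤ N → 1 ≤ p i) (hV : ∀ v ∈ V, 1 ≤ v) {k : ℕ} (hk : 1 ≤ k) {m : ℕ}
    (hm : m < N) : ∑ v ∈ initial N L x I m k, nrm θ p L x N k v ≤ L m / k := by
  have hk0 : (0 : ℝ) < k := by exact_mod_cast hk
  obtain ⟨w, hw0, hw⟩ := h.exists_weight hθ hp hk (m := m + 1) hm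
  set S := (x N k).support with hS
  have hmaps : ∀ v ∈ S, lev x (m + 1) v ∈ S.image (lev x (m + 1)) := fun v hv =>
    Finset.mem_image_of_mem _ hv
  have hpar : ∀ v ∈ S, 1 ≤ lev x (m + 1) v := fun v hv =>
    h.one_le_lev (h.isPoint_of_mem le_rfl hk hv) hm
  have hone : ∑ j ∈ S.image (lev x (m + 1)), w j = 1 := by
    rw [← h.sum_nrm hθ hp le_rfl hk, ← hS, ← Finset.sum_fiberwise_of_maps_to hmaps]
    refine Finset.sum_congr rfl fun j hj => ?_
    obtain ⟨v, hv, rfl⟩ := Finset.mem_image.1 hj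
    rw [h.filter_lev_eq hk hm hv, ← mul_one (w _), ← h.sum_nrm hθ hp hm (hpar v hv),
      Finset.mul_sum]
    refine Finset.sum_congr rfl fun u hu => ?_
    rw [hw u (h.support_subset hk hm hv hu), h.lev_eq hm (hpar v hv) hu]
  rw [initial, Finset.sum_filter, ← hS, ← Finset.sum_fiberwise_of_maps_to hmaps]
  calc _ ≤ ∑ j ∈ S.image (lev x (m + 1)), w j * (L m / k) := ?_
    _ = L m / k := by rw [← Finset.sum_mul, hone, one_mul]
  refine Finset.sum_le_sum fun j hj => ?_
  obtain ⟨v, hv, rfl⟩ := Finset.mem_image.1 hj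
  set j' := lev x (m + 1) v with hj'
  rw [h.filter_lev_eq hk hm hv, h.sum_support_succ hm (hpar v hv)]
  have hterm : ∀ i ∈ I m j', ∑ u ∈ (x m i).support,
      (if lev x m u + 1 < minOf (I m (lev x (m + 1) u)) + L m then nrm θ p L x N k u else 0) ≤
      if i + 1 < minOf (I m j') + L m then w j' * (k : ℝ)⁻¹ else 0 := by
    intro i hi
    have hi1 := h.one_le_of_mem hm (hpar v hv) hi
    have hc : ∀ u ∈ (x m i).support,
        (if lev x m u + 1 < minOf (I m (lev x (m + 1) u)) + L m then nrm θ p L x N k u else 0) =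
        if i + 1 < minOf (I m j') + L m then nrm θ p L x N k u else 0 := by
      intro u hu
      rw [h.lev_eq hm.le hi1 hu, h.lev_eq hm (hpar v hv) (h.child_support_subset hk hm hv hi hu)]
    rw [Finset.sum_congr rfl hc]
    split_ifs
    · rw [h.class_mass hθ hp hk hm hw hv hi]
      exact mul_le_mul_of_nonneg_left (h.cof_le hθ hp hV hk hm hv hi) (hw0 _ (hpar v hv))
    · simp
  refine (Finset.sum_le_sum hterm).trans ?_
  rw [← Finset.sum_filter, Finset.sum_const, nsmul_eq_mul]
  have hcard : ((I m j').filter fun i => i + 1 < minOf (I m j') + L m).card ≤ L m := by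
    have : (I m j').filter (fun i => i + 1 < minOf (I m j') + L m) ⊆
        Finset.Ico (minOf (I m j')) (minOf (I m j') + L m) := by
      intro i hi
      rw [Finset.mem_filter] at hi
      have := minOf_le hi.1
      exact Finset.mem_Ico.2 (by omega)
    simpa using Finset.card_le_card this
  have hcard' : (((I m j').filter fun i => i + 1 < minOf (I m j') + L m).card : ℝ) ≤ L m := by
    exact_mod_cast hcard
  calc _ ≤ (L m : ℝ) * (w j' * (k : ℝ)⁻¹) := mul_le_mul_of_nonneg_right hcard'
        (mul_nonneg (hw0 _ (hpar v hv)) (by positivity))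
    _ = _ := by ring

/-- The density of the norming functional of `X_M` for the level `M`. -/
noncomputable def dens (θ : ℕ → ℝ) (N : ℕ) (p L : ℕ → ℕ) (x : ℕ → ℕ → (ℕ →₀ ℝ)) (M v : ℕ) : ℝ :=
  θ (tail N p L x M v) * ∏ l ∈ Finset.Icc 1 M, θ (lidx p L x l v)

theorem tail_eq_add {M : ℕ} (hM : M < N) (v : ℕ) :
    tail N p L x M v = lidx p L x (M + 1) v + tail N p L x (M + 1) v := by
  have h1 : Finset.Ioc M N = insert (M + 1) (Finset.Ioc (M + 1) N) := by
    ext l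
    simp only [Finset.mem_insert, Finset.mem_Ioc]
    omega
  rw [tail, h1, Finset.sum_insert (by simp)]
  rfl

/-- The mass of the functional `dens` on one vector of level `M + 1`. -/
theorem sum_dens_class (h : Tower θ N V p L x I a) (hθ : RegularSeq θ)
    (hp : ∀ i, 1 ≤ i → i ≤ N → 1 ≤ p i) {k : ℕ} (hk : 1 ≤ k) {M : ℕ} (hM : M + 1 < N) {w : ℕ → ℝ}
    (hw : ∀ v ∈ (x N k).support, nrm θ p L x N k v =
      w (lev x (M + 2) v) * nrm θ p L x (M + 2) (lev x (M + 2) v) v)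
    {v j : ℕ} (hv : v ∈ (x N k).support) (hj : j ∈ I (M + 1) (lev x (M + 2) v)) :
    ∑ u ∈ (x (M + 1) j).support, x N k u * dens θ N p L x M u =
      w (lev x (M + 2) v) * cof θ p L a (M + 1) (lev x (M + 2) v) j *
        (∏ l ∈ Finset.Ioc (M + 1) N, θ (lidx p L x l v))⁻¹ *
        (θ (residue (L (M + 1)) j * p (M + 1) + tail N p L x (M + 1) v) /
          θ (residue (L (M + 1)) j * p (M + 1))) := by
  have h1 := h.one_le_lev (h.isPoint_of_mem le_rfl hk hv) (M := M + 2) hM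
  have hj1 := h.one_le_of_mem hM h1 hj
  rw [← h.class_mass hθ hp hk hM hw hv hj, mul_assoc, Finset.sum_mul]
  refine Finset.sum_congr rfl fun u hu => ?_
  have hu2 := h.child_support_subset hk hM hv hj hu
  have huS := h.support_subset hk hM hv hu2
  have hup := h.isPoint_of_mem le_rfl hk huS
  have hvp := h.isPoint_of_mem le_rfl hk hv
  have hl : ∀ l ∈ Finset.Ioc (M + 1) N, lidx p L x l u = lidx p L x l v := by
    intro l hl
    rw [Finset.mem_Ioc] at hl
    exact h.lidx_congr hup hvp (M := M + 2) (by omega) hl.2 (h.lev_eq hM h1 hu2)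
  have ht : tail N p L x (M + 1) u = tail N p L x (M + 1) v := Finset.sum_congr rfl hl
  have hlM : lidx p L x (M + 1) u = residue (L (M + 1)) j * p (M + 1) := by
    rw [lidx, h.lev_eq hM.le hj1 hu]
  have hsplit : ∏ l ∈ Finset.Icc 1 N, θ (lidx p L x l u) =
      (∏ l ∈ Finset.Icc 1 M, θ (lidx p L x l u)) * θ (residue (L (M + 1)) j * p (M + 1)) *
        ∏ l ∈ Finset.Ioc (M + 1) N, θ (lidx p L x l v) := by
    have hd : Finset.Icc 1 N = Finset.Icc 1 (M + 1) ∪ Finset.Ioc (M + 1) N := by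
      ext l; simp only [Finset.mem_union, Finset.mem_Icc, Finset.mem_Ioc]; omega
    have hc : ∏ l ∈ Finset.Ioc (M + 1) N, θ (lidx p L x l u) =
        ∏ l ∈ Finset.Ioc (M + 1) N, θ (lidx p L x l v) :=
      Finset.prod_congr rfl fun l hl' => by rw [hl l hl']
    rw [hd, Finset.prod_union, Finset.prod_Icc_succ_top (by omega), hlM, hc]
    refine Finset.disjoint_left.2 fun l hl hl' => ?_
    rw [Finset.mem_Icc] at hl
    rw [Finset.mem_Ioc] at hl'
    omega
  have hpos1 : θ (residue (L (M + 1)) j * p (M + 1)) ≠ 0 := (theta_pos hθ hp (by omega) j).ne'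
  have hpos2 : ∏ l ∈ Finset.Ioc (M + 1) N, θ (lidx p L x l v) ≠ 0 := by
    refine (Finset.prod_pos fun l hl => ?_).ne'
    rw [Finset.mem_Ioc] at hl
    exact hθ.pos _ (lidx_pos hp (by omega) hl.2 v)
  rw [nrm, hsplit, dens, tail_eq_add (by omega), hlM, ht]
  field_simp

/-- The points stopped at depth `d` for two consecutive levels, with an order in a certain range. -/
noncomputable def stuck (N : ℕ) (p L : ℕ → ℕ) (x : ℕ → ℕ → (ℕ →₀ ℝ)) (T : NTree)
    (M d : ℕ) : Finset ℕ :=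
  T.supp.filter fun v => stopDepth L x T M v = d ∧ stopDepth L x T (M + 1) v = d ∧
    tail N p L x M v ≤ T.ord d v ∧ T.ord d v < tail N p L x M v + p (M + 1)

/-- By (‡) the dens_M-mass g j of a noninitial vector j of level M + 1 is at most F(L_{M+1}) times
the mass of the window of L_{M+1} siblings ending at j. The windows attached to the vectors
containing stuck points cover each index at most twice, which gives the factor 2. -/
theorem sum_stuck_dens_le (h : Tower θ N V p L x I a) (hθ : RegularSeq θ) {F : ℕ → ℝ}
    (hF : DoubleDagger θ F)
    (hp : ∀ i, 1 ≤ i → i ≤ N → 1 ≤ p i) (hL : ∀ i, 1 ≤ i → i ≤ N → 2 ≤ L i)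
    {k : ℕ} (hk : 1 ≤ k) {T : NTree} (hT : T.Valid)
    (hTS : T.supp ⊆ (x N k).support) {M : ℕ} (hM : M + 1 < N) {d : ℕ} (hd : 1 ≤ d) :
    ∑ v ∈ stuck N p L x T M d \ initial N L x I (M + 1) k, x N k v * dens θ N p L x M v ≤
      2 * F (L (M + 1)) * ∑ v ∈ (x N k).support, x N k v * dens θ N p L x M v := by
  obtain ⟨w, hw0, hw⟩ := h.exists_weight hθ hp hk (m := M + 2) hM
  set S := (x N k).support with hS
  set Z := stuck N p L x T M d \ initial N L x I (M + 1) k with hZ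
  set l := L (M + 1) with hl
  set B := Z.image (lev x (M + 1)) with hB
  let f : ℕ → ℝ := fun v => x N k v * dens θ N p L x M v
  let g : ℕ → ℝ := fun j => ∑ v ∈ (x (M + 1) j).support, f v
  -- The l consecutive indices ending at j. By `hwin` one has l ≤ j for all j that matter, so the
  -- subtraction is not truncated, and the window stays among the siblings of j.
  let W : ℕ → Finset ℕ := fun j => Finset.Ico (j - l + 1) (j + 1)
  have hF0 : 0 < F l := hF.pos hθ (by have := hL (M + 1) (by omega) hM.le; omega)
  have hl1 : 1 ≤ l := by have := hL (M + 1) (by omega) hM.le; omega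
  have hZs : ∀ v ∈ Z, v ∈ T.supp := fun v hv =>
    (Finset.mem_filter.1 (Finset.mem_sdiff.1 hv).1).1
  have hZS : ∀ v ∈ Z, v ∈ S := fun v hv => hTS (hZs v hv)
  have hpt : ∀ v ∈ S, IsPoint x v := fun v hv => h.isPoint_of_mem le_rfl hk hv
  have hf0 : ∀ v, 0 ≤ f v := fun v => by
    refine mul_nonneg (h.nonneg N le_rfl k hk v) (mul_nonneg (hθ.pos _
      (one_le_tail hp (by omega) v)).le (Finset.prod_nonneg fun i hi => ?_))
    rw [Finset.mem_Icc] at hi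
    exact (hθ.pos _ (lidx_pos hp hi.1 (by omega) v)).le
  have hg0 : ∀ j, 0 ≤ g j := fun j => Finset.sum_nonneg fun v _ => hf0 v
  have hwin : ∀ v ∈ Z, l ≤ lev x (M + 1) v ∧ ∀ i ∈ W (lev x (M + 1) v),
      i ∈ I (M + 1) (lev x (M + 2) v) := by
    intro v hv
    have hvp := hpt v (hZS v hv)
    have hni := (Finset.mem_sdiff.1 hv).2
    rw [initial, Finset.mem_filter, not_and, not_lt] at hni
    have h1 := hni (hZS v hv)
    obtain ⟨s, t, hst, hI⟩ := h.I_Icc (M + 1) hM _ (h.one_le_lev hvp (M := M + 2) hM)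
    have hmem := h.lev_mem_I hvp hM
    have hmin : minOf (I (M + 1) (lev x (M + 2) v)) = s := by
      rw [hI]
      exact minOf_eq (by simpa using hst) fun i hi => (Finset.mem_Icc.1 hi).1
    have hs1 : 1 ≤ s := h.one_le_of_mem hM (h.one_le_lev hvp (M := M + 2) hM)
      (by rw [hI]; simpa using hst)
    rw [show M + 1 + 1 = M + 2 from rfl, hmin] at h1
    rw [hI, Finset.mem_Icc] at hmem
    refine ⟨by omega, fun i hi => ?_⟩
    rw [Finset.mem_Ico] at hi
    rw [hI, Finset.mem_Icc]
    omega
  have hgle : ∀ j ∈ B, g j ≤ F l * ∑ i ∈ W j, g i := by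
    intro j hj
    obtain ⟨v, hv, rfl⟩ := Finset.mem_image.1 hj
    have hvS := hZS v hv
    have hvp := hpt v hvS
    obtain ⟨hlj, hWI⟩ := hwin v hv
    set j := lev x (M + 1) v with hj
    set j' := lev x (M + 2) v with hj'
    have hj'1 : 1 ≤ j' := h.one_le_lev hvp hM
    have hjI : j ∈ I (M + 1) j' := h.lev_mem_I hvp hM
    have hgv : ∀ i ∈ I (M + 1) j', g i = w j' * cof θ p L a (M + 1) j' i *
        (∏ l ∈ Finset.Ioc (M + 1) N, θ (lidx p L x l v))⁻¹ *
        (θ (residue l i * p (M + 1) + tail N p L x (M + 1) v) / θ (residue l i * p (M + 1))) :=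
      fun i hi => h.sum_dens_class hθ hp hk hM hw hvS hi
    set Λ := (∏ l ∈ Finset.Ioc (M + 1) N, θ (lidx p L x l v))⁻¹ with hΛ
    have hΛ0 : 0 ≤ Λ := by
      refine inv_nonneg.2 (Finset.prod_nonneg fun i hi => ?_)
      rw [Finset.mem_Ioc] at hi
      exact (hθ.pos _ (lidx_pos hp (by omega) hi.2 v)).le
    have hp1 := hp (M + 1) (by omega) hM.le
    have hφ0 : ∀ i, 0 ≤ θ (residue l i * p (M + 1) + tail N p L x (M + 1) v) /
        θ (residue l i * p (M + 1)) := fun i => by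
      have : 1 ≤ residue l i * p (M + 1) := Nat.mul_pos (one_le_residue _ _) hp1
      exact div_nonneg (hθ.pos _ (by omega)).le (hθ.pos _ this).le
    have hdd := hF.le_sum hl1 hp1 (one_le_tail (L := L) (x := x) hp hM v) hlj
    have hb0 : 0 ≤ w j' * cof θ p L a (M + 1) j' j * Λ :=
      mul_nonneg (mul_nonneg (hw0 _ hj'1)
        (h.cof_pos hθ hp hM _ (h.one_le_of_mem hM hj'1 hjI)).le) hΛ0
    rw [hgv j hjI]
    refine (mul_le_mul_of_nonneg_left hdd hb0).trans ?_
    rw [← mul_assoc, mul_comm _ (F l), mul_assoc]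
    refine mul_le_mul_of_nonneg_left ?_ hF0.le
    rw [Finset.mul_sum]
    refine Finset.sum_le_sum fun i hi => ?_
    rw [hgv i (hWI i hi)]
    refine mul_le_mul_of_nonneg_right ?_ (hφ0 i)
    refine mul_le_mul_of_nonneg_right ?_ hΛ0
    refine mul_le_mul_of_nonneg_left ?_ (hw0 _ hj'1)
    refine mul_le_mul_of_nonneg_left ?_ (theta_pos hθ hp hM _).le
    -- The window precedes j and the coefficients are nonincreasing, so replacing the coefficient of
    -- j by that of i only enlarges the sum.
    exact h.a_anti (M + 1) hM i j (h.one_le_of_mem hM hj'1 (hWI i hi))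
      (Nat.lt_succ_iff.1 (Finset.mem_Ico.1 hi).2)
  have hmult : ∀ i, (B.filter fun j => i ∈ W j).card ≤ 2 := by
    intro i
    refine card_le_two fun j₁ hj₁ j₂ hj₂ j₃ hj₃ h12 h23 => ?_
    obtain ⟨hj₁, hi₁⟩ := Finset.mem_filter.1 hj₁
    obtain ⟨hj₂, hi₂⟩ := Finset.mem_filter.1 hj₂
    obtain ⟨hj₃, hi₃⟩ := Finset.mem_filter.1 hj₃
    obtain ⟨v₁, hv₁, rfl⟩ := Finset.mem_image.1 hj₁
    obtain ⟨v₂, hv₂, rfl⟩ := Finset.mem_image.1 hj₂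
    obtain ⟨v₃, hv₃, rfl⟩ := Finset.mem_image.1 hj₃
    -- Two stuck points in different vectors whose windows share an index lie under different nodes
    -- of depth d - 1.
    have hcell : ∀ v ∈ Z, ∀ w ∈ Z, i ∈ W (lev x (M + 1) v) → i ∈ W (lev x (M + 1) w) →
        lev x (M + 1) v < lev x (M + 1) w → SetLT (T.cell (d - 1) v) (T.cell (d - 1) w) := by
      intro v hv w hw hiv hiw hvw
      have hvp := hpt v (hZS v hv)
      have hwp := hpt w (hZS w hw)
      refine T.setLT_cell hT (hZs v hv) (hZs w hw) (h.lt_of_lev_lt hvp hwp hM.le hvw) ?_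
      intro hce
      have hpar : lev x (M + 2) v = lev x (M + 2) w :=
        h.I_eq hM (h.one_le_lev hvp hM) (h.one_le_lev hwp hM) ((hwin v hv).2 i hiv)
          ((hwin w hw).2 i hiw)
      have hwv : w ∈ T.cell (d - 1) v := by
        rw [hce]; exact T.mem_cell hT (hZs w hw) _
      -- Under a common node of depth d - 1 the two points would have the same order at depth d.
      -- They have a common parent, so the same indices above level M + 1, and the order, known up
      -- to less than p_{M+1}, would give them equal residues. Distinct vectors less than L_{M+1}
      -- apart have different residues.
      have hord := (T.cell_eq hT (hZs v hv) hwv).2.2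
      rw [Nat.sub_add_cancel hd] at hord
      have hv2 := (Finset.mem_filter.1 (Finset.mem_sdiff.1 hv).1).2.2.2
      have hw2 := (Finset.mem_filter.1 (Finset.mem_sdiff.1 hw).1).2.2.2
      have htl : tail N p L x (M + 1) v = tail N p L x (M + 1) w :=
        Finset.sum_congr rfl fun q hq => h.lidx_congr hvp hwp (M := M + 2)
          (by rw [Finset.mem_Ioc] at hq; omega) (Finset.mem_Ioc.1 hq).2 hpar
      rw [tail_eq_add (by omega), lidx, ← hl] at hv2 hw2
      have hiv' := Finset.mem_Ico.1 hiv
      have hiw' := Finset.mem_Ico.1 hiw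
      have h1v := h.one_le_lev hvp hM.le
      have hlw := (hwin w hw).1
      refine residue_ne (l := l) h1v hvw (by omega) ?_
      have e1 : residue l (lev x (M + 1) v) * p (M + 1) <
          (residue l (lev x (M + 1) w) + 1) * p (M + 1) := by
        rw [add_mul, one_mul]; omega
      have e2 : residue l (lev x (M + 1) w) * p (M + 1) <
          (residue l (lev x (M + 1) v) + 1) * p (M + 1) := by
        rw [add_mul, one_mul]; omega
      have := Nat.lt_of_mul_lt_mul_right e1
      have := Nat.lt_of_mul_lt_mul_right e2
      omega
    have hP12 := hcell v₁ hv₁ v₂ hv₂ hi₁ hi₂ h12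
    have hP23 := hcell v₂ hv₂ v₃ hv₃ hi₂ hi₃ h23
    -- Of three such points, the node of the middle one lies strictly between the other two, so it
    -- meets at most l vectors of level M + 1. But it has not yet been stopped for that level, and
    -- therefore meets more than L_1 ⋯ L_{M+1} ≥ l of them.
    have hsub : (T.cell (d - 1) v₂).image (lev x (M + 1)) ⊆
        Finset.Icc (lev x (M + 1) v₁) (lev x (M + 1) v₃) := by
      intro j hj
      obtain ⟨u, hu, rfl⟩ := Finset.mem_image.1 hj
      have hup := hpt u (hTS (T.cell_subset hT (hZs v₂ hv₂) _ hu))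
      exact Finset.mem_Icc.2
        ⟨h.lev_mono (hpt v₁ (hZS v₁ hv₁)) hup
          (hP12 v₁ (T.mem_cell hT (hZs v₁ hv₁) _) u hu).le hM.le,
        h.lev_mono hup (hpt v₃ (hZS v₃ hv₃))
          (hP23 u hu v₃ (T.mem_cell hT (hZs v₃ hv₃) _)).le hM.le⟩
    have hcard := Finset.card_le_card hsub
    rw [Nat.card_Icc] at hcard
    have hdepth := (Finset.mem_filter.1 (Finset.mem_sdiff.1 hv₂).1).2.2.1
    have hlt : d - 1 < stopDepth L x T (M + 1) v₂ := by omega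
    have hK := lt_meets hlt
    rw [Finset.prod_Icc_succ_top (by omega)] at hK
    have hK2 : l ≤ (∏ l ∈ Finset.Icc 1 M, L l) * L (M + 1) :=
      Nat.le_mul_of_pos_left _ (one_le_prod_L hL (by omega))
    have e1 := Finset.mem_Ico.1 hi₁
    have e3 := Finset.mem_Ico.1 hi₃
    have e4 := (hwin v₃ hv₃).1
    rw [meets] at hK
    omega
  have hWJ : ∀ j ∈ B, W j ⊆ S.image (lev x (M + 1)) := by
    intro j hj i hi
    obtain ⟨v, hv, rfl⟩ := Finset.mem_image.1 hj
    have hiI := (hwin v hv).2 i hi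
    have h1 := h.one_le_lev (hpt v (hZS v hv)) (M := M + 2) hM
    have hi1 := h.one_le_of_mem hM h1 hiI
    have h2 := h.minOf_mem_support hM.le hi1
    exact Finset.mem_image.2 ⟨_, h.support_subset hk hM (hZS v hv)
      (h.child_support_subset hk hM (hZS v hv) hiI h2), h.lev_eq hM.le hi1 h2⟩
  have hsumS : ∑ i ∈ S.image (lev x (M + 1)), g i = ∑ v ∈ S, f v := by
    rw [← Finset.sum_fiberwise_of_maps_to (s := S) (t := S.image (lev x (M + 1)))
      (fun v hv => Finset.mem_image_of_mem (lev x (M + 1)) hv) f]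
    refine Finset.sum_congr rfl fun j hj => ?_
    obtain ⟨v, hv, rfl⟩ := Finset.mem_image.1 hj
    rw [h.filter_lev_eq hk hM.le hv]
  calc ∑ v ∈ Z, f v ≤ ∑ j ∈ B, g j := by
        rw [← Finset.sum_fiberwise_of_maps_to (s := Z) (t := B)
          (fun v hv => Finset.mem_image_of_mem (lev x (M + 1)) hv) f]
        refine Finset.sum_le_sum fun j hj => ?_
        refine Finset.sum_le_sum_of_subset_of_nonneg (fun v hv => ?_) fun v _ _ => hf0 v
        rw [Finset.mem_filter] at hv
        rw [← hv.2]
        exact h.mem_lev (hpt v (hZS v hv.1)) hM.le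
    _ ≤ ∑ j ∈ B, F l * ∑ i ∈ W j, g i := Finset.sum_le_sum hgle
    _ = F l * ∑ j ∈ B, ∑ i ∈ S.image (lev x (M + 1)), if i ∈ W j then g i else 0 := by
        rw [← Finset.mul_sum]
        congr 1
        refine Finset.sum_congr rfl fun j hj => ?_
        rw [← Finset.sum_filter]
        refine Finset.sum_congr ?_ fun _ _ => rfl
        ext i
        rw [Finset.mem_filter]
        exact ⟨fun hi => ⟨hWJ j hj hi, hi⟩, fun hi => hi.2⟩
    _ = F l * ∑ i ∈ S.image (lev x (M + 1)), ((B.filter fun j => i ∈ W j).card : ℝ) * g i := by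
        rw [Finset.sum_comm]
        congr 1
        refine Finset.sum_congr rfl fun i _ => ?_
        rw [← Finset.sum_filter, Finset.sum_const, nsmul_eq_mul]
    _ ≤ F l * ∑ i ∈ S.image (lev x (M + 1)), 2 * g i := by
        refine mul_le_mul_of_nonneg_left (Finset.sum_le_sum fun i _ => ?_) hF0.le
        exact mul_le_mul_of_nonneg_right (by exact_mod_cast hmult i) (hg0 i)
    _ = 2 * F l * ∑ v ∈ S, f v := by
        rw [← Finset.mul_sum, hsumS]
        ring

end Tower

/-! ### The suprema of products -/

theorem prod_theta_le_one {θ : ℕ → ℝ} (hθ : RegularSeq θ) {N : ℕ} {l : Fin N → ℕ}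
    (hl : ∀ i, 1 ≤ l i) : ∏ i, θ (l i) ≤ 1 :=
  Finset.prod_le_one (fun i _ => (hθ.pos _ (hl i)).le) fun i _ => (hθ.lt_one _ (hl i)).le

theorem prod_le_bigTheta {θ : ℕ → ℝ} (hθ : RegularSeq θ) {N : ℕ} {l : Fin N → ℕ}
    (hl : ∀ i, 1 ≤ l i) : ∏ i, θ (l i) ≤ bigTheta θ N (∑ i, l i) :=
  le_csSup ⟨1, by rintro _ ⟨l, hl, -, rfl⟩; exact prod_theta_le_one hθ hl⟩ ⟨l, hl, rfl, rfl⟩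

theorem bigTheta_nonneg {θ : ℕ → ℝ} (hθ : RegularSeq θ) (N q : ℕ) : 0 ≤ bigTheta θ N q :=
  Real.sSup_nonneg (by
    rintro _ ⟨l, hl, -, rfl⟩
    exact Finset.prod_nonneg fun i _ => (hθ.pos _ (hl i)).le)

theorem bigTheta_le_one {θ : ℕ → ℝ} (hθ : RegularSeq θ) (N q : ℕ) : bigTheta θ N q ≤ 1 :=
  Real.sSup_le (by rintro _ ⟨l, hl, -, rfl⟩; exact prod_theta_le_one hθ hl) zero_le_one

/-- Entries larger than one are lowered one unit at a time. As θ is nonincreasing, products of N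
factors with index sum at least q are thereby bounded by Θ_q. -/
theorem exists_le_sum_eq {N q : ℕ} (hq : N ≤ q) {l : Fin N → ℕ} (hl : ∀ i, 1 ≤ l i)
    (hsum : q ≤ ∑ i, l i) : ∃ l' : Fin N → ℕ, (∀ i, 1 ≤ l' i) ∧ (∀ i, l' i ≤ l i) ∧
      ∑ i, l' i = q := by
  obtain ⟨n, hn⟩ := Nat.exists_eq_add_of_le hsum
  induction n generalizing l with
  | zero => exact ⟨l, hl, fun _ => le_rfl, by simpa using hn⟩
  | succ n ih =>
    -- If all entries were equal to one, the sum would be N, at most q, while it still exceeds q.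
    have hex : ∃ i, 2 ≤ l i := by
      by_contra hno
      push Not at hno
      have : ∑ i, l i ≤ ∑ _i : Fin N, 1 := Finset.sum_le_sum fun i _ => by
        have := hno i; omega
      simp at this
      omega
    obtain ⟨i, hi⟩ := hex
    have hsum' : ∑ j, Function.update l i (l i - 1) j = q + n := by
      have h1 := Finset.sum_update_of_mem (Finset.mem_univ i) l (l i - 1)
      have h2 := Finset.add_sum_erase Finset.univ l (Finset.mem_univ i)
      rw [h1, Finset.sdiff_singleton_eq_erase]
      omega
    obtain ⟨l', h1, h2, h3⟩ := ih (l := Function.update l i (l i - 1)) (fun j => by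
      rcases eq_or_ne j i with rfl | h
      · rw [Function.update_self]; omega
      · rw [Function.update_of_ne h]; exact hl j) (by omega) hsum'
    refine ⟨l', h1, fun j => (h2 j).trans ?_, h3⟩
    rcases eq_or_ne j i with rfl | h
    · rw [Function.update_self]; omega
    · rw [Function.update_of_ne h]

theorem NTree.wt_le_bigTheta {θ : ℕ → ℝ} (hθ : RegularSeq θ) {T : NTree} (hT : T.Valid) {v : ℕ}
    (hv : v ∈ T.supp) {N q : ℕ} (hN : 1 ≤ N) (hh : N ≤ T.height v) (hq : N ≤ q)
    (hord : q ≤ T.ord (T.height v) v) : T.wt θ v ≤ bigTheta θ N q := by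
  obtain ⟨l, hl, hsum, hle⟩ := T.exists_prod_of_le_height hθ hT hv hN hh
  obtain ⟨l', h1, h2, h3⟩ := exists_le_sum_eq hq hl (hsum ▸ hord)
  rw [← h3]
  refine hle.trans (le_trans ?_ (prod_le_bigTheta hθ h1))
  exact Finset.prod_le_prod (fun i _ => (hθ.pos _ (hl i)).le) fun i _ =>
    hθ.antitone _ _ (h1 i) (h2 i)

theorem supRatio_nonneg {θ : ℕ → ℝ} (hθ : RegularSeq θ) {N : ℕ} (hN : 1 ≤ N) {p L : ℕ → ℕ}
    (hp : ∀ i, 1 ≤ i → i ≤ N → 1 ≤ p i) {rN : ℕ} (hrN : 1 ≤ rN) : 0 ≤ supRatio θ N p L rN :=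
  Real.sSup_nonneg (by
    rintro _ ⟨r, hr, hr', rfl⟩
    refine div_nonneg (bigTheta_nonneg hθ _ _) (hθ.pos _ ?_).le
    refine le_trans ?_ (Finset.single_le_sum (f := fun i => p i * r i) (fun _ _ => Nat.zero_le _)
      (Finset.mem_Icc.2 ⟨hN, le_rfl⟩))
    exact Nat.mul_pos (hp N hN le_rfl) (hr' ▸ hrN))

theorem ratio_le_supRatio {θ : ℕ → ℝ} (hθ : RegularSeq θ) {N : ℕ} (hN : 1 ≤ N) {p L : ℕ → ℕ}
    (hp : ∀ i, 1 ≤ i → i ≤ N → 1 ≤ p i) {r : ℕ → ℕ} (hr1 : ∀ i, 1 ≤ i → i ≤ N → 1 ≤ r i)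
    (hrL : ∀ i, 1 ≤ i → i ≤ N → r i ≤ L i) :
    bigTheta θ N (∑ i ∈ Finset.Icc 1 N, p i * r i) / θ (∑ i ∈ Finset.Icc 1 N, p i * r i) ≤
      supRatio θ N p L (r N) := by
  refine le_csSup ⟨1 / θ (∑ i ∈ Finset.Icc 1 N, p i * L i), ?_⟩
    ⟨r, fun i hi hiN => ⟨hr1 i hi hiN.le, hrL i hi hiN.le⟩, rfl, rfl⟩
  rintro _ ⟨s, hs, hsN, rfl⟩
  have h1 : 1 ≤ ∑ i ∈ Finset.Icc 1 N, p i * s i := by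
    refine le_trans ?_ (Finset.single_le_sum (f := fun i => p i * s i) (fun _ _ => Nat.zero_le _)
      (Finset.mem_Icc.2 ⟨hN, le_rfl⟩))
    exact Nat.mul_pos (hp N hN le_rfl) (hsN ▸ hr1 N hN le_rfl)
  have h2 : ∑ i ∈ Finset.Icc 1 N, p i * s i ≤ ∑ i ∈ Finset.Icc 1 N, p i * L i := by
    refine Finset.sum_le_sum fun i hi => Nat.mul_le_mul_left _ ?_
    rw [Finset.mem_Icc] at hi
    rcases eq_or_lt_of_le hi.2 with h | h
    · rw [h, hsN]; exact hrL N hN le_rfl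
    · exact (hs i hi.1 h).2
  have h3 := hθ.pos _ (h1.trans h2)
  have h4 := hθ.antitone _ _ h1 h2
  exact div_le_div₀ zero_le_one (bigTheta_le_one hθ _ _) h3 h4

/-- If no such M existed, σ M ≤ N - 1 - M would follow by induction, and σ (N - 1) would vanish.
Since the common value is tied to M, the stuck points need only N - 1 sets, not one for each pair of
a level and a depth. -/
theorem exists_eq_sub {N : ℕ} {σ : ℕ → ℕ} (h0 : σ 0 ≤ N - 1) (h1 : 1 ≤ σ (N - 1))
    (hσ : ∀ M, M + 1 < N → σ (M + 1) ≤ σ M) :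
    ∃ M, M + 1 < N ∧ σ M = N - 1 - M ∧ σ (M + 1) = N - 1 - M := by
  by_contra hno
  push Not at hno
  have hle : ∀ M, M < N → σ M ≤ N - 1 - M := by
    intro M
    induction M with
    | zero => intro _; simpa using h0
    | succ M ih =>
      intro hM
      have e1 := ih (by omega)
      have e2 := hσ M hM
      have e3 := hno M hM
      omega
  rcases Nat.eq_zero_or_pos N with rfl | hN
  · simp at h0 h1; omega
  · have := hle (N - 1) (by omega)
    omega

namespace Tower

variable {θ : ℕ → ℝ} {N : ℕ} {V : Set ℕ} {p L : ℕ → ℕ} {x : ℕ → ℕ → (ℕ →₀ ℝ)}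
  {I : ℕ → ℕ → Finset ℕ} {a : ℕ → ℕ → ℝ}

/-! ### The pointwise splitting of a tree functional and its summation -/

theorem dens_nonneg (hθ : RegularSeq θ) (hp : ∀ i, 1 ≤ i → i ≤ N → 1 ≤ p i) {M : ℕ} (hM : M < N)
    (v : ℕ) : 0 ≤ dens θ N p L x M v :=
  mul_nonneg (hθ.pos _ (one_le_tail hp hM v)).le (Finset.prod_nonneg fun i hi => by
    rw [Finset.mem_Icc] at hi
    exact (hθ.pos _ (lidx_pos hp hi.1 (by omega) v)).le)

theorem tail_zero (v : ℕ) :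
    tail N p L x 0 v = ∑ i ∈ Finset.Icc 1 N, p i * residue (L i) (lev x i v) :=
  Finset.sum_congr (by ext i; simp only [Finset.mem_Ioc, Finset.mem_Icc]; omega)
    fun _ _ => mul_comm _ _

/-- The pointwise estimate of the coefficients of a tree functional. -/
theorem wt_mul_le (h : Tower θ N V p L x I a) (hθ : RegularSeq θ) {F : ℕ → ℝ} (hN : 1 ≤ N)
    (hpar : IsParam θ F N p L) {k : ℕ} (hk : 1 ≤ k) {T : NTree} (hT : T.Valid)
    (hTS : T.supp ⊆ (x N k).support) {v : ℕ} (hv : v ∈ T.supp) :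
    T.wt θ v * x N k v ≤
      (∑ M ∈ Finset.range N,
        if v ∈ T.supp.filter (fun v => T.ord (stopDepth L x T M v) v < tail N p L x M v)
          then x N k v else 0) +
      (∑ M ∈ Finset.range (N - 1), 1 / (24 * (N : ℝ) ^ 2) *
        (θ 1 * dens θ N p L x M v * x N k v)) +
      supRatio θ N p L (residue (L N) k) * (dens θ N p L x 0 v * x N k v) +
      (∑ M ∈ Finset.range (N - 1),
        if v ∈ stuck N p L x T M (N - 1 - M) \ initial N L x I (M + 1) k then
          (∏ l ∈ Finset.Icc 1 M, θ (L l * p l))⁻¹ * (x N k v * dens θ N p L x M v) else 0) +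
      ∑ M ∈ Finset.range (N - 1), if v ∈ initial N L x I (M + 1) k then x N k v else 0 := by
  have hp := hpar.p_pos
  have hL := hpar.two_le_L
  have hvS := hTS hv
  have hvp := h.isPoint_of_mem le_rfl hk hvS
  have hpt : ∀ v ∈ T.supp, IsPoint x v := fun v hv => h.isPoint_of_mem le_rfl hk (hTS hv)
  have hx0 : 0 ≤ x N k v := h.nonneg N le_rfl k hk v
  have hd0 : ∀ M < N, 0 ≤ dens θ N p L x M v := fun M hM => dens_nonneg hθ hp hM v
  have hθ1 : 0 < θ 1 := hθ.pos 1 le_rfl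
  have hP0 : ∀ M ≤ N, 0 < ∏ l ∈ Finset.Icc 1 M, θ (L l * p l) := fun M hM =>
    prod_theta_pos hθ hp hL hM
  have hR0 := supRatio_nonneg (L := L) hθ hN hp (one_le_residue (L N) k)
  have n1 : ∀ M ∈ Finset.range N, 0 ≤
      if v ∈ T.supp.filter (fun v => T.ord (stopDepth L x T M v) v < tail N p L x M v)
          then x N k v else 0 := fun M _ => by split_ifs <;> simp [hx0]
  have n2 : ∀ M ∈ Finset.range (N - 1), 0 ≤ 1 / (24 * (N : ℝ) ^ 2) *
        (θ 1 * dens θ N p L x M v * x N k v) := fun M hM => by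
    have := hd0 M (by rw [Finset.mem_range] at hM; omega)
    positivity
  have n3 : 0 ≤ supRatio θ N p L (residue (L N) k) * (dens θ N p L x 0 v * x N k v) :=
    mul_nonneg hR0 (mul_nonneg (hd0 0 hN) hx0)
  have n4 : ∀ M ∈ Finset.range (N - 1), 0 ≤
      if v ∈ stuck N p L x T M (N - 1 - M) \ initial N L x I (M + 1) k then
          (∏ l ∈ Finset.Icc 1 M, θ (L l * p l))⁻¹ * (x N k v * dens θ N p L x M v) else 0 :=
    fun M hM => by
      have hMN : M < N := by rw [Finset.mem_range] at hM; omega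
      split_ifs
      · exact mul_nonneg (inv_nonneg.2 (hP0 M hMN.le).le) (mul_nonneg hx0 (hd0 M hMN))
      · exact le_rfl
  have n5 : ∀ M ∈ Finset.range (N - 1), 0 ≤
      if v ∈ initial N L x I (M + 1) k then x N k v else 0 := fun M _ => by
    split_ifs <;> simp [hx0]
  have s1 := Finset.sum_nonneg n1
  have s2 := Finset.sum_nonneg n2
  have s4 := Finset.sum_nonneg n4
  have s5 := Finset.sum_nonneg n5
  have hw1 : T.wt θ v * x N k v ≤ x N k v := mul_le_of_le_one_left hx0 (T.wt_le_one hθ hT hv)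
  -- Points stopped at too small an order: the trivial bound 1 for the weight suffices, as their
  -- mass is small.
  by_cases ha : ∃ M < N, T.ord (stopDepth L x T M v) v < tail N p L x M v
  · obtain ⟨M, hM, hlt⟩ := ha
    have hs := Finset.single_le_sum n1 (Finset.mem_range.2 hM)
    rw [if_pos (Finset.mem_filter.2 ⟨hv, hlt⟩)] at hs
    linarith
  push Not at ha
  have hord1 : ∀ M < N, 1 ≤ T.ord (stopDepth L x T M v) v := fun M hM =>
    (one_le_tail hp hM v).trans (ha M hM)
  -- The order overshoots by at least p_{M+1}. The tail is at least p_N, so (A) applies with n equal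
  -- to the tail and makes the weight negligible against dens_M.
  by_cases hb : ∃ M, M + 1 < N ∧ tail N p L x M v + p (M + 1) ≤ T.ord (stopDepth L x T M v) v
  · obtain ⟨M, hM, hle⟩ := hb
    have hs := Finset.single_le_sum n2 (Finset.mem_range.2 (by omega : M < N - 1))
    have ht := one_le_tail (L := L) (x := x) hp (by omega : M < N) v
    have h1 : T.wt θ v ≤ θ (p (M + 1) + tail N p L x M v) := by
      refine (T.wt_le_ord hθ hT hv (hord1 M (by omega))).trans ?_
      rw [add_comm]
      exact hθ.antitone _ _ (by omega) hle
    have hpN : p N ≤ tail N p L x M v := by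
      refine le_trans ?_ (Finset.single_le_sum (f := fun l => lidx p L x l v)
        (fun _ _ => Nat.zero_le _) (Finset.mem_Ioc.2 ⟨by omega, le_rfl⟩))
      exact Nat.le_mul_of_pos_left _ (one_le_residue _ _)
    have h2 := hpar.condA M (by omega) _ hpN
    rw [div_le_iff₀ (hθ.pos _ ht)] at h2
    have h3 : θ (p (M + 1) + tail N p L x M v) ≤
        1 / (24 * (N : ℝ) ^ 2) * (θ 1 * dens θ N p L x M v) := by
      refine h2.trans ?_
      have h4 := prod_theta_le (L := L) (x := x) hθ hp hL (by omega : M ≤ N) v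
      have h5 := (hθ.pos _ ht).le
      have h6 : 0 ≤ θ 1 / (24 * (N : ℝ) ^ 2) := by positivity
      calc _ ≤ θ 1 / (24 * (N : ℝ) ^ 2) * (∏ l ∈ Finset.Icc 1 M, θ (lidx p L x l v)) *
            θ (tail N p L x M v) :=
          mul_le_mul_of_nonneg_right (mul_le_mul_of_nonneg_left h4 h6) h5
        _ = _ := by rw [dens]; ring
    have h7 := mul_le_mul_of_nonneg_right (h1.trans h3) hx0
    have h8 : 1 / (24 * (N : ℝ) ^ 2) * (θ 1 * dens θ N p L x M v) * x N k v =
      1 / (24 * (N : ℝ) ^ 2) * (θ 1 * dens θ N p L x M v * x N k v) := by ring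
    linarith
  push Not at hb
  -- A branch with at least N nodes gives the main term. Its total order is at least t_0, and the
  -- residue at level N is that of k, so the ratio is one of those in the supremum.
  rcases le_or_gt N (T.height v) with hh | hh
  · have hq : N ≤ tail N p L x 0 v := by
      calc N = ∑ _l ∈ Finset.Ioc 0 N, 1 := by simp
        _ ≤ _ := Finset.sum_le_sum fun l hl => by
          rw [Finset.mem_Ioc] at hl
          exact lidx_pos hp hl.1 hl.2 v
    have h1 := T.wt_le_bigTheta hθ hT hv hN hh hq
      ((ha 0 hN).trans (T.ord_le_ord_height hT hv _))
    have h2 := ratio_le_supRatio (L := L) hθ hN hp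
      (r := fun i => residue (L i) (lev x i v)) (fun i _ _ => one_le_residue _ _)
      fun i hi hiN => residue_le (by have := hL i hi hiN; omega)
    rw [← tail_zero, h.lev_eq le_rfl hk hvS, div_le_iff₀ (hθ.pos _ (hN.trans hq))] at h2
    have h3 := mul_le_mul_of_nonneg_right (h1.trans h2) hx0
    have h4 : dens θ N p L x 0 v = θ (tail N p L x 0 v) := by simp [dens]
    rw [h4]
    rw [h4] at n3
    linarith
  -- A short branch has d_0 ≤ N - 1. Moreover d_{N-1} ≥ 1, since at depth zero the order is zero
  -- while it must reach a positive tail. The pigeonhole argument produces a level at which v is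
  -- stuck.
  · obtain ⟨M, hM, e1, e2⟩ := exists_eq_sub (N := N) (σ := fun M => stopDepth L x T M v)
      (by have := stopDepth_le_height (x := x) hL hT hv (Nat.zero_le N); omega)
      (by
        by_contra h0
        have h0' : stopDepth L x T (N - 1) v = 0 := by omega
        have := hord1 (N - 1) (by omega)
        rw [h0', T.ord_zero] at this
        omega)
      (fun M hM => h.stopDepth_succ_le hL hT hpt hv (by omega))
    have h1 := ha M (by omega)
    have h2 := hb M hM
    rw [e1] at h1 h2
    have hst : v ∈ stuck N p L x T M (N - 1 - M) := Finset.mem_filter.2 ⟨hv, e1, e2, h1, h2⟩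
    by_cases hin : v ∈ initial N L x I (M + 1) k
    · have hs := Finset.single_le_sum n5 (Finset.mem_range.2 (by omega : M < N - 1))
      rw [if_pos hin] at hs
      linarith
    · have hs := Finset.single_le_sum n4 (Finset.mem_range.2 (by omega : M < N - 1))
      rw [if_pos (Finset.mem_sdiff.2 ⟨hst, hin⟩)] at hs
      have ht := one_le_tail (L := L) (x := x) hp (by omega : M < N) v
      have h3 : T.wt θ v ≤ θ (tail N p L x M v) :=
        (T.wt_le_ord hθ hT hv (ht.trans h1)).trans (hθ.antitone _ _ ht h1)
      have h4 := prod_theta_le (L := L) (x := x) hθ hp hL (by omega : M ≤ N) v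
      have h5 : θ (tail N p L x M v) ≤ (∏ l ∈ Finset.Icc 1 M, θ (L l * p l))⁻¹ *
          dens θ N p L x M v := by
        rw [← div_eq_inv_mul, le_div_iff₀ (hP0 M (by omega))]
        exact mul_le_mul_of_nonneg_left h4 (hθ.pos _ ht).le
      have h6 := mul_le_mul_of_nonneg_right (h3.trans h5) hx0
      have h7 : (∏ l ∈ Finset.Icc 1 M, θ (L l * p l))⁻¹ * dens θ N p L x M v * x N k v =
        (∏ l ∈ Finset.Icc 1 M, θ (L l * p l))⁻¹ * (x N k v * dens θ N p L x M v) := by ring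
      linarith

/-- Each of the four error terms sums at most N contributions of order 1/N², with constants 1/2,
1/24, 1/72 and 1/42; as B ≥ 1, together they stay below (2/N) B. The main term enters with the
constant θ_1⁻¹, coming from the norming functional for M = 0. -/
theorem val_le (h : Tower θ N V p L x I a) (hθ : RegularSeq θ) {F : ℕ → ℝ}
    (hF : DoubleDagger θ F) (hN : 1 ≤ N) (hpar : IsParam θ F N p L) (hV : ∀ v ∈ V, 1 ≤ v) {k : ℕ}
    (hk : 1 ≤ k)
    (hkN : 42 * (N : ℝ) ^ 2 * ∏ i ∈ Finset.Icc 1 N, (L i : ℝ) * (θ (L i * p i))⁻¹ ≤ k)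
    {T : NTree} (hT : T.Valid) (hTS : T.supp ⊆ (x N k).support) :
    T.val θ (x N k) ≤ (2 / (N : ℝ) + 4 * (θ 1)⁻¹ * supRatio θ N p L (residue (L N) k)) *
      normXM θ (x N k) := by
  have hp := hpar.p_pos
  have hL := hpar.two_le_L
  have hθ1 : 0 < θ 1 := hθ.pos 1 le_rfl
  have hN1 : (1 : ℝ) ≤ N := by exact_mod_cast hN
  have hk0 : (0 : ℝ) < k := by exact_mod_cast hk
  have hR0 := supRatio_nonneg (L := L) hθ hN hp (one_le_residue (L N) k)
  have hB1 := h.one_le_normXM hθ hp hk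
  set B := normXM θ (x N k) with hB
  set R := supRatio θ N p L (residue (L N) k) with hR
  set S := (x N k).support with hS
  have hx0 : ∀ v, 0 ≤ x N k v := h.nonneg N le_rfl k hk
  have hP0 : 0 < ∏ l ∈ Finset.Icc 1 N, θ (L l * p l) := prod_theta_pos hθ hp hL le_rfl
  have hP1 : ∏ l ∈ Finset.Icc 1 N, θ (L l * p l) ≤ 1 := by
    refine Finset.prod_le_one (fun l hl => ?_) fun l hl => ?_
    all_goals
      rw [Finset.mem_Icc] at hl
      have h1 := hL l hl.1 hl.2
      have h2 := hp l hl.1 hl.2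
      have h3 : 1 ≤ L l * p l := Nat.mul_pos (by omega) h2
    · exact (hθ.pos _ h3).le
    · exact (hθ.lt_one _ h3).le
  have hQ1 : (1 : ℝ) ≤ ∏ l ∈ Finset.Icc 1 N, (L l : ℝ) := by
    exact_mod_cast one_le_prod_L hL le_rfl
  have hkN' := hkN
  rw [Finset.prod_mul_distrib, Finset.prod_inv_distrib] at hkN'
  set P := ∏ l ∈ Finset.Icc 1 N, θ (L l * p l) with hP
  set Q := ∏ l ∈ Finset.Icc 1 N, (L l : ℝ) with hQ
  have hPi : 1 ≤ P⁻¹ := (one_le_inv₀ hP0).2 hP1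
  have hQP : Q * P⁻¹ * (42 * (N : ℝ) ^ 2) ≤ k := by linarith
  have hQle : Q ≤ k := by
    have e1 : Q ≤ Q * P⁻¹ := le_mul_of_one_le_right (by linarith) hPi
    have e2 : Q * P⁻¹ ≤ Q * P⁻¹ * (42 * (N : ℝ) ^ 2) :=
      le_mul_of_one_le_right (by linarith) (by nlinarith)
    linarith
  have hsub : ∀ s : Finset ℕ, s ⊆ Finset.Icc 1 N → ((∏ l ∈ s, L l : ℕ) : ℝ) ≤ Q := by
    intro s hs
    rw [hQ, ← Nat.cast_prod]
    norm_cast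
    refine Finset.prod_le_prod_of_subset_of_one_le' hs fun l hl _ => ?_
    rw [Finset.mem_Icc] at hl
    have := hL l hl.1 hl.2
    omega
  have hdens : ∀ M < N, ∑ v ∈ S, θ 1 * dens θ N p L x M v * x N k v ≤ B := by
    intro M hM
    refine h.norming_tail hθ hp hL hV hM hk ?_ (x N k) hx0
    have := (hsub (Finset.Ioo M N) fun l hl => by
      rw [Finset.mem_Ioo] at hl; rw [Finset.mem_Icc]; omega).trans hQle
    exact_mod_cast this
  have hdens' : ∀ M < N, ∑ v ∈ S, x N k v * dens θ N p L x M v ≤ (θ 1)⁻¹ * B := by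
    intro M hM
    rw [← div_eq_inv_mul, le_div_iff₀ hθ1, Finset.sum_mul]
    refine le_trans (le_of_eq ?_) (hdens M hM)
    exact Finset.sum_congr rfl fun v _ => by ring
  have hfil : ∀ (A : Finset ℕ) (f : ℕ → ℝ), (∀ v, 0 ≤ f v) →
      ∑ v ∈ T.supp, (if v ∈ A then f v else 0) ≤ ∑ v ∈ A, f v := by
    intro A f hf
    rw [← Finset.sum_filter]
    exact Finset.sum_le_sum_of_subset_of_nonneg (fun v hv => (Finset.mem_filter.1 hv).2)
      fun v _ _ => hf v
  have t1 : ∑ v ∈ T.supp, ∑ M ∈ Finset.range N,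
      (if v ∈ T.supp.filter (fun v => T.ord (stopDepth L x T M v) v < tail N p L x M v)
          then x N k v else 0) ≤ N * (1 / (2 * (N : ℝ) ^ 2)) := by
    rw [Finset.sum_comm]
    refine (Finset.sum_le_card_nsmul _ _ (1 / (2 * (N : ℝ) ^ 2)) fun M hM => ?_).trans
      (by rw [Finset.card_range, nsmul_eq_mul])
    exact (hfil _ _ hx0).trans (h.sum_apply_small_order_le hθ hp hL hV hk hkN hT hTS
      (Finset.mem_range.1 hM))
  have t2 : ∑ v ∈ T.supp, ∑ M ∈ Finset.range (N - 1), 1 / (24 * (N : ℝ) ^ 2) *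
        (θ 1 * dens θ N p L x M v * x N k v) ≤ N * (1 / (24 * (N : ℝ) ^ 2) * B) := by
    rw [Finset.sum_comm]
    refine (Finset.sum_le_card_nsmul _ _ (1 / (24 * (N : ℝ) ^ 2) * B) fun M hM => ?_).trans ?_
    · have hMN : M < N := by rw [Finset.mem_range] at hM; omega
      rw [← Finset.mul_sum]
      refine mul_le_mul_of_nonneg_left (le_trans ?_ (hdens M hMN)) (by positivity)
      exact Finset.sum_le_sum_of_subset_of_nonneg hTS fun v _ _ =>
        mul_nonneg (mul_nonneg hθ1.le (dens_nonneg hθ hp hMN v)) (hx0 v)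
    · rw [Finset.card_range, nsmul_eq_mul]
      refine mul_le_mul_of_nonneg_right ?_ (by positivity)
      exact_mod_cast Nat.sub_le N 1
  have t3 : ∑ v ∈ T.supp, R * (dens θ N p L x 0 v * x N k v) ≤ R * ((θ 1)⁻¹ * B) := by
    rw [← Finset.mul_sum]
    refine mul_le_mul_of_nonneg_left (le_trans ?_ (hdens' 0 hN)) hR0
    refine le_trans (le_of_eq ?_) (Finset.sum_le_sum_of_subset_of_nonneg hTS fun v _ _ =>
        mul_nonneg (hx0 v) (dens_nonneg hθ hp hN v))
    exact Finset.sum_congr rfl fun v _ => mul_comm _ _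
  have t4 : ∑ v ∈ T.supp, ∑ M ∈ Finset.range (N - 1),
        (if v ∈ stuck N p L x T M (N - 1 - M) \ initial N L x I (M + 1) k then
          (∏ l ∈ Finset.Icc 1 M, θ (L l * p l))⁻¹ * (x N k v * dens θ N p L x M v) else 0) ≤
      N * (1 / (72 * (N : ℝ) ^ 2) * B) := by
    rw [Finset.sum_comm]
    refine (Finset.sum_le_card_nsmul _ _ (1 / (72 * (N : ℝ) ^ 2) * B) fun M hM => ?_).trans ?_
    · have hMN : M + 1 < N := by rw [Finset.mem_range] at hM; omega
      have hPM := prod_theta_pos hθ hp hL (by omega : M ≤ N)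
      refine (hfil _ _ fun v => mul_nonneg (inv_nonneg.2 hPM.le) (mul_nonneg (hx0 v)
        (dens_nonneg hθ hp (by omega) v))).trans ?_
      rw [← Finset.mul_sum]
      have e1 := h.sum_stuck_dens_le hθ hF hp hL hk hT hTS hMN (d := N - 1 - M) (by omega)
      have e2 := hdens' M (by omega)
      -- The product in (C) cancels the factor PM⁻¹ lost in comparing θ of the tail with dens_M, and
      -- its θ_1 cancels the one from the norming functional.
      have e3 := hpar.condC M (by omega)
      have e4 := (hF.pos hθ (R := L (M + 1)) (by
        have := hL (M + 1) (by omega) (by omega); omega)).le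
      set PM := ∏ l ∈ Finset.Icc 1 M, θ (L l * p l) with hPMdef
      have e5 : 0 ≤ (θ 1)⁻¹ * B := by positivity
      calc _ ≤ PM⁻¹ * (2 * F (L (M + 1)) * ((θ 1)⁻¹ * B)) :=
            mul_le_mul_of_nonneg_left (e1.trans (mul_le_mul_of_nonneg_left e2 (by positivity)))
              (inv_nonneg.2 hPM.le)
        _ ≤ PM⁻¹ * (2 * (θ 1 / (144 * (N : ℝ) ^ 2) * PM) * ((θ 1)⁻¹ * B)) := by
            refine mul_le_mul_of_nonneg_left (mul_le_mul_of_nonneg_right ?_ e5)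
              (inv_nonneg.2 hPM.le)
            linarith
        _ = 1 / (72 * (N : ℝ) ^ 2) * B := by
            field_simp
            norm_num
    · rw [Finset.card_range, nsmul_eq_mul]
      refine mul_le_mul_of_nonneg_right ?_ (by positivity)
      exact_mod_cast Nat.sub_le N 1
  have t5 : ∑ v ∈ T.supp, ∑ M ∈ Finset.range (N - 1),
      (if v ∈ initial N L x I (M + 1) k then x N k v else 0) ≤ N * (1 / (42 * (N : ℝ) ^ 2)) := by
    rw [Finset.sum_comm]
    refine (Finset.sum_le_card_nsmul _ _ (1 / (42 * (N : ℝ) ^ 2)) fun M hM => ?_).trans ?_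
    · have hMN : M + 1 < N := by rw [Finset.mem_range] at hM; omega
      refine (hfil _ _ hx0).trans ?_
      have e1 := h.sum_initial_le hθ hp hV hk (m := M + 1) hMN
      have e2 := hsub {M + 1} (by
        intro l hl
        rw [Finset.mem_singleton] at hl
        rw [Finset.mem_Icc]; omega)
      rw [Finset.prod_singleton] at e2
      calc ∑ v ∈ initial N L x I (M + 1) k, x N k v
          ≤ ∑ v ∈ initial N L x I (M + 1) k, P⁻¹ * nrm θ p L x N k v :=
            Finset.sum_le_sum fun v _ => h.apply_le_nrm hθ hp hL hk v
        _ = P⁻¹ * ∑ v ∈ initial N L x I (M + 1) k, nrm θ p L x N k v := by rw [Finset.mul_sum]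
        _ ≤ P⁻¹ * (Q / k) := by
            refine mul_le_mul_of_nonneg_left (e1.trans ?_) (by positivity)
            gcongr
        _ = (Q * P⁻¹) / k := by ring
        _ ≤ _ := by
            rw [div_le_div_iff₀ hk0 (by positivity)]
            linarith
    · rw [Finset.card_range, nsmul_eq_mul]
      refine mul_le_mul_of_nonneg_right ?_ (by positivity)
      exact_mod_cast Nat.sub_le N 1
  have hval : T.val θ (x N k) ≤ N * (1 / (2 * (N : ℝ) ^ 2)) + N * (1 / (24 * (N : ℝ) ^ 2) * B) +
      R * ((θ 1)⁻¹ * B) + N * (1 / (72 * (N : ℝ) ^ 2) * B) + N * (1 / (42 * (N : ℝ) ^ 2)) := by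
    refine (Finset.sum_le_sum fun v hv => h.wt_mul_le hθ hN hpar hk hT hTS hv).trans ?_
    simp only [Finset.sum_add_distrib]
    linarith
  refine hval.trans ?_
  have e1 : (N : ℝ) * (1 / (2 * (N : ℝ) ^ 2)) = 1 / 2 * (1 / N) := by field_simp
  have e2 : (N : ℝ) * (1 / (24 * (N : ℝ) ^ 2) * B) = 1 / 24 * (1 / N * B) := by field_simp
  have e3 : (N : ℝ) * (1 / (72 * (N : ℝ) ^ 2) * B) = 1 / 72 * (1 / N * B) := by field_simp
  have e4 : (N : ℝ) * (1 / (42 * (N : ℝ) ^ 2)) = 1 / 42 * (1 / N) := by field_simp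
  have e5 : 1 / (N : ℝ) ≤ 1 / N * B := le_mul_of_one_le_right (by positivity) hB1
  have e6 : 0 ≤ R * ((θ 1)⁻¹ * B) := by positivity
  have e7 : (2 / (N : ℝ) + 4 * (θ 1)⁻¹ * R) * B = 2 * (1 / N * B) + 4 * (R * ((θ 1)⁻¹ * B)) := by
    ring
  have e8 : (0 : ℝ) ≤ 1 / N := by positivity
  rw [e1, e2, e3, e4, e7]
  linarith

end Tower

/-- The norm estimate for layered vectors. -/
theorem IsLayered.normX_le {θ F : ℕ → ℝ} (hθ : RegularSeq θ) (hF : DoubleDagger θ F) {N : ℕ}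
    (hN : 1 ≤ N) {V : Set ℕ} (hV : ∀ v ∈ V, 1 ≤ v) {p L : ℕ → ℕ} (hpar : IsParam θ F N p L)
    {x : ℕ → ℕ → (ℕ →₀ ℝ)} (hx : IsLayered θ N V p L x) {k : ℕ}
    (hkN : 42 * (N : ℝ) ^ 2 * ∏ i ∈ Finset.Icc 1 N, (L i : ℝ) * (θ (L i * p i))⁻¹ ≤ k) :
    x N k ≠ 0 ∧
      x N k ∈ Submodule.span ℝ ((fun v : ℕ => (Finsupp.single v 1 : ℕ →₀ ℝ)) '' V) ∧
      normX θ (x N k) ≤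
        (2 / (N : ℝ) + 4 * (θ 1)⁻¹ * supRatio θ N p L (residue (L N) k)) * normXM θ (x N k) := by
  obtain ⟨I, a, h⟩ := hx.exists_tower hθ hpar.p_pos
  have hk : 1 ≤ k := by
    have hpos : 0 < 42 * (N : ℝ) ^ 2 * ∏ i ∈ Finset.Icc 1 N, (L i : ℝ) * (θ (L i * p i))⁻¹ := by
      refine mul_pos (by positivity) (Finset.prod_pos fun i hi => ?_)
      rw [Finset.mem_Icc] at hi
      have h1 := hpar.two_le_L i hi.1 hi.2
      have h2 := hpar.p_pos i hi.1 hi.2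
      have h3 := hθ.pos (L i * p i) (Nat.mul_pos (by omega) h2)
      have h4 : (0 : ℝ) < L i := by exact_mod_cast (by omega : 0 < L i)
      positivity
    exact_mod_cast hpos.trans_le hkN
  refine ⟨fun h0 => ?_, h.mem_span le_rfl hk, ?_⟩
  · have := h.nonempty N le_rfl k hk
    rw [h0] at this
    simp at this
  · exact normX_le_of_tree hθ (h.nonneg N le_rfl k hk)
      (fun v hv => hk.trans ((h.le_minOf hV le_rfl hk).trans (minOf_le hv)))
      fun T hT hTS => h.val_le hθ hF hN hpar hV hk hkN hT hTS

/-! ### Existence of good integers -/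

theorem NotDagger.exists_forall {θ : ℕ → ℝ} (hθ : RegularSeq θ) (h : NotDagger θ) {ε : ℝ}
    (hε : 0 < ε) :
    ∀ᶠ m in atTop, ∀ᶠ n in atTop, θ (m + n) / θ n ≤ ε := by
  filter_upwards [(tendsto_order.1 h).2 ε hε] with m hm
  -- Monotonicity bounds the ratios by one; without boundedness the real limsup could be a default
  -- value and would carry no information.
  have hb : IsBoundedUnder (· ≤ ·) atTop fun n => θ (m + n) / θ n := by
    refine ⟨1, eventually_map.2 ?_⟩
    filter_upwards [eventually_ge_atTop 1] with n hn
    exact (div_le_one (hθ.pos n hn)).2 (hθ.antitone n _ hn (by omega))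
  filter_upwards [eventually_lt_of_limsup_lt hm hb] with n hn using hn.le

/-- Each new pair is chosen large relative to the product over the earlier pairs: p_{K+1} by (¬†)
and L_{K+1} by F → 0. As (¬†) concerns a limsup, (A) is obtained here only for all large n. -/
theorem exists_isParam_aux {θ F : ℕ → ℝ} (hθ : RegularSeq θ) (hdag : NotDagger θ)
    (hF : Tendsto F atTop (𝓝 0)) {α β : ℝ} (hα : 0 < α) (hβ : 0 < β) (K : ℕ) :
    ∃ p L : ℕ → ℕ, (∀ i, 1 ≤ i → i ≤ K → 1 ≤ p i ∧ 2 ≤ L i) ∧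
      ∀ M, M < K →
        (∀ᶠ n in atTop, θ (p (M + 1) + n) / θ n ≤ α * ∏ i ∈ Finset.Icc 1 M, θ (L i * p i)) ∧
        ∑ i ∈ Finset.Icc 1 M, L i * p i < p (M + 1) ∧
        F (L (M + 1)) ≤ β * ∏ i ∈ Finset.Icc 1 M, θ (L i * p i) := by
  induction K with
  | zero => exact ⟨fun _ => 1, fun _ => 2, by omega, by omega⟩
  | succ K ih =>
    obtain ⟨p, L, hpL, h⟩ := ih
    have hP : 0 < ∏ i ∈ Finset.Icc 1 K, θ (L i * p i) := Finset.prod_pos fun i hi => by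
      obtain ⟨hi1, hiK⟩ := Finset.mem_Icc.1 hi
      obtain ⟨hp, hL⟩ := hpL i hi1 hiK
      exact hθ.pos _ (Nat.mul_pos (by omega) hp)
    obtain ⟨P, hP1, hP2⟩ := ((hdag.exists_forall hθ (mul_pos hα hP)).and
      (eventually_gt_atTop (∑ i ∈ Finset.Icc 1 K, L i * p i))).exists
    obtain ⟨Q, hQ1, hQ2⟩ := (((tendsto_order.1 hF).2 _ (mul_pos hβ hP)).and
      (eventually_ge_atTop 2)).exists
    have e : ∀ i, i ≤ K → Function.update p (K + 1) P i = p i ∧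
        Function.update L (K + 1) Q i = L i := fun i hi =>
      ⟨Function.update_of_ne (by omega) _ _, Function.update_of_ne (by omega) _ _⟩
    refine ⟨Function.update p (K + 1) P, Function.update L (K + 1) Q, fun i hi hiK => ?_,
      fun M hM => ?_⟩
    · rcases Nat.lt_or_ge K i with hi' | hi'
      · obtain rfl : i = K + 1 := by omega
        simp only [Function.update_self]
        exact ⟨by omega, hQ2⟩
      · rw [(e i hi').1, (e i hi').2]
        exact hpL i hi hi'
    · have e1 : ∏ i ∈ Finset.Icc 1 M, θ (Function.update L (K + 1) Q i *
          Function.update p (K + 1) P i) = ∏ i ∈ Finset.Icc 1 M, θ (L i * p i) :=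
        Finset.prod_congr rfl fun i hi => by
          have := (Finset.mem_Icc.1 hi).2
          rw [(e i (by omega)).1, (e i (by omega)).2]
      have e2 : ∑ i ∈ Finset.Icc 1 M, Function.update L (K + 1) Q i *
          Function.update p (K + 1) P i = ∑ i ∈ Finset.Icc 1 M, L i * p i :=
        Finset.sum_congr rfl fun i hi => by
          have := (Finset.mem_Icc.1 hi).2
          rw [(e i (by omega)).1, (e i (by omega)).2]
      rw [e1, e2]
      rcases Nat.lt_or_ge M K with hM' | hM'
      · rw [(e (M + 1) hM').1, (e (M + 1) hM').2]
        exact h M hM'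
      · obtain rfl : M = K := by omega
        simp only [Function.update_self]
        exact ⟨hP1, hP2, hQ1.le⟩

/-- The number p_N is replaced last, beyond the finitely many thresholds in n left open by the
auxiliary construction. This is harmless because the conditions involve p_N only through n ≥ p_N:
all the other indices in them are below N. -/
theorem exists_isParam {θ F : ℕ → ℝ} (hθ : RegularSeq θ) (hdag : NotDagger θ)
    (hF : Tendsto F atTop (𝓝 0)) {N : ℕ} (hN : 1 ≤ N) : ∃ p L : ℕ → ℕ, IsParam θ F N p L := by
  have h1 := hθ.pos 1 le_rfl
  have hN' : (0 : ℝ) < N := by exact_mod_cast hN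
  obtain ⟨p, L, hpL, h⟩ := exists_isParam_aux hθ hdag hF
    (α := θ 1 / (24 * (N : ℝ) ^ 2)) (β := θ 1 / (144 * (N : ℝ) ^ 2)) (by positivity)
    (by positivity) N
  have hev : ∀ᶠ n in atTop, ∀ M ∈ Finset.range N, θ (p (M + 1) + n) / θ n ≤
      θ 1 / (24 * (N : ℝ) ^ 2) * ∏ i ∈ Finset.Icc 1 M, θ (L i * p i) :=
    (Filter.eventually_all_finset _).2 fun M hM => (h M (Finset.mem_range.1 hM)).1
  obtain ⟨P, hP⟩ := eventually_atTop.1 hev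
  have e : ∀ i, i < N → Function.update p N (P + 1) i = p i := fun i hi =>
    Function.update_of_ne (by omega) _ _
  have e1 : ∀ M, M < N → ∏ i ∈ Finset.Icc 1 M, θ (L i * Function.update p N (P + 1) i) =
      ∏ i ∈ Finset.Icc 1 M, θ (L i * p i) := fun M hM => Finset.prod_congr rfl fun i hi => by
    rw [e i (by have := (Finset.mem_Icc.1 hi).2; omega)]
  have e2 : ∀ M, M < N → ∑ i ∈ Finset.Icc 1 M, L i * Function.update p N (P + 1) i =
      ∑ i ∈ Finset.Icc 1 M, L i * p i := fun M hM => Finset.sum_congr rfl fun i hi => by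
    rw [e i (by have := (Finset.mem_Icc.1 hi).2; omega)]
  refine ⟨Function.update p N (P + 1), L, fun i hi hiN => ?_, fun i hi hiN => (hpL i hi hiN).2,
    fun M hM n hn => ?_, fun M _ hM => ?_, fun M hM => ?_⟩
  · rcases Nat.lt_or_ge i N with hi' | hi'
    · rw [e i hi']
      exact (hpL i hi hiN).1
    · obtain rfl : i = N := by omega
      simp
  · rw [Function.update_self] at hn
    rw [e _ (by omega), e1 _ (by omega)]
    exact hP n (by omega) M (Finset.mem_range.2 (by omega))
  · rw [e _ (by omega), e2 _ (by omega)]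
    exact (h M (by omega)).2.1
  · rw [e1 _ (by omega)]
    exact (h M (by omega)).2.2

/-! ### Existence of layered families -/

theorem exists_index_of_strictMono {s : ℕ → ℕ} (hs : StrictMono s) {j : ℕ} (hj : s 0 ≤ j) :
    ∃ i, s i ≤ j ∧ j < s (i + 1) := by
  have hex : ∃ i, j < s (i + 1) := ⟨j, (Nat.lt_succ_self j).trans_le (hs.id_le _)⟩
  classical
  refine ⟨Nat.find hex, ?_, Nat.find_spec hex⟩
  rcases Nat.eq_zero_or_pos (Nat.find hex) with h | h
  · rwa [h]
  · obtain ⟨n, hn⟩ := Nat.exists_eq_succ_of_ne_zero h.ne'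
    have := Nat.find_min hex (m := n) (by omega)
    rw [hn]
    exact not_lt.1 this

theorem index_unique_of_strictMono {s : ℕ → ℕ} (hs : StrictMono s) {i i' j : ℕ} (h1 : s i ≤ j)
    (h2 : j < s (i + 1)) (h3 : s i' ≤ j) (h4 : j < s (i' + 1)) : i = i' := by
  have h5 := hs.lt_iff_lt.1 (h1.trans_lt h4)
  have h6 := hs.lt_iff_lt.1 (h3.trans_lt h2)
  omega

/-- Consecutive intervals carrying coefficients can be chosen one after another, with coefficients
that are nonincreasing overall. -/
theorem exists_concat {j₀ : ℕ} {R : ℕ → ℕ → ℕ → (ℕ → ℝ) → Prop}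
    (hR : ∀ i u, j₀ ≤ u → ∃ v b, u < v ∧ (∀ j, u ≤ j → j + 1 < v → b (j + 1) ≤ b j) ∧ R i u v b)
    (hcongr : ∀ i u v b b', (∀ j, u ≤ j → j < v → b' j = b j) → u < v → R i u v b → R i u v b')
    (hglue : ∀ i u v w b, j₀ ≤ u → u < v → v < w → R i u v b → R (i + 1) v w b → b v ≤ b (v - 1)) :
    ∃ (s : ℕ → ℕ) (b : ℕ → ℝ), StrictMono s ∧ s 0 = j₀ ∧
      (∀ j, j₀ ≤ j → b (j + 1) ≤ b j) ∧ ∀ i, R i (s i) (s (i + 1)) b := by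
  choose! v c hv hc hRc using hR
  let s : ℕ → ℕ := fun i => Nat.rec j₀ (fun i u => v i u) i
  have hs0 : s 0 = j₀ := rfl
  have hs1 : ∀ i, s (i + 1) = v i (s i) := fun i => rfl
  have hge : ∀ i, j₀ ≤ s i := by
    intro i
    induction i with
    | zero => exact le_rfl
    | succ i ih => exact ih.trans (hv i _ ih).le
  have hs : StrictMono s := strictMono_nat_of_lt_succ fun i => hv i _ (hge i)
  -- Exactly one block contains j ≥ j₀ and prescribes the value there; below j₀ the value is
  -- arbitrary.
  have hb : ∀ j, ∃ t : ℝ, ∀ i, s i ≤ j → j < s (i + 1) → t = c i (s i) j := by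
    intro j
    by_cases hj : j₀ ≤ j
    · obtain ⟨i, h1, h2⟩ := exists_index_of_strictMono hs hj
      refine ⟨c i (s i) j, fun i' h3 h4 => ?_⟩
      rw [index_unique_of_strictMono hs h1 h2 h3 h4]
    · exact ⟨0, fun i hi => absurd ((hge i).trans hi) hj⟩
  choose b hb using hb
  have hRb : ∀ i, R i (s i) (s (i + 1)) b := fun i =>
    hcongr i _ _ (c i (s i)) b (fun j h1 h2 => hb j i h1 h2) (hs i.lt_succ_self)
      (hRc i _ (hge i))
  refine ⟨s, b, hs, hs0, fun j hj => ?_, hRb⟩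
  obtain ⟨i, h1, h2⟩ := exists_index_of_strictMono hs hj
  rcases Nat.lt_or_ge (j + 1) (s (i + 1)) with h3 | h3
  · rw [hb (j + 1) i (by omega) h3, hb j i h1 h2]
    exact hc i _ (hge i) j h1 h3
  · have h4 : s (i + 1) = j + 1 := by omega
    have h5 := hglue i _ _ _ b (hge i) (hs i.lt_succ_self) (hs (i + 1).lt_succ_self) (hRb i)
      (hRb (i + 1))
    rwa [h4, Nat.add_sub_cancel] at h5

theorem sum_Ico_strictMono {s : ℕ → ℕ} (hs : StrictMono s) {A : Type*} [AddCommMonoid A]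
    (f : ℕ → A) (k : ℕ) :
    ∑ i ∈ Finset.range k, ∑ j ∈ Finset.Ico (s i) (s (i + 1)), f j =
      ∑ j ∈ Finset.Ico (s 0) (s k), f j := by
  induction k with
  | zero => simp
  | succ k ih =>
    rw [Finset.sum_range_succ, ih, Finset.sum_Ico_consecutive _ (hs.monotone (Nat.zero_le k))
      (hs.monotone (Nat.le_succ k))]

theorem support_sum_single {m : ℕ → ℕ} {s : Finset ℕ} {b : ℕ → ℝ} (hb : ∀ j ∈ s, 0 < b j) :
    (∑ j ∈ s, Finsupp.single (m j) (b j)).support = s.image m := by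
  rw [support_sum_of_nonneg fun j hj v => ?_]
  · ext v
    simp only [Finset.mem_biUnion, Finset.mem_image]
    refine exists_congr fun j => and_congr_right fun hj => ?_
    rw [Finsupp.support_single _ (hb j hj).ne', Finset.mem_singleton, eq_comm]
  · rw [Finsupp.single_apply]
    split_ifs
    exacts [(hb j hj).le, le_rfl]

/-- The coefficients of a repeated average over the points `m u < ⋯ < m (v - 1)`, with bounds on
the first and the last of them. -/
def IsAverageOn (m : ℕ → ℕ) (q u v : ℕ) (b : ℕ → ℝ) : Prop :=
  IsRepeatedAverage q (∑ j ∈ Finset.Ico u v, Finsupp.single (m j) (b j)) ∧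
    (∀ j, u ≤ j → j < v → 0 < b j) ∧ b u = ((m u : ℝ) ^ q)⁻¹ ∧
    ((m (v - 1) : ℝ) ^ q)⁻¹ ≤ b (v - 1)

theorem IsAverageOn.congr {m : ℕ → ℕ} {q u v : ℕ} {b b' : ℕ → ℝ}
    (h : ∀ j, u ≤ j → j < v → b' j = b j) (huv : u < v) (hb : IsAverageOn m q u v b) :
    IsAverageOn m q u v b' := by
  obtain ⟨h1, h2, h3, h4⟩ := hb
  refine ⟨?_, fun j hj hjv => ?_, ?_, ?_⟩
  · rwa [Finset.sum_congr rfl fun j hj => by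
      rw [h j (Finset.mem_Ico.1 hj).1 (Finset.mem_Ico.1 hj).2]]
  · rw [h j hj hjv]
    exact h2 j hj hjv
  · rwa [h u le_rfl huv]
  · rwa [h (v - 1) (by omega) (by omega)]

theorem exists_isAverageOn {m : ℕ → ℕ} (hm : ∀ i j, 1 ≤ i → i < j → m i < m j)
    (hm1 : ∀ j, 1 ≤ j → 1 ≤ m j) (q : ℕ) {u : ℕ} (hu : 1 ≤ u) :
    ∃ v b, u < v ∧ (∀ j, u ≤ j → j + 1 < v → b (j + 1) ≤ b j) ∧ IsAverageOn m q u v b := by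
  have hmono : ∀ i j, 1 ≤ i → i ≤ j → m i ≤ m j := fun i j hi hij => by
    rcases hij.eq_or_lt with rfl | h
    exacts [le_rfl, (hm i j hi h).le]
  have hpos : ∀ j, 1 ≤ j → (0 : ℝ) < m j := fun j hj => by exact_mod_cast hm1 j hj
  induction q generalizing u with
  | zero =>
    refine ⟨u + 1, fun _ => 1, by omega, fun _ _ _ => le_rfl, ⟨m u, hm1 u hu, ?_⟩,
      fun _ _ _ => one_pos, by simp, by simp⟩
    simp
  | succ q ih =>
    obtain ⟨s, b, hs, hs0, hb, hsb⟩ := exists_concat (j₀ := u)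
      (R := fun _ u v b => IsAverageOn m q u v b) (fun _ w hw => ih (hu.trans hw))
      (fun _ _ _ _ _ h huv hb => hb.congr h huv)
      (fun _ w v _ b hw hwv _ h1 h2 => by
        -- The next average of the same order starts with (m v)^{-q}, which is at most (m (v -
        -- 1))^{-q}, hence at most the last coefficient of the preceding one. This is why the first
        -- coefficient is recorded exactly and the last only from below.
        rw [h2.2.2.1]
        refine le_trans ?_ h1.2.2.2
        have h3 := hpos (v - 1) (by omega)
        have h4 : (m (v - 1) : ℝ) ≤ m v := by exact_mod_cast hmono _ _ (by omega) (by omega)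
        gcongr)
    have hk : 0 < m u := hm1 u hu
    have hus : u < s (m u) := hs0.symm.trans_lt (hs hk)
    have hbpos : ∀ j, u ≤ j → 0 < b j := fun j hj => by
      obtain ⟨i, h1, h2⟩ := exists_index_of_strictMono hs (hs0.le.trans hj)
      exact (hsb i).2.1 j h1 h2
    have hge : ∀ i, u ≤ s i := fun i => hs0.symm.trans_le (hs.monotone (Nat.zero_le i))
    have hsupp : ∀ i, (∑ j ∈ Finset.Ico (s i) (s (i + 1)),
        Finsupp.single (m j) (b j)).support = (Finset.Ico (s i) (s (i + 1))).image m := fun i =>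
      support_sum_single fun j hj => hbpos j ((hge i).trans (Finset.mem_Ico.1 hj).1)
    have hinv : (0 : ℝ) < (m u : ℝ)⁻¹ := inv_pos.2 (hpos u hu)
    refine ⟨s (m u), fun j => (m u : ℝ)⁻¹ * b j, hus, fun j hj _ =>
      mul_le_mul_of_nonneg_left (hb j hj) hinv.le,
      ⟨m u, hk, fun i => ∑ j ∈ Finset.Ico (s i) (s (i + 1)), Finsupp.single (m j) (b j),
        fun i => (hsb i).1, fun i i' hii => ?_, ?_, ?_⟩, fun j hj _ => mul_pos hinv (hbpos j hj),
      ?_, ?_⟩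
    · rw [hsupp, hsupp]
      intro x hx y hy
      obtain ⟨j, hj, rfl⟩ := Finset.mem_image.1 hx
      obtain ⟨j', hj', rfl⟩ := Finset.mem_image.1 hy
      rw [Finset.mem_Ico] at hj hj'
      have h1 : s (i + 1) ≤ s i' := hs.monotone (Nat.succ_le_of_lt hii)
      exact hm _ _ (hu.trans ((hge i).trans hj.1)) (by omega)
    · rw [hsupp]
      refine minOf_eq (Finset.mem_image.2 ⟨u, Finset.mem_Ico.2 ⟨hs0.le, ?_⟩, rfl⟩) fun x hx => ?_
      · exact hs0.symm.trans_lt (hs (Nat.lt_succ_self 0))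
      · obtain ⟨j, hj, rfl⟩ := Finset.mem_image.1 hx
        exact hmono _ _ hu ((hge _).trans (Finset.mem_Ico.1 hj).1)
    · rw [Fin.sum_univ_eq_sum_range fun i => ∑ j ∈ Finset.Ico (s i) (s (i + 1)),
        Finsupp.single (m j) (b j), sum_Ico_strictMono hs, hs0, Finset.smul_sum]
      exact Finset.sum_congr rfl fun j _ => by rw [Finsupp.smul_single, smul_eq_mul]
    · have h1 := (hsb 0).2.2.1
      rw [hs0] at h1
      change (m u : ℝ)⁻¹ * b u = _
      rw [h1, pow_succ', mul_inv]
    · obtain ⟨n, hn⟩ := Nat.exists_eq_succ_of_ne_zero hk.ne'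
      have h1 := (hsb n).2.2.2
      rw [← Nat.succ_eq_add_one, ← hn] at h1
      have h2 : (m u : ℝ) ≤ m (s (m u) - 1) := by
        exact_mod_cast hmono _ _ hu (by omega)
      rw [pow_succ', mul_inv]
      exact mul_le_mul (inv_anti₀ (hpos u hu) h2) h1 (by positivity) hinv.le

/-- A sequence of positive integers that grows at least like the iteration of `t ↦ B t ^ Q`. -/
structure Sparse (B Q : ℕ) (m : ℕ → ℕ) : Prop where
  one_le : ∀ j, 1 ≤ j → 1 ≤ m j
  lt : ∀ i j, 1 ≤ i → i < j → m i < m j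
  mul_pow_le : ∀ i j, 1 ≤ i → i < j → B * m i ^ Q ≤ m j

theorem exists_sparse {V : Set ℕ} (hV : V.Infinite) (hVpos : ∀ v ∈ V, 1 ≤ v) (B Q : ℕ) :
    ∃ n : ℕ → ℕ, Sparse B Q n ∧ ∀ j, n j ∈ V := by
  have h : ∀ t, ∃ v ∈ V, max t (B * t ^ Q) < v := fun t => hV.exists_gt _
  choose f hfV hf using h
  let n : ℕ → ℕ := fun j => Nat.rec (f 0) (fun _ t => f t) j
  have hnV : ∀ j, n j ∈ V := fun j => by
    cases j
    exacts [hfV _, hfV _]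
  have hn : ∀ j, max (n j) (B * n j ^ Q) < n (j + 1) := fun j => hf _
  have hmono : StrictMono n := strictMono_nat_of_lt_succ fun j => (le_max_left _ _).trans_lt (hn j)
  exact ⟨n, ⟨fun j _ => hVpos _ (hnV j), fun i j _ hij => hmono hij, fun i j _ hij =>
    ((le_max_right _ _).trans (hn i).le).trans (hmono.monotone hij)⟩, hnV⟩

theorem Sparse.comp {B Q : ℕ} {m s : ℕ → ℕ} (hm : Sparse B Q m) (hs : ∀ j, 1 ≤ j → 1 ≤ s j)
    (hs' : ∀ i j, 1 ≤ i → i < j → s i < s j) : Sparse B Q fun j => m (s j) :=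
  ⟨fun j hj => hm.one_le _ (hs j hj), fun i j hi hij => hm.lt _ _ (hs i hi) (hs' i j hi hij),
    fun i j hi hij => hm.mul_pow_le _ _ (hs i hi) (hs' i j hi hij)⟩

/-- Within a block the coefficients of a repeated average are nonincreasing; only the boundaries
between blocks, where the order and the factor θ change, need sparseness. The new minima are a
subsequence of the old ones, so sparseness is inherited and the construction can be repeated. -/
theorem exists_layer {θ : ℕ → ℝ} (hθ : RegularSeq θ) {B Q p l : ℕ} (hp : 1 ≤ p) (hl : 1 ≤ l)
    (hB : (θ (l * p))⁻¹ ≤ B) (hQ : l * p ≤ Q) {y : ℕ → (ℕ →₀ ℝ)}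
    (hy : ∀ j, 1 ≤ j → (y j).support.Nonempty ∧ ∀ t, 0 ≤ y j t)
    (hm : Sparse B Q fun j => minOf (y j).support) :
    ∃ z : ℕ → (ℕ →₀ ℝ), (∀ k, 1 ≤ k → (z k).support.Nonempty ∧ ∀ t, 0 ≤ z k t) ∧
      (Sparse B Q fun k => minOf (z k).support) ∧
      ∃ (I : ℕ → Finset ℕ) (a : ℕ → ℝ),
        (∀ k, 1 ≤ k → ∃ u v, u ≤ v ∧ I k = Finset.Icc u v) ∧
        (∀ k, 1 ≤ k → SetLT (I k) (I (k + 1))) ∧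
        (∀ j, 1 ≤ j ↔ ∃ k, 1 ≤ k ∧ j ∈ I k) ∧
        (∀ i j, 1 ≤ i → i ≤ j → a j ≤ a i) ∧
        ∀ k, 1 ≤ k → z k = ∑ j ∈ I k, a j • y j ∧
          IsRepeatedAverage (residue l k * p) (θ (residue l k * p) •
            ∑ j ∈ I k, Finsupp.single (minOf (y j).support) (a j)) := by
  set m : ℕ → ℕ := fun j => minOf (y j).support with hmdef
  have hq1 : ∀ k, 1 ≤ residue l k * p := fun k => Nat.mul_pos (one_le_residue l k) hp
  have hq2 : ∀ k, residue l k * p ≤ l * p := fun k => Nat.mul_le_mul_right p (residue_le hl)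
  have hθq : ∀ k, 0 < θ (residue l k * p) := fun k => hθ.pos _ (hq1 k)
  have hmono : ∀ i j, 1 ≤ i → i ≤ j → m i ≤ m j := fun i j hi hij => by
    rcases hij.eq_or_lt with rfl | h
    exacts [le_rfl, (hm.lt i j hi h).le]
  obtain ⟨s, a, hs, hs0, ha, hsa⟩ := exists_concat (j₀ := 1)
    (R := fun i u v b => IsAverageOn m (residue l (i + 1) * p) u v
      fun j => θ (residue l (i + 1) * p) * b j)
    (fun i u hu => by
      obtain ⟨v, b, h1, h2, h3⟩ := exists_isAverageOn hm.lt hm.one_le (residue l (i + 1) * p) hu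
      refine ⟨v, fun j => (θ (residue l (i + 1) * p))⁻¹ * b j, h1, fun j hj hjv =>
        mul_le_mul_of_nonneg_left (h2 j hj hjv) (inv_pos.2 (hθq _)).le, ?_⟩
      exact h3.congr (fun j _ _ => mul_inv_cancel_left₀ (hθq _).ne' _) h1)
    (fun i u v b b' h huv hb => hb.congr (fun j hj hjv => by rw [h j hj hjv]) huv)
    (fun i u v w b hu huv hvw h1 h2 => by
      have hv1 : 1 ≤ v - 1 := by omega
      have e1 := h2.2.2.1
      have e2 := h1.2.2.2
      have hpos : (0 : ℝ) < m (v - 1) := by exact_mod_cast hm.one_le _ hv1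
      have hpos1 : (1 : ℝ) ≤ m (v - 1) := by exact_mod_cast hm.one_le _ hv1
      have hpos' : (1 : ℝ) ≤ m v := by exact_mod_cast hm.one_le _ (by omega)
      have hsp : (B : ℝ) * (m (v - 1) : ℝ) ^ Q ≤ m v := by
        exact_mod_cast hm.mul_pow_le (v - 1) v hv1 (by omega)
      have hB' : (θ (residue l (i + 1 + 1) * p))⁻¹ ≤ B :=
        (inv_anti₀ (hθ.pos _ (Nat.mul_pos hl hp)) (hθ.antitone _ _ (hq1 _) (hq2 _))).trans hB
      have hbv : 0 < b (v - 1) := by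
        have := h1.2.1 (v - 1) (by omega) (by omega)
        exact (mul_pos_iff_of_pos_left (hθq _)).1 this
      -- The first coefficient of a new block is at most B / m_v, the last one of the old block at
      -- least m_{v-1}^{-Q}; the condition B m_{v-1}^Q ≤ m_v separates them.
      calc b v = (θ (residue l (i + 1 + 1) * p))⁻¹ *
            ((m v : ℝ) ^ (residue l (i + 1 + 1) * p))⁻¹ := by
            rw [← e1, inv_mul_cancel_left₀ (hθq _).ne']
        _ ≤ B * (m v : ℝ)⁻¹ := by
            refine mul_le_mul hB' (inv_anti₀ (by linarith) ?_) (by positivity) (Nat.cast_nonneg B)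
            exact le_self_pow₀ hpos' (by have := hq1 (i + 1 + 1); omega)
        _ ≤ ((m (v - 1) : ℝ) ^ Q)⁻¹ := by
            rw [← div_eq_mul_inv, div_le_iff₀ (by linarith), ← div_eq_inv_mul,
              le_div_iff₀ (by positivity)]
            exact hsp
        _ ≤ ((m (v - 1) : ℝ) ^ (residue l (i + 1) * p))⁻¹ :=
            inv_anti₀ (by positivity) (pow_le_pow_right₀ hpos1 ((hq2 _).trans hQ))
        _ ≤ θ (residue l (i + 1) * p) * b (v - 1) := e2
        _ ≤ b (v - 1) := mul_le_of_le_one_left hbv.le (hθ.lt_one _ (hq1 _)).le)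
  have hge : ∀ i, 1 ≤ s i := fun i => hs0 ▸ hs.monotone (Nat.zero_le i)
  have hapos : ∀ j, 1 ≤ j → 0 < a j := fun j hj => by
    obtain ⟨i, h1, h2⟩ := exists_index_of_strictMono hs (hs0.le.trans hj)
    exact (mul_pos_iff_of_pos_left (hθq _)).1 ((hsa i).2.1 j h1 h2)
  have hk : ∀ k, 1 ≤ k → ∃ i, k = i + 1 := fun k hk => ⟨k - 1, by omega⟩
  have hne : ∀ i, s i < s (i + 1) := fun i => hs i.lt_succ_self
  have hsupp : ∀ i, (∑ j ∈ Finset.Ico (s i) (s (i + 1)), a j • y j).support =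
      (Finset.Ico (s i) (s (i + 1))).biUnion fun j => (y j).support := fun i => by
    rw [support_sum_of_nonneg fun j hj t => ?_]
    · refine Finset.biUnion_congr rfl fun j hj => support_smul_pos (hapos j ?_) _
      exact (hge i).trans (Finset.mem_Ico.1 hj).1
    · have hj1 := (hge i).trans (Finset.mem_Ico.1 hj).1
      exact mul_nonneg (hapos j hj1).le ((hy j hj1).2 t)
  have hmem : ∀ i, s i ∈ Finset.Ico (s i) (s (i + 1)) := fun i =>
    Finset.mem_Ico.2 ⟨le_rfl, hne i⟩
  have hmin : ∀ i, minOf (∑ j ∈ Finset.Ico (s i) (s (i + 1)), a j • y j).support = m (s i) := by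
    intro i
    rw [hsupp]
    refine minOf_eq (Finset.mem_biUnion.2 ⟨s i, hmem i, minOf_mem (hy _ (hge i)).1⟩) fun t ht => ?_
    obtain ⟨j, hj, htj⟩ := Finset.mem_biUnion.1 ht
    exact (hmono _ _ (hge i) (Finset.mem_Ico.1 hj).1).trans (minOf_le htj)
  refine ⟨fun k => ∑ j ∈ Finset.Ico (s (k - 1)) (s (k - 1 + 1)), a j • y j, fun k _ => ⟨?_, ?_⟩,
    ?_, fun k => Finset.Ico (s (k - 1)) (s (k - 1 + 1)), a, fun k _ => ?_, fun k hk1 => ?_,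
    fun j => ⟨fun hj => ?_, ?_⟩, fun i j hi hij => ?_, fun k hk1 => ⟨rfl, ?_⟩⟩
  · rw [hsupp]
    obtain ⟨t, ht⟩ := (hy _ (hge (k - 1))).1
    exact ⟨t, Finset.mem_biUnion.2 ⟨_, hmem _, ht⟩⟩
  · intro t
    rw [Finsupp.finsetSum_apply]
    refine Finset.sum_nonneg fun j hj => ?_
    have hj1 := (hge _).trans (Finset.mem_Ico.1 hj).1
    exact mul_nonneg (hapos j hj1).le ((hy j hj1).2 t)
  · simp only [hmin]
    exact hm.comp (fun j _ => hge _) fun i j _ hij => hs (by omega)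
  · refine ⟨s (k - 1), s (k - 1 + 1) - 1, by have := hne (k - 1); omega, ?_⟩
    ext j
    have := hne (k - 1)
    rw [Finset.mem_Ico, Finset.mem_Icc]
    omega
  · obtain ⟨i, rfl⟩ := hk k hk1
    intro j hj j' hj'
    simp only [Nat.add_sub_cancel, Finset.mem_Ico] at hj hj'
    omega
  · obtain ⟨i, h1, h2⟩ := exists_index_of_strictMono hs (hs0.le.trans hj)
    exact ⟨i + 1, by omega, by simpa using ⟨h1, h2⟩⟩
  · rintro ⟨k, _, hj⟩
    exact (hge _).trans (Finset.mem_Ico.1 hj).1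
  · induction j, hij using Nat.le_induction with
    | base => exact le_rfl
    | succ j hij ih => exact (ha j (hi.trans hij)).trans ih
  · obtain ⟨i, rfl⟩ := hk k hk1
    have h1 := (hsa i).1
    rw [Finset.smul_sum]
    simpa only [Nat.add_sub_cancel, Finsupp.smul_single, smul_eq_mul] using h1

/-- The sums defining B and Q dominate all the values θ(L_i p_i)⁻¹ and L_i p_i at once, so a single
sparse subsequence of V serves every layer. -/
theorem exists_isLayered {θ : ℕ → ℝ} (hθ : RegularSeq θ) {N : ℕ} {V : Set ℕ} (hV : V.Infinite)
    (hVpos : ∀ v ∈ V, 1 ≤ v) {p L : ℕ → ℕ} (hp : ∀ i, 1 ≤ i → i ≤ N → 1 ≤ p i)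
    (hL : ∀ i, 1 ≤ i → i ≤ N → 1 ≤ L i) :
    ∃ x : ℕ → ℕ → (ℕ →₀ ℝ), IsLayered θ N V p L x := by
  obtain ⟨B, hB⟩ := exists_nat_ge (∑ i ∈ Finset.Icc 1 N, (θ (L i * p i))⁻¹)
  obtain ⟨n, hn, hnV⟩ := exists_sparse hV hVpos B (∑ i ∈ Finset.Icc 1 N, L i * p i)
  suffices h : ∀ K ≤ N, ∃ x : ℕ → ℕ → (ℕ →₀ ℝ), IsLayered θ K V p L x ∧
      (∀ j, 1 ≤ j → (x K j).support.Nonempty ∧ ∀ t, 0 ≤ x K j t) ∧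
      Sparse B (∑ i ∈ Finset.Icc 1 N, L i * p i) fun j => minOf (x K j).support by
    obtain ⟨x, hx, -⟩ := h N le_rfl
    exact ⟨x, hx⟩
  intro K
  induction K with
  | zero =>
    intro _
    have hs : ∀ j, (Finsupp.single (n j) (1 : ℝ)).support = {n j} := fun j =>
      Finsupp.support_single _ one_ne_zero
    refine ⟨fun _ j => Finsupp.single (n j) 1,
      ⟨⟨n, hn.lt, fun j _ => ⟨hnV j, rfl⟩⟩, by omega⟩, fun j _ => ⟨?_, fun t => ?_⟩, ?_⟩
    · rw [hs]
      exact Finset.singleton_nonempty _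
    · rw [Finsupp.single_apply]
      split_ifs
      exacts [zero_le_one, le_rfl]
    · have hmin : ∀ j, minOf (Finsupp.single (n j) (1 : ℝ)).support = n j := fun j => by
        rw [hs]
        exact minOf_eq (Finset.mem_singleton_self _) fun v hv => (Finset.mem_singleton.1 hv).ge
      simpa only [hmin] using hn
  | succ K ih =>
    intro hK
    obtain ⟨x, hx, hne, hsp⟩ := ih (by omega)
    have hmem : K + 1 ∈ Finset.Icc 1 N := Finset.mem_Icc.2 ⟨by omega, hK⟩
    obtain ⟨z, hz, hzsp, hstep⟩ := exists_layer hθ (hp (K + 1) (by omega) hK)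
      (hL (K + 1) (by omega) hK)
      ((Finset.single_le_sum (f := fun i => (θ (L i * p i))⁻¹) (fun i hi => by
        obtain ⟨h1, h2⟩ := Finset.mem_Icc.1 hi
        exact (inv_pos.2 (hθ.pos _ (Nat.mul_pos (hL i h1 h2) (hp i h1 h2)))).le) hmem).trans hB)
      (Finset.single_le_sum (f := fun i => L i * p i) (fun _ _ => Nat.zero_le _) hmem) hne hsp
    have e : ∀ M, M ≤ K → Function.update x (K + 1) z M = x M := fun M hM =>
      Function.update_of_ne (by omega) _ _
    refine ⟨Function.update x (K + 1) z, ⟨?_, fun M hM => ?_⟩, ?_, ?_⟩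
    · rw [e 0 (Nat.zero_le K)]
      exact hx.base
    · rw [e M (by omega)]
      rcases Nat.lt_or_ge M K with h | h
      · rw [e (M + 1) h]
        exact hx.step M h
      · obtain rfl : M = K := by omega
        rw [Function.update_self]
        exact hstep
    · rwa [Function.update_self]
    · rwa [Function.update_self]

end MixedTsirelson

open MixedTsirelson in
theorem mainTheorem2 (θ F : ℕ → ℝ) (hθ : RegularSeq θ) (hdag : NotDagger θ)
    (hddag : DoubleDagger θ F) (N : ℕ) (hN : 1 ≤ N)
    (V : Set ℕ) (hV : V.Infinite) (hVpos : ∀ v ∈ V, 1 ≤ v) :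
    (∃ p L : ℕ → ℕ, IsParam θ F N p L) ∧
    ∀ p L : ℕ → ℕ, IsParam θ F N p L →
      (∃ x : ℕ → ℕ → (ℕ →₀ ℝ), IsLayered θ N V p L x) ∧
      ∀ x : ℕ → ℕ → (ℕ →₀ ℝ), IsLayered θ N V p L x →
        ∀ k : ℕ, 42 * (N : ℝ) ^ 2 * ∏ i ∈ Finset.Icc 1 N, (L i : ℝ) * (θ (L i * p i))⁻¹ ≤ k →
          x N k ≠ 0 ∧
          x N k ∈ Submodule.span ℝ ((fun v : ℕ => (Finsupp.single v 1 : ℕ →₀ ℝ)) '' V) ∧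
          normX θ (x N k) ≤
            (2 / (N : ℝ) + 4 * (θ 1)⁻¹ * supRatio θ N p L (residue (L N) k)) *
              normXM θ (x N k) := by
  refine ⟨exists_isParam hθ hdag hddag.1 hN, fun p L hpar =>
    ⟨exists_isLayered hθ hV hVpos hpar.p_pos fun i hi hiN =>
      (hpar.two_le_L i hi hiN).trans' one_le_two, fun x hx k hk =>
        hx.normX_le hθ hddag hN hVpos hpar hk⟩⟩
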